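/- Let $1\le p\le n$ be integers and let $\Omega\subset\mathbb R^n$ be a bounded domain. For $u\in C^2(\Omega)$ put $w=\sqrt{1+|Du|^2}$, let $\nu=(-Du,1)/w\in\mathbb S^n$ be the upward unit normal of the graph of $u$, and let $\kappa_1,\dots,\kappa_n$ be its principal curvatures, i.e. the eigenvalues of $h_{ij}=u_{ij}/w$ with respect to $g_{ij}=\delta_{ij}+u_iu_j$. Call $u$ admissible if $\kappa_{i_1}+\cdots+\kappa_{i_p}\ge 0$ in $\Omega$ for all $i_1<\cdots<i_p$. Let $u\in C^4(\Omega)\cap C^2(\bar\Omega)$ be an admissible solution of $$\prod_{1\le i_1<\cdots<i_p\le n}(\kappa_{i_1}+\cdots+\kappa_{i_p})=f\quad\text{in }\Omega,$$ where $f>0$ is smooth and either (a) $f=f(x,u,\nu)$ is a function on $\Omega\times\mathbb R\times\mathbb S^n$ and $p\ge \frac n2$, or (b) $f=f(x,u)$ is a function on $\Omega\times\mathbb R$ (and $1\le p\le n$ is arbitrary). Then $$\sup_\Omega|D^2u|\le C\Bigl(1+\sup_{\partial\Omega}|D^2u|\Bigr),$$ where in case (b) the constant $C>0$ depends only on $n$,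 $p$, an upper bound for $|u|_{C^1}$, a positive lower bound for $\inf f$ and an upper bound for $|f|_{C^2}$, and in case (a) only on these quantities and an upper bound for the diameter of $\Omega$. Here $\inf f$ and $|f|_{C^2}$ are taken over the points with $x\in\Omega$, $|z|\le K_0$ (and, in case (a), $\nu\in\mathbb S^n$), where $K_0$ is an upper bound for $\sup_\Omega|u|$. -/

import Mathlib

open scoped ContDiff

noncomputable section

namespace PrescribedCurvature

/-- Euclidean space `ℝⁿ`. -/
abbrev Space (n : ℕ) : Type := EuclideanSpace ℝ (Fin n)

/-- Euclidean space `ℝⁿ⁺¹ = ℝⁿ × ℝ`, in which graphs over subsets of `ℝⁿ` live. -/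
abbrev Ambient (n : ℕ) : Type := WithLp 2 (Space n × ℝ)

/-- The partial derivative `u_i`. -/
def partialDeriv {n : ℕ} (u : Space n → ℝ) (i : Fin n) (x : Space n) : ℝ :=
  fderiv ℝ u x (EuclideanSpace.single i 1)

/-- The second derivative `D²u(x)`, a bilinear form. -/
def hess {n : ℕ} (u : Space n → ℝ) (x : Space n) : Space n →L[ℝ] Space n →L[ℝ] ℝ :=
  fderiv ℝ (fderiv ℝ u) x

/-- `w = √(1 + |Du|²)`. -/
def areaElement {n : ℕ} (u : Space n → ℝ) (x : Space n) : ℝ :=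
  √(1 + ‖gradient u x‖ ^ 2)

/-- The upward unit normal `ν = (-Du, 1) / w` of the graph of `u` at `(x, u(x))`. -/
def upwardNormal {n : ℕ} (u : Space n → ℝ) (x : Space n) : Ambient n :=
  WithLp.toLp 2 (-((areaElement u x)⁻¹ • gradient u x), (areaElement u x)⁻¹)

/-- The induced metric `g_ij = δ_ij + u_i u_j` of the graph of `u`. -/
def inducedMetric {n : ℕ} (u : Space n → ℝ) (x : Space n) : Matrix (Fin n) (Fin n) ℝ :=
  Matrix.of fun i j => (if i = j then 1 else 0) + partialDeriv u i x * partialDeriv u j x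

/-- The second fundamental form `h_ij = u_ij / w` of the graph of `u`. -/
def secondFundamentalForm {n : ℕ} (u : Space n → ℝ) (x : Space n) :
    Matrix (Fin n) (Fin n) ℝ :=
  Matrix.of fun i j =>
    hess u x (EuclideanSpace.single i 1) (EuclideanSpace.single j 1) / areaElement u x

/-- The principal curvatures `κ_1, …, κ_n` of the graph of `u` over `x`: the eigenvalues of `h`
with respect to `g`, with multiplicity (all `n` of them are real where `u` is `C²`). -/
def principalCurvatures {n : ℕ} (u : Space n → ℝ) (x : Space n) : Multiset ℝ :=
  ((inducedMetric u x)⁻¹ * secondFundamentalForm u x).charpoly.roots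

/-- The sums `κ_{i_1} + ⋯ + κ_{i_p}`, `i_1 < ⋯ < i_p`, with multiplicity. -/
def pSums (p : ℕ) (κ : Multiset ℝ) : Multiset ℝ :=
  (κ.powersetCard p).map Multiset.sum

/-- The curvature operator `∏_{i_1 < ⋯ < i_p} (κ_{i_1} + ⋯ + κ_{i_p})` of the graph of `u`. -/
def curvatureOperator {n : ℕ} (p : ℕ) (u : Space n → ℝ) (x : Space n) : ℝ :=
  (pSums p (principalCurvatures u x)).prod

/-- `u` is admissible on `Ω`: its graph is `p`-convex. (Where the curvature operator is positive,
as it is for solutions of the equation with `f > 0`, all the sums are then strictly positive.) -/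
def Admissible {n : ℕ} (p : ℕ) (Ω : Set (Space n)) (u : Space n → ℝ) : Prop :=
  ∀ x ∈ Ω, ∀ s ∈ pSums p (principalCurvatures u x), 0 ≤ s

/-- `u ∈ C²(closure Ω)`, `Ω` open: `u ∈ C²(Ω)`, and `u`, `Du`, `D²u` extend continuously from `Ω`
to its closure. -/
def IsC2UpToBoundary {n : ℕ} (Ω : Set (Space n)) (u : Space n → ℝ) : Prop :=
  ContDiffOn ℝ 2 u Ω ∧
  (∃ v : Space n → ℝ, ContinuousOn v (closure Ω) ∧ Set.EqOn v u Ω) ∧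
  (∃ v : Space n → (Space n →L[ℝ] ℝ), ContinuousOn v (closure Ω) ∧
    Set.EqOn v (fderiv ℝ u) Ω) ∧
  (∃ v : Space n → (Space n →L[ℝ] Space n →L[ℝ] ℝ), ContinuousOn v (closure Ω) ∧
    Set.EqOn v (hess u) Ω)

/-- `sup_{∂Ω} |D²u|`, where on `∂Ω` the value of `D²u` is its limit from inside `Ω`. -/
def boundarySupHess {n : ℕ} (Ω : Set (Space n)) (u : Space n → ℝ) : ℝ :=
  sSup ((fun y => ‖extendFrom Ω (hess u) y‖) '' frontier Ω)

/-- A function `f(x, z, ν)` of `x ∈ ℝⁿ`, `z ∈ ℝ` and a unit vector `ν ∈ Sⁿ`, extended to all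
`ν ≠ 0` as a function that is homogeneous of degree zero in `ν`. Only the values of `f` at unit
vectors are used. Regularity of `f` on the sphere, and the size of its derivatives there, are
those of this extension. -/
def sphereExtension {n : ℕ} (f : Space n × ℝ × Ambient n → ℝ) : Space n × ℝ × Ambient n → ℝ :=
  fun q => f (q.1, q.2.1, ‖q.2.2‖⁻¹ • q.2.2)

end PrescribedCurvature

end

/-!
The estimate is a maximum principle argument. Let `h` and `g` be the second fundamental form and the
metric of the graph, and consider the maximum of `h(ξ, ξ) / (V g(ξ, ξ))` over `x ∈ closure Ω` and
directions `ξ`, with the weight `V = (1 / w - a) exp (-B |x - z|² / 2)`. The weight is bounded above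
and below by the data, so a maximum over the boundary is controlled by `sup_{∂Ω} |D²u|`, and it is
enough to bound the largest principal curvature `k` at an interior maximum point
(`norm_hess_le_of_interior_bound`). By admissibility `k` controls all principal curvatures.

At such a point the graph is written as the graph of a function `v` over its tangent plane
(`exists_isTangentGraph`), where `Dv = 0` and `D²v` is diagonal with entries `κ_i`. Derivatives are
handled as second order jets `HasJet` of functions along lines. Write `λ_I` for the sums of `p`
principal curvatures and `F^{ii} = ∑_{I ∋ i} 1 / λ_I` (`linCoeff`). The curvature operator itself is
never differentiated: its logarithm `∑_I log λ_I` is a concave function of the symmetric matrix `h`,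
so it lies below its linearization `∑ F^{ii} h(e_i, e_i)`, in any moving orthonormal frame `e_i`,
with equality at the point (`log_prod_pSums_le`; this rests on Birkhoff's theorem on doubly
stochastic matrices). Comparing second order jets gives the twice differentiated equation as an
inequality. The frame may turn with an arbitrary angular velocity `τ`, and the terms in `τ` do the
work of the second derivatives of the operator. In combination with the first and second order
conditions at the maximum the fourth derivatives of `v` cancel (`main_inequality`), and what is left
is an inequality between real numbers (`MaxInequality`).

If `f` does not depend on the normal, the second derivative of `log f` in the direction of `k` is
bounded below by a multiple of `-(1 + k)`. With the weight `1 / w` the terms with `∑ F^{ii} κ_i²`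
cancel, and `k² ∑ F^{ii} κ_i`, which is `k²` times a binomial coefficient, dominates
(`le_of_maxInequality_of_const`).

If `f` depends on the normal, terms of order `k²` appear. There are two cases
(`exists_bound_of_maxInequality`). If `∑ F^{ii} κ_i²` controls `k² ∑ F^{ii}`, then the fraction of
`∑ F^{ii} κ_i²` left over because of `a > 0` dominates. Otherwise all `κ_i` are bounded below by a
small multiple of `-k`. Then the sums `λ_I` that contain `k` are large, and for `p ≥ n / 2` they are
at least as many as the others, so the bound on the product forces some `λ_I` to be of order `1 / k`
and `∑ F^{ii}` to be of order `k` (`le_sum_linCoeff_of_lower_bound`). The exponential factor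
contributes `B ∑ F^{ii}`, which dominates for large `B`, while a suitable `τ` cancels the terms
quadratic in `B`.
-/

open scoped ContDiff

namespace PrescribedCurvature

open Filter Topology Asymptotics

/-! ### Second order jets of curves -/

section Jets

variable {E F G : Type*} [NormedAddCommGroup E] [NormedSpace ℝ E] [NormedAddCommGroup F]
  [NormedSpace ℝ F] [NormedAddCommGroup G] [NormedSpace ℝ G]

/-- `HasJet f a b c` says that `f t = a + t b + (t² / 2) c + o(t²)` as `t → 0`. The vectors `b` and
`c` play the role of the first and the second derivative of `f` at `0`. -/
def HasJet (f : ℝ → E) (a b c : E) : Prop :=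
  (fun t : ℝ => f t - (a + t • b + (t ^ 2 / 2) • c)) =o[𝓝 0] (fun t : ℝ => t ^ 2)

theorem HasJet.congr {f g : ℝ → E} {a b c : E} (h : HasJet f a b c) (hfg : g =ᶠ[𝓝 0] f) :
    HasJet g a b c := by
  refine IsLittleO.congr' h ?_ EventuallyEq.rfl
  filter_upwards [hfg] with t ht
  rw [ht]

theorem HasJet.of_eq {f : ℝ → E} {a b c a' b' c' : E} (h : HasJet f a b c) (ha : a = a')
    (hb : b = b') (hc : c = c') : HasJet f a' b' c' := by
  subst ha hb hc; exact h

theorem HasJet.const (a : E) : HasJet (fun _ => a) a 0 0 := by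
  simp [HasJet]

theorem HasJet.line (a b : E) : HasJet (fun t : ℝ => a + t • b) a b 0 := by
  simp [HasJet]

theorem HasJet.smul_id (b : E) : HasJet (fun t : ℝ => t • b) 0 b 0 := by
  simp [HasJet]

theorem tendsto_smul_zero (d : E) : Tendsto (fun t : ℝ => t • d) (𝓝 0) (𝓝 0) := by
  have : Continuous (fun t : ℝ => t • d) := by fun_prop
  simpa using this.tendsto 0

theorem HasJet.add {f g : ℝ → E} {a b c a' b' c' : E} (hf : HasJet f a b c)
    (hg : HasJet g a' b' c') :
    HasJet (fun t => f t + g t) (a + a') (b + b') (c + c') := by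
  refine (IsLittleO.add hf hg).congr_left fun t => ?_
  simp only [smul_add]; abel

theorem HasJet.sub {f g : ℝ → E} {a b c a' b' c' : E} (hf : HasJet f a b c)
    (hg : HasJet g a' b' c') :
    HasJet (fun t => f t - g t) (a - a') (b - b') (c - c') := by
  refine (IsLittleO.sub hf hg).congr_left fun t => ?_
  simp only [smul_sub]; abel

theorem HasJet.clm {f : ℝ → E} {a b c : E} (L : E →L[ℝ] F) (hf : HasJet f a b c) :
    HasJet (fun t => L (f t)) (L a) (L b) (L c) := by
  have h := (L.isBigO_comp (fun t : ℝ => f t - (a + t • b + (t ^ 2 / 2) • c)) (𝓝 0)).trans_isLittleO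
    hf
  refine h.congr_left fun t => ?_
  simp

theorem HasJet.neg {f : ℝ → E} {a b c : E} (hf : HasJet f a b c) :
    HasJet (fun t => - f t) (-a) (-b) (-c) := by
  simpa using ((HasJet.const (0 : E)).sub hf)

theorem HasJet.sum {ι : Type*} (s : Finset ι) {f : ι → ℝ → E} {a b c : ι → E}
    (hf : ∀ i ∈ s, HasJet (f i) (a i) (b i) (c i)) :
    HasJet (fun t => ∑ i ∈ s, f i t) (∑ i ∈ s, a i) (∑ i ∈ s, b i) (∑ i ∈ s, c i) := by
  classical
  induction s using Finset.induction_on with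
  | empty => simpa using HasJet.const (0 : E)
  | insert i s hi ih =>
    simp only [Finset.sum_insert hi]
    exact (hf i (by simp)).add (ih fun j hj => hf j (by simp [hj]))

theorem HasJet.prodMk {f : ℝ → E} {g : ℝ → F} {a b c : E} {a' b' c' : F}
    (hf : HasJet f a b c) (hg : HasJet g a' b' c') :
    HasJet (fun t => (f t, g t)) (a, a') (b, b') (c, c') := by
  have h1 := hf.clm (ContinuousLinearMap.inl ℝ E F)
  have h2 := hg.clm (ContinuousLinearMap.inr ℝ E F)
  simpa using h1.add h2

theorem HasJet.sub_isBigO {f : ℝ → E} {a b c : E} (hf : HasJet f a b c) :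
    (fun t => f t - a) =O[𝓝 0] (fun t : ℝ => t) := by
  have h1 : (fun t : ℝ => t ^ 2) =O[𝓝 0] (fun t : ℝ => t) := by
    simpa using (isLittleO_pow_pow (𝕜 := ℝ) (show 1 < 2 by norm_num)).isBigO
  have h2 : (fun t : ℝ => t • b) =O[𝓝 0] (fun t : ℝ => t) := by
    refine IsBigO.of_bound ‖b‖ (Eventually.of_forall fun t => ?_)
    rw [norm_smul, mul_comm]
  have h3 : (fun t : ℝ => (t ^ 2 / 2) • c) =O[𝓝 0] (fun t : ℝ => t) := by
    refine IsBigO.trans (IsBigO.of_bound ‖c‖ (Eventually.of_forall fun t => ?_)) h1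
    rw [norm_smul, mul_comm]
    gcongr
    rw [Real.norm_eq_abs, Real.norm_eq_abs, abs_div, abs_two]
    have := abs_nonneg (t ^ 2)
    linarith
  refine (((hf.isBigO.trans h1).add h2).add h3).congr_left fun t => ?_
  abel

theorem HasJet.sub_isBigO_sq {f : ℝ → E} {a c : E} (hf : HasJet f a 0 c) :
    (fun t => f t - a) =O[𝓝 0] (fun t : ℝ => t ^ 2) := by
  have h3 : (fun t : ℝ => (t ^ 2 / 2) • c) =O[𝓝 0] (fun t : ℝ => t ^ 2) := by
    refine (IsBigO.of_bound ‖c‖ (Eventually.of_forall fun t => ?_))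
    rw [norm_smul, mul_comm]
    gcongr
    rw [Real.norm_eq_abs, Real.norm_eq_abs, abs_div, abs_two]
    have := abs_nonneg (t ^ 2)
    linarith
  refine (hf.isBigO.add h3).congr_left fun t => ?_
  rw [smul_zero]; abel

theorem HasJet.tendsto {f : ℝ → E} {a b c : E} (hf : HasJet f a b c) :
    Tendsto f (𝓝 0) (𝓝 a) := by
  have h : Tendsto (fun t => f t - a) (𝓝 0) (𝓝 0) :=
    hf.sub_isBigO.trans_tendsto (Filter.tendsto_id (α := ℝ))
  simpa using h.add_const a

/-- Second order Taylor expansion with Peano remainder. -/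
theorem isLittleO_taylor_two {g : E → F} {g' : E → E →L[ℝ] F} {g'' : E →L[ℝ] E →L[ℝ] F} {a : E}
    (h1 : ∀ᶠ x in 𝓝 a, HasFDerivAt g (g' x) x) (h2 : HasFDerivAt g' g'' a) :
    (fun x => g x - (g a + g' a (x - a) + (1 / 2 : ℝ) • g'' (x - a) (x - a)))
      =o[𝓝 a] (fun x => ‖x - a‖ ^ 2) := by
  rw [isLittleO_iff]
  intro ε hε
  have h2' := (hasFDerivAt_iff_isLittleO.1 h2).def hε
  obtain ⟨δ, hδ, hball⟩ := Metric.eventually_nhds_iff_ball.1 (h1.and h2')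
  filter_upwards [Metric.ball_mem_nhds a hδ] with x hx
  set h := x - a with hh
  have hmem : ∀ s ∈ Set.Icc (0 : ℝ) 1, a + s • h ∈ Metric.ball a δ := by
    intro s hs
    rw [Metric.mem_ball, dist_eq_norm, add_sub_cancel_left, norm_smul, Real.norm_eq_abs,
      abs_of_nonneg hs.1]
    rw [Metric.mem_ball, dist_eq_norm] at hx
    exact lt_of_le_of_lt (mul_le_of_le_one_left (norm_nonneg _) hs.2) hx
  have hder : ∀ s ∈ Set.Icc (0 : ℝ) 1, HasDerivWithinAt
      (fun s : ℝ => g (a + s • h) - s • g' a h - (s ^ 2 / 2) • g'' h h)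
      ((g' (a + s • h) - g' a - g'' (s • h)) h) (Set.Icc 0 1) s := by
    intro s hs
    have hl : HasDerivAt (fun s : ℝ => a + s • h) h s := by
      simpa using ((hasDerivAt_id s).smul_const h).const_add a
    have e1 := (hball _ (hmem s hs)).1.comp_hasDerivAt s hl
    have e2 : HasDerivAt (fun s : ℝ => s • g' a h) (g' a h) s := by
      simpa using (hasDerivAt_id s).smul_const (g' a h)
    have e3 : HasDerivAt (fun s : ℝ => (s ^ 2 / 2) • g'' h h) (s • g'' h h) s := by
      have := ((hasDerivAt_pow 2 s).div_const 2).smul_const (g'' h h)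
      simpa using this
    refine (((e1.sub e2).sub e3).congr_deriv ?_).hasDerivWithinAt
    simp
  have hb : ∀ s ∈ Set.Ico (0 : ℝ) 1,
      ‖(g' (a + s • h) - g' a - g'' (s • h)) h‖ ≤ ε * ‖h‖ ^ 2 := by
    intro s hs
    have e := (hball _ (hmem s ⟨hs.1, hs.2.le⟩)).2
    rw [add_sub_cancel_left] at e
    calc _ ≤ ‖g' (a + s • h) - g' a - g'' (s • h)‖ * ‖h‖ := ContinuousLinearMap.le_opNorm _ _
      _ ≤ (ε * ‖s • h‖) * ‖h‖ := by gcongr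
      _ ≤ (ε * ‖h‖) * ‖h‖ := by
        gcongr
        rw [norm_smul, Real.norm_eq_abs, abs_of_nonneg hs.1]
        exact mul_le_of_le_one_left (norm_nonneg _) hs.2.le
      _ = _ := by ring
  -- The mean value inequality on the segment, for the remainder as a function of the parameter.
  have key := norm_image_sub_le_of_norm_deriv_le_segment_01' hder hb
  have e : g x - (g a + g' a h + (1 / 2 : ℝ) • g'' h h) =
      (g (a + (1 : ℝ) • h) - (1 : ℝ) • g' a h - ((1 : ℝ) ^ 2 / 2) • g'' h h) -
      (g (a + (0 : ℝ) • h) - (0 : ℝ) • g' a h - ((0 : ℝ) ^ 2 / 2) • g'' h h) := by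
    have : a + h = x := by rw [hh]; abel
    simp [this]; abel
  rw [e]
  simpa using key

/-- A continuous bilinear map applied to two curves: the product rule for jets. -/
theorem HasJet.bilin {f : ℝ → E} {g : ℝ → F} {a b c : E} {a' b' c' : F}
    (B : E →L[ℝ] F →L[ℝ] G) (hf : HasJet f a b c) (hg : HasJet g a' b' c') :
    HasJet (fun t => B (f t) (g t)) (B a a') (B a b' + B b a')
      (B a c' + (2 : ℝ) • B b b' + B c a') := by
  have hB : ∀ {f₁ : ℝ → E} {f₂ : ℝ → F} {g₁ g₂ : ℝ → ℝ}, f₁ =o[𝓝 0] g₁ → f₂ =O[𝓝 0] g₂ →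
      (fun t => B (f₁ t) (f₂ t)) =o[𝓝 0] (fun t => g₁ t * g₂ t) := by
    intro f₁ f₂ g₁ g₂ h1 h2
    have : (fun t => B (f₁ t) (f₂ t)) =O[𝓝 0] (fun t => ‖f₁ t‖ * ‖f₂ t‖) := by
      refine IsBigO.of_bound ‖B‖ (Eventually.of_forall fun t => ?_)
      rw [norm_mul, norm_norm, norm_norm, ← mul_assoc]
      exact B.le_opNorm₂ _ _
    exact this.trans_isLittleO (h1.norm_left.mul_isBigO h2.norm_left)
  have hB' : ∀ {f₁ : ℝ → E} {f₂ : ℝ → F} {g₁ g₂ : ℝ → ℝ}, f₁ =O[𝓝 0] g₁ → f₂ =o[𝓝 0] g₂ →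
      (fun t => B (f₁ t) (f₂ t)) =o[𝓝 0] (fun t => g₁ t * g₂ t) := by
    intro f₁ f₂ g₁ g₂ h1 h2
    have : (fun t => B (f₁ t) (f₂ t)) =O[𝓝 0] (fun t => ‖f₁ t‖ * ‖f₂ t‖) := by
      refine IsBigO.of_bound ‖B‖ (Eventually.of_forall fun t => ?_)
      rw [norm_mul, norm_norm, norm_norm, ← mul_assoc]
      exact B.le_opNorm₂ _ _
    exact this.trans_isLittleO (h1.norm_left.mul_isLittleO h2.norm_left)
  have hgb : g =O[𝓝 0] (fun _ => (1 : ℝ)) := hg.tendsto.isBigO_one ℝ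
  have hpb : (fun t : ℝ => a + t • b + (t ^ 2 / 2) • c) =O[𝓝 0] (fun _ => (1 : ℝ)) := by
    have : Continuous (fun t : ℝ => a + t • b + (t ^ 2 / 2) • c) := by fun_prop
    exact (this.tendsto 0).isBigO_one ℝ
  have r1 := hB hf hgb
  have r2 := hB' hpb hg
  have r3 : (fun t : ℝ => t ^ 3 • ((1 / 2 : ℝ) • B b c' + (1 / 2 : ℝ) • B c b' +
      (t / 4) • B c c')) =o[𝓝 0] (fun t : ℝ => t ^ 2) := by
    have e1 : (fun t : ℝ => t ^ 3) =o[𝓝 0] (fun t : ℝ => t ^ 2) :=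
      isLittleO_pow_pow (by norm_num)
    have e2 : (fun t : ℝ => ((1 / 2 : ℝ) • B b c' + (1 / 2 : ℝ) • B c b' +
      (t / 4) • B c c')) =O[𝓝 0] (fun _ => (1 : ℝ)) := by
      have : Continuous (fun t : ℝ => ((1 / 2 : ℝ) • B b c' + (1 / 2 : ℝ) • B c b' +
        (t / 4) • B c c')) := by fun_prop
      exact (this.tendsto 0).isBigO_one ℝ
    simpa using e1.smul_isBigO e2
  simp only [mul_one, one_mul] at r1 r2
  refine ((r1.add r2).add r3).congr_left fun t => ?_
  simp only [map_sub, map_add, map_smul, sub_apply, add_apply, smul_apply, smul_add, smul_smul]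
  module

theorem HasJet.mul {f g : ℝ → ℝ} {a b c a' b' c' : ℝ} (hf : HasJet f a b c)
    (hg : HasJet g a' b' c') :
    HasJet (fun t => f t * g t) (a * a') (a * b' + b * a') (a * c' + 2 * (b * b') + c * a') := by
  simpa using hf.bilin (ContinuousLinearMap.mul ℝ ℝ) hg

theorem HasJet.smul {f : ℝ → ℝ} {g : ℝ → E} {a b c : ℝ} {a' b' c' : E} (hf : HasJet f a b c)
    (hg : HasJet g a' b' c') :
    HasJet (fun t => f t • g t) (a • a') (a • b' + b • a')
      (a • c' + (2 : ℝ) • b • b' + c • a') := by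
  simpa using hf.bilin (ContinuousLinearMap.lsmul ℝ ℝ) hg

theorem HasJet.apply {f : ℝ → E →L[ℝ] F} {g : ℝ → E} {a b c : E →L[ℝ] F} {a' b' c' : E}
    (hf : HasJet f a b c) (hg : HasJet g a' b' c') :
    HasJet (fun t => f t (g t)) (a a') (a b' + b a') (a c' + (2 : ℝ) • b b' + c a') := by
  simpa using hf.bilin (ContinuousLinearMap.id ℝ (E →L[ℝ] F)) hg

theorem HasJet.inner {H : Type*} [NormedAddCommGroup H] [InnerProductSpace ℝ H]
    {f g : ℝ → H} {a b c a' b' c' : H} (hf : HasJet f a b c) (hg : HasJet g a' b' c') :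
    HasJet (fun t => inner ℝ (f t) (g t)) (inner ℝ a a') (inner ℝ a b' + inner ℝ b a')
      (inner ℝ a c' + 2 * inner ℝ b b' + inner ℝ c a') := by
  exact hf.bilin (innerSL ℝ) hg

/-- The chain rule for jets. -/
theorem HasJet.comp_of_hasFDerivAt {f : ℝ → E} {a b c : E} {g : E → F} {g' : E → E →L[ℝ] F}
    {g'' : E →L[ℝ] E →L[ℝ] F} (h1 : ∀ᶠ x in 𝓝 a, HasFDerivAt g (g' x) x)
    (h2 : HasFDerivAt g' g'' a) (hf : HasJet f a b c) :
    HasJet (fun t => g (f t)) (g a) (g' a b) (g' a c + g'' b b) := by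
  have ht := (isLittleO_taylor_two h1 h2).comp_tendsto hf.tendsto
  have ht2 : (fun t => ‖f t - a‖ ^ 2) =O[𝓝 0] (fun t : ℝ => t ^ 2) := by
    simpa using (hf.sub_isBigO.norm_left.pow 2)
  have hfa : HasJet (fun t => f t - a) 0 b c := by simpa using hf.sub (HasJet.const a)
  have hq := (hfa.clm (g' a)).add
    ((hfa.bilin g'' hfa).clm ((1 / 2 : ℝ) • ContinuousLinearMap.id ℝ F))
  have hq' := (HasJet.const (g a)).add hq
  refine ((ht.trans_isBigO ht2).add hq').congr_left fun t => ?_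
  simp only [Function.comp, map_zero, zero_add, add_zero, smul_apply,
    zero_apply, ContinuousLinearMap.id_apply]
  module

theorem HasJet.comp {f : ℝ → E} {a b c : E} {g : E → F} (hg : ContDiffAt ℝ 2 g a)
    (hf : HasJet f a b c) :
    HasJet (fun t => g (f t)) (g a) (fderiv ℝ g a b)
      (fderiv ℝ g a c + fderiv ℝ (fderiv ℝ g) a b b) := by
  have h1 : ∀ᶠ x in 𝓝 a, HasFDerivAt g (fderiv ℝ g x) x := by
    filter_upwards [hg.eventually (by simp)] with x hx
    exact (hx.differentiableAt (by norm_num)).hasFDerivAt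
  have h2 : HasFDerivAt (fderiv ℝ g) (fderiv ℝ (fderiv ℝ g) a) a :=
    ((hg.fderiv_right (m := 1) (by norm_num)).differentiableAt (by norm_num)).hasFDerivAt
  exact hf.comp_of_hasFDerivAt h1 h2

theorem HasJet.scomp {f : ℝ → ℝ} {a b c : ℝ} {g g' : ℝ → ℝ} {g'' : ℝ}
    (h1 : ∀ᶠ x in 𝓝 a, HasDerivAt g (g' x) x)
    (h2 : HasDerivAt g' g'' a) (hf : HasJet f a b c) :
    HasJet (fun t => g (f t)) (g a) (g' a * b) (g' a * c + g'' * b ^ 2) := by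
  have h1' : ∀ᶠ x in 𝓝 a, HasFDerivAt g
      ((ContinuousLinearMap.smulRightL ℝ ℝ ℝ (ContinuousLinearMap.id ℝ ℝ)) (g' x)) x := by
    filter_upwards [h1] with x hx
    exact hx.hasFDerivAt
  have h2' := ((ContinuousLinearMap.smulRightL ℝ ℝ ℝ
    (ContinuousLinearMap.id ℝ ℝ)).hasFDerivAt).comp a h2.hasFDerivAt
  refine (hf.comp_of_hasFDerivAt h1' h2').of_eq rfl ?_ ?_
  · simp [mul_comm]
  · simp; ring

/-- If the first order term of the inner curve vanishes, the second derivative of the outer function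
does not enter the jet of the composition. -/
theorem HasJet.scomp_zero {f : ℝ → ℝ} {a c : ℝ} {g : ℝ → ℝ} {g' : ℝ}
    (h1 : HasDerivAt g g' a) (hf : HasJet f a 0 c) :
    HasJet (fun t => g (f t)) (g a) 0 (g' * c) := by
  have ht := ((hasDerivAt_iff_isLittleO.1 h1).comp_tendsto hf.tendsto).trans_isBigO hf.sub_isBigO_sq
  refine (ht.add (IsLittleO.const_mul_left hf g')).congr_left fun t => ?_
  simp only [Function.comp, smul_eq_mul]
  ring

theorem HasJet.exp {f : ℝ → ℝ} {a b c : ℝ} (hf : HasJet f a b c) :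
    HasJet (fun t => Real.exp (f t)) (Real.exp a) (Real.exp a * b)
      (Real.exp a * c + Real.exp a * b ^ 2) :=
  hf.scomp (Eventually.of_forall fun x => Real.hasDerivAt_exp x) (Real.hasDerivAt_exp a)

theorem HasJet.log {f : ℝ → ℝ} {a b c : ℝ} (ha : a ≠ 0) (hf : HasJet f a b c) :
    HasJet (fun t => Real.log (f t)) (Real.log a) (b / a) (c / a - (b / a) ^ 2) := by
  refine (hf.scomp (g' := fun x => x⁻¹) ?_ (hasDerivAt_inv ha)).of_eq rfl ?_ ?_
  · filter_upwards [isOpen_ne.mem_nhds ha] with x hx using Real.hasDerivAt_log hx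
  · field_simp
  · field_simp; ring

/-- The necessary conditions of first and second order for a minimum, in terms of jets. -/
theorem HasJet.of_eventually_le {f g : ℝ → ℝ} {a b c a' b' c' : ℝ} (hf : HasJet f a b c)
    (hg : HasJet g a' b' c') (hle : ∀ᶠ t in 𝓝 0, f t ≤ g t) (ha : a = a') :
    b = b' ∧ c ≤ c' := by
  subst ha
  have hd : HasJet (fun t => g t - f t) 0 (b' - b) (c' - c) := by simpa using hg.sub hf
  have h1 : HasDerivAt (fun t => g t - f t) (b' - b) 0 := by
    have h0 : g 0 - f 0 = 0 := by
      have := (isLittleO_iff.1 hd one_pos).self_of_nhds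
      simpa using this
    rw [hasDerivAt_iff_isLittleO]
    have e1 : (fun t : ℝ => t ^ 2) =o[𝓝 0] (fun t : ℝ => t) := by
      simpa using (isLittleO_pow_pow (𝕜 := ℝ) (show 1 < 2 by norm_num))
    have e2 := (hd.trans e1).add (e1.const_mul_left ((c' - c) / 2))
    simp only [sub_zero]
    refine e2.congr_left fun t => ?_
    simp only [h0, smul_eq_mul]; ring
  have hmin : IsLocalMin (fun t => g t - f t) 0 := by
    have h0 : g 0 - f 0 = 0 := by
      have := (isLittleO_iff.1 hd one_pos).self_of_nhds
      simpa using this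
    filter_upwards [hle] with t ht
    simp only [h0]; linarith
  have hb : b' - b = 0 := hmin.hasDerivAt_eq_zero h1
  refine ⟨by linarith, ?_⟩
  by_contra hc
  push Not at hc
  have hε : 0 < (c - c') / 4 := by linarith
  have h2 := (isLittleO_iff.1 hd hε).and hle
  obtain ⟨δ, hδ, hball⟩ := Metric.eventually_nhds_iff_ball.1 h2
  have hmem : δ / 2 ∈ Metric.ball (0 : ℝ) δ := by
    rw [Metric.mem_ball, dist_zero_right, Real.norm_eq_abs, abs_of_pos (by linarith)]; linarith
  obtain ⟨k1, k2⟩ := hball _ hmem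
  rw [hb, Real.norm_eq_abs, Real.norm_eq_abs, abs_of_nonneg (sq_nonneg (δ / 2))] at k1
  have k3 := (abs_le.1 k1).2
  simp only [smul_eq_mul, mul_zero, zero_add, add_zero] at k3
  have : 0 < (δ / 2) ^ 2 := by positivity
  nlinarith

end Jets

end PrescribedCurvature

namespace PrescribedCurvature

open Matrix

/-! ### The curvature operator in orthonormal frames -/

section LinearAlgebra

variable {n : ℕ}

/-- The index sets `{i_1 < ⋯ < i_p}`. -/
abbrev pSets (n p : ℕ) : Finset (Finset (Fin n)) := Finset.powersetCard p Finset.univ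

theorem pSums_map_univ (p : ℕ) (κ : Fin n → ℝ) :
    pSums p ((Finset.univ : Finset (Fin n)).val.map κ) =
      (pSets n p).val.map fun I => ∑ i ∈ I, κ i := by
  rw [pSums, Multiset.powersetCard_map, ← Finset.map_val_val_powersetCard, Multiset.map_map,
    Multiset.map_map]
  rfl

theorem prod_pSums_map_univ (p : ℕ) (κ : Fin n → ℝ) :
    (pSums p ((Finset.univ : Finset (Fin n)).val.map κ)).prod =
      ∏ I ∈ pSets n p, ∑ i ∈ I, κ i := by
  rw [pSums_map_univ]; rfl

/-- A sum over `p`-subsets is invariant under permutations of the index set. -/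
theorem sum_pSets_perm (p : ℕ) (σ : Equiv.Perm (Fin n)) (κ : Fin n → ℝ) (φ : ℝ → ℝ) :
    ∑ I ∈ pSets n p, φ (∑ i ∈ I, κ (σ i)) = ∑ I ∈ pSets n p, φ (∑ i ∈ I, κ i) := by
  refine Finset.sum_nbij' (fun I => I.map σ.toEmbedding) (fun I => I.map σ.symm.toEmbedding)
    ?_ ?_ ?_ ?_ ?_
  · intro I hI
    simpa [Finset.mem_powersetCard] using hI
  · intro I hI
    simpa [Finset.mem_powersetCard] using hI
  · intro I _
    simp [Finset.map_map]
  · intro I _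
    simp [Finset.map_map]
  · intro I _
    simp

theorem log_le_log_add_div_sub_one {x μ : ℝ} (hx : 0 < x) (hμ : 0 < μ) :
    Real.log x ≤ Real.log μ + x / μ - 1 := by
  have := Real.log_le_sub_one_of_pos (div_pos hx hμ)
  rw [Real.log_div hx.ne' hμ.ne'] at this
  linarith

/-- A doubly stochastic average of `lam` has a larger value of `∑_I log (∑_{i ∈ I} lam i)`, and by
concavity of the logarithm that value is at most its linearization at `μ`. By Birkhoff's theorem the
average is one over permutations. -/
theorem sum_log_le_of_mem_doublyStochastic {p : ℕ} {S : Matrix (Fin n) (Fin n) ℝ}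
    (hS : S ∈ doublyStochastic ℝ (Fin n)) {lam μ : Fin n → ℝ}
    (hlam : ∀ I ∈ pSets n p, 0 < ∑ i ∈ I, lam i) (hμ : ∀ I ∈ pSets n p, 0 < ∑ i ∈ I, μ i) :
    ∑ I ∈ pSets n p, Real.log (∑ i ∈ I, lam i) ≤
      ∑ I ∈ pSets n p,
        (Real.log (∑ i ∈ I, μ i) + (∑ i ∈ I, (S *ᵥ lam) i) / (∑ i ∈ I, μ i) - 1) := by
  obtain ⟨w, hw0, hw1, hwS⟩ := exists_eq_sum_perm_of_mem_doublyStochastic hS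
  have hSv : ∀ i, (S *ᵥ lam) i = ∑ σ, w σ * lam (σ i) := by
    intro i
    rw [← hwS, Matrix.sum_mulVec, Finset.sum_apply]
    refine Finset.sum_congr rfl fun σ _ => ?_
    rw [Matrix.smul_mulVec, Matrix.permMatrix_mulVec]
    simp
  have hperm : ∀ σ : Equiv.Perm (Fin n), ∀ I ∈ pSets n p, 0 < ∑ i ∈ I, lam (σ i) := by
    intro σ I hI
    have := hlam (I.map σ.toEmbedding) (by simpa [Finset.mem_powersetCard] using hI)
    simpa using this
  calc ∑ I ∈ pSets n p, Real.log (∑ i ∈ I, lam i)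
      = ∑ σ, w σ * ∑ I ∈ pSets n p, Real.log (∑ i ∈ I, lam (σ i)) := by
        simp_rw [sum_pSets_perm p _ lam Real.log]
        rw [← Finset.sum_mul, hw1, one_mul]
    _ ≤ ∑ σ, w σ * ∑ I ∈ pSets n p,
          (Real.log (∑ i ∈ I, μ i) + (∑ i ∈ I, lam (σ i)) / (∑ i ∈ I, μ i) - 1) := by
        refine Finset.sum_le_sum fun σ _ => mul_le_mul_of_nonneg_left ?_ (hw0 σ)
        exact Finset.sum_le_sum fun I hI => log_le_log_add_div_sub_one (hperm σ I hI) (hμ I hI)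
    _ = _ := by
        simp_rw [Finset.mul_sum]
        rw [Finset.sum_comm]
        refine Finset.sum_congr rfl fun I _ => ?_
        simp_rw [hSv]
        rw [Finset.sum_comm, Finset.sum_div]
        simp_rw [mul_sub, mul_add, Finset.sum_sub_distrib, Finset.sum_add_distrib]
        rw [← Finset.sum_mul, ← Finset.sum_mul, hw1]
        simp_rw [← Finset.mul_sum, mul_div_assoc]
        ring

theorem sq_eigenvectorUnitary_mem_doublyStochastic {B : Matrix (Fin n) (Fin n) ℝ}
    (hB : B.IsHermitian) :
    (Matrix.of fun i j => (hB.eigenvectorUnitary : Matrix (Fin n) (Fin n) ℝ) i j ^ 2) ∈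
      doublyStochastic ℝ (Fin n) := by
  set U : Matrix (Fin n) (Fin n) ℝ := (hB.eigenvectorUnitary : Matrix (Fin n) (Fin n) ℝ) with hU
  have h1 : U * star U = 1 := Unitary.mul_star_self_of_mem hB.eigenvectorUnitary.2
  have h2 : star U * U = 1 := Unitary.star_mul_self_of_mem hB.eigenvectorUnitary.2
  rw [mem_doublyStochastic_iff_sum]
  refine ⟨fun i j => sq_nonneg _, fun i => ?_, fun j => ?_⟩
  · have := congrFun (congrFun h1 i) i
    simpa [Matrix.mul_apply, Matrix.star_apply, sq] using this
  · have := congrFun (congrFun h2 j) j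
    simpa [Matrix.mul_apply, Matrix.star_apply, sq] using this

theorem diag_eq_sq_eigenvectorUnitary_mulVec {B : Matrix (Fin n) (Fin n) ℝ}
    (hB : B.IsHermitian) (i : Fin n) :
    B i i = ((Matrix.of fun i j => (hB.eigenvectorUnitary : Matrix (Fin n) (Fin n) ℝ) i j ^ 2) *ᵥ
      hB.eigenvalues) i := by
  conv_lhs => rw [hB.spectral_theorem, Unitary.conjStarAlgAut_apply]
  simp only [Matrix.mul_apply, Matrix.diagonal_apply, Matrix.mulVec, dotProduct, Matrix.of_apply,
    Matrix.star_apply, Function.comp]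
  refine Finset.sum_congr rfl fun j _ => ?_
  simp
  ring

/-- The coefficients `F^{ii} = ∑_{I ∋ i} 1 / λ_I` of the linearization of `∑_I log λ_I` at a
diagonal matrix with entries `κ`, where `λ_I = ∑_{i ∈ I} κ_i`. -/
noncomputable def linCoeff (p : ℕ) (κ : Fin n → ℝ) (i : Fin n) : ℝ :=
  ∑ I ∈ pSets n p with i ∈ I, (∑ j ∈ I, κ j)⁻¹

theorem sum_linCoeff_mul (p : ℕ) (κ d : Fin n → ℝ) :
    ∑ i, linCoeff p κ i * d i = ∑ I ∈ pSets n p, (∑ i ∈ I, d i) / (∑ i ∈ I, κ i) := by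
  simp_rw [linCoeff, Finset.sum_mul, Finset.sum_filter]
  rw [Finset.sum_comm]
  refine Finset.sum_congr rfl fun I _ => ?_
  rw [Finset.sum_div, ← Finset.sum_filter]
  refine Finset.sum_congr (by ext; simp) fun i _ => ?_
  rw [div_eq_mul_inv, mul_comm]

/-- The supporting hyperplane of the concave function `∑_I log λ_I` of a symmetric matrix `B`. -/
theorem log_prod_pSums_le {p : ℕ} {B : Matrix (Fin n) (Fin n) ℝ} (hB : B.IsHermitian)
    (hpos : ∀ s ∈ pSums p B.charpoly.roots, 0 < s) {κ : Fin n → ℝ}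
    (hκ : ∀ I ∈ pSets n p, 0 < ∑ i ∈ I, κ i) :
    Real.log (pSums p B.charpoly.roots).prod ≤
      ∑ I ∈ pSets n p, Real.log (∑ i ∈ I, κ i) +
        (∑ i, linCoeff p κ i * B i i - ∑ i, linCoeff p κ i * κ i) := by
  have hr : B.charpoly.roots = (Finset.univ : Finset (Fin n)).val.map hB.eigenvalues := by
    simpa using hB.roots_charpoly_eq_eigenvalues
  rw [hr] at hpos ⊢
  have hlam : ∀ I ∈ pSets n p, 0 < ∑ i ∈ I, hB.eigenvalues i := by
    intro I hI
    refine hpos _ ?_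
    rw [pSums_map_univ]
    exact Multiset.mem_map_of_mem (fun I : Finset (Fin n) => ∑ i ∈ I, hB.eigenvalues i) hI
  rw [prod_pSums_map_univ, Real.log_prod fun I hI => (hlam I hI).ne']
  refine (sum_log_le_of_mem_doublyStochastic (sq_eigenvectorUnitary_mem_doublyStochastic hB) hlam
    hκ).trans (le_of_eq ?_)
  rw [sum_linCoeff_mul, sum_linCoeff_mul]
  simp_rw [← diag_eq_sq_eigenvectorUnitary_mulVec]
  rw [← Finset.sum_sub_distrib, ← Finset.sum_add_distrib]
  refine Finset.sum_congr rfl fun I hI => ?_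
  rw [div_self (hκ I hI).ne']
  ring

/-- The induced metric of the graph of `u` as a bilinear form. -/
noncomputable def metricForm (u : Space n → ℝ) (x a b : Space n) : ℝ :=
  inner ℝ a b + fderiv ℝ u x a * fderiv ℝ u x b

/-- The second fundamental form of the graph of `u` as a bilinear form. -/
noncomputable def secondForm (u : Space n → ℝ) (x a b : Space n) : ℝ :=
  hess u x a b / areaElement u x

theorem eq_sum_single (a : Space n) : a = ∑ i, a i • EuclideanSpace.single i (1 : ℝ) := by
  conv_lhs => rw [← (EuclideanSpace.basisFun (Fin n) ℝ).sum_repr a]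
  simp

theorem transpose_mul_inducedMetric_mul (u : Space n → ℝ) (x : Space n)
    (e : Fin n → Space n) :
    (Matrix.of fun i k => e k i)ᵀ * inducedMetric u x * (Matrix.of fun i k => e k i) =
      Matrix.of fun k l => metricForm u x (e k) (e l) := by
  ext k l
  have hd : ∀ k, fderiv ℝ u x (e k) = ∑ i, e k i * partialDeriv u i x := by
    intro k
    conv_lhs => rw [eq_sum_single (e k)]
    simp [partialDeriv]
  simp only [Matrix.mul_apply, Matrix.transpose_apply, Matrix.of_apply, inducedMetric, metricForm,
    hd, PiLp.inner_apply]
  simp only [mul_add, Finset.sum_add_distrib, add_mul, mul_ite, mul_one, mul_zero,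
    Finset.sum_ite_eq', Finset.mem_univ, if_true]
  congr 1
  · exact Finset.sum_congr rfl fun i _ => by simp [mul_comm]
  · rw [Finset.sum_mul_sum, Finset.sum_comm]
    simp_rw [Finset.sum_mul]
    refine Finset.sum_congr rfl fun i _ => Finset.sum_congr rfl fun j _ => ?_
    ring

theorem transpose_mul_secondFundamentalForm_mul (u : Space n → ℝ) (x : Space n)
    (e : Fin n → Space n) :
    (Matrix.of fun i k => e k i)ᵀ * secondFundamentalForm u x * (Matrix.of fun i k => e k i) =
      Matrix.of fun k l => secondForm u x (e k) (e l) := by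
  ext k l
  have hd : hess u x (e k) (e l) = ∑ i, ∑ j, e k i * (e l j *
      hess u x (EuclideanSpace.single i 1) (EuclideanSpace.single j 1)) := by
    conv_lhs => rw [eq_sum_single (e k), eq_sum_single (e l)]
    simp only [map_sum, map_smul, _root_.sum_apply, _root_.smul_apply, smul_eq_mul, Finset.mul_sum]
    rw [Finset.sum_comm]
    refine Finset.sum_congr rfl fun i _ => Finset.sum_congr rfl fun j _ => ?_
    ring
  simp only [Matrix.mul_apply, Matrix.transpose_apply, Matrix.of_apply, secondFundamentalForm,
    secondForm, hd]
  simp_rw [Finset.sum_mul, Finset.sum_div]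
  rw [Finset.sum_comm]
  refine Finset.sum_congr rfl fun i _ => Finset.sum_congr rfl fun j _ => ?_
  ring

/-- The principal curvatures are the eigenvalues of the second fundamental form in any frame that
is orthonormal for the induced metric. -/
theorem principalCurvatures_eq_of_frame {u : Space n → ℝ} {x : Space n} {e : Fin n → Space n}
    (he : ∀ k l, metricForm u x (e k) (e l) = if k = l then 1 else 0) :
    principalCurvatures u x =
      (Matrix.of fun k l => secondForm u x (e k) (e l)).charpoly.roots := by
  set E : Matrix (Fin n) (Fin n) ℝ := Matrix.of fun i k => e k i with hE
  have h1 : Eᵀ * inducedMetric u x * E = 1 := by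
    rw [transpose_mul_inducedMetric_mul]
    ext k l
    simp [he, Matrix.one_apply]
  have h2 : inducedMetric u x * (E * Eᵀ) = 1 := by
    rw [Matrix.mul_assoc] at h1
    rw [← Matrix.mul_assoc]
    exact mul_eq_one_comm.1 h1
  rw [principalCurvatures, Matrix.inv_eq_right_inv h2, Matrix.mul_assoc, Matrix.charpoly_mul_comm,
    transpose_mul_secondFundamentalForm_mul]

theorem principalCurvatures_eq_map {u : Space n → ℝ} {x : Space n} {e : Fin n → Space n}
    (he : ∀ k l, metricForm u x (e k) (e l) = if k = l then 1 else 0) {κ : Fin n → ℝ}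
    (hκ : ∀ k l, secondForm u x (e k) (e l) = if k = l then κ k else 0) :
    principalCurvatures u x = (Finset.univ : Finset (Fin n)).val.map κ := by
  rw [principalCurvatures_eq_of_frame he]
  have : (Matrix.of fun k l => secondForm u x (e k) (e l)) = Matrix.diagonal κ := by
    ext k l
    simp [hκ, Matrix.diagonal_apply]
  rw [this, Matrix.charpoly_diagonal]
  have := Polynomial.roots_multiset_prod_X_sub_C ((Finset.univ : Finset (Fin n)).val.map κ)
  rw [Multiset.map_map] at this
  exact this

end LinearAlgebra

end PrescribedCurvature

namespace PrescribedCurvature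

/-! ### The linearized operator on the cone of `p`-convex vectors -/

section Cone

variable {n p : ℕ} {κ : Fin n → ℝ}

theorem linCoeff_nonneg (hκ : ∀ I ∈ pSets n p, 0 < ∑ i ∈ I, κ i) (i : Fin n) :
    0 ≤ linCoeff p κ i :=
  Finset.sum_nonneg fun I hI => (inv_pos.2 (hκ I (Finset.mem_filter.1 hI).1)).le

theorem sum_linCoeff_mul_self (hκ : ∀ I ∈ pSets n p, 0 < ∑ i ∈ I, κ i) :
    ∑ i, linCoeff p κ i * κ i = ((pSets n p).card : ℝ) := by
  rw [sum_linCoeff_mul, Finset.sum_congr rfl fun I hI => div_self (hκ I hI).ne']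
  simp

theorem sum_linCoeff (p : ℕ) (κ : Fin n → ℝ) :
    ∑ i, linCoeff p κ i = p * ∑ I ∈ pSets n p, (∑ i ∈ I, κ i)⁻¹ := by
  have := sum_linCoeff_mul p κ (fun _ => 1)
  simp only [mul_one] at this
  rw [this, Finset.mul_sum]
  refine Finset.sum_congr rfl fun I hI => ?_
  rw [Finset.sum_const, (Finset.mem_powersetCard.1 hI).2]
  simp [div_eq_mul_inv]

theorem inv_sum_le_sum_linCoeff (hp : 1 ≤ p) (hκ : ∀ I ∈ pSets n p, 0 < ∑ i ∈ I, κ i)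
    {I : Finset (Fin n)} (hI : I ∈ pSets n p) :
    (∑ i ∈ I, κ i)⁻¹ ≤ ∑ i, linCoeff p κ i := by
  rw [sum_linCoeff]
  have h1 : (∑ i ∈ I, κ i)⁻¹ ≤ ∑ I ∈ pSets n p, (∑ i ∈ I, κ i)⁻¹ :=
    Finset.single_le_sum (f := fun I => (∑ i ∈ I, κ i)⁻¹)
      (fun J hJ => (inv_pos.2 (hκ J hJ)).le) hI
  have h2 : (1 : ℝ) ≤ p := by exact_mod_cast hp
  have h3 : 0 < (∑ i ∈ I, κ i)⁻¹ := inv_pos.2 (hκ I hI)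
  nlinarith

theorem linCoeff_anti (hκ : ∀ I ∈ pSets n p, 0 < ∑ i ∈ I, κ i) {i j : Fin n}
    (hij : κ i ≤ κ j) : linCoeff p κ j ≤ linCoeff p κ i := by
  have h : linCoeff p κ j =
      ∑ I ∈ pSets n p with i ∈ I, (∑ l ∈ I, κ (Equiv.swap i j l))⁻¹ := by
    refine Finset.sum_nbij' (fun I => I.map (Equiv.swap i j).toEmbedding)
      (fun I => I.map (Equiv.swap i j).toEmbedding) ?_ ?_ ?_ ?_ ?_
    · intro I hI
      simp only [Finset.mem_filter, Finset.mem_powersetCard] at hI ⊢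
      refine ⟨⟨Finset.subset_univ _, by simpa using hI.1.2⟩, ?_⟩
      exact Finset.mem_map.2 ⟨j, hI.2, by simp⟩
    · intro I hI
      simp only [Finset.mem_filter, Finset.mem_powersetCard] at hI ⊢
      refine ⟨⟨Finset.subset_univ _, by simpa using hI.1.2⟩, ?_⟩
      exact Finset.mem_map.2 ⟨i, hI.2, by simp⟩
    · intro I _
      ext l; simp
    · intro I _
      ext l; simp
    · intro I _
      simp
  rw [h]
  refine Finset.sum_le_sum fun I hI => ?_
  simp only [Finset.mem_filter] at hI
  refine inv_anti₀ (hκ I hI.1) ?_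
  by_cases hj : j ∈ I
  · have : I.map (Equiv.swap i j).toEmbedding = I := by
      ext l
      simp only [Finset.mem_map_equiv, Equiv.symm_swap]
      by_cases h1 : l = i
      · subst h1; simp [hj, hI.2]
      · by_cases h2 : l = j
        · subst h2; simp [hj, hI.2]
        · rw [Equiv.swap_apply_of_ne_of_ne h1 h2]
    have e : ∑ l ∈ I, κ (Equiv.swap i j l) = ∑ l ∈ I, κ l := by
      conv_rhs => rw [← this]
      simp
    exact e.ge
  · refine Finset.sum_le_sum fun l hl => ?_
    by_cases h1 : l = i
    · subst h1; simpa using hij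
    · have h2 : l ≠ j := fun h => hj (h ▸ hl)
      rw [Equiv.swap_apply_of_ne_of_ne h1 h2]

theorem exists_mem_pSets {i : Fin n} (hp : 1 ≤ p) (hpn : p ≤ n) : ∃ I ∈ pSets n p, i ∈ I := by
  obtain ⟨I, h1, -, h2⟩ := Finset.exists_subsuperset_card_eq (s := {i}) (t := Finset.univ)
    (Finset.subset_univ _) (n := p) (by simpa using hp) (by simpa using hpn)
  exact ⟨I, by simp [Finset.mem_powersetCard, h2], by simpa using h1⟩

theorem pos_of_forall_le (hp : 1 ≤ p) (hpn : p ≤ n) (hκ : ∀ I ∈ pSets n p, 0 < ∑ i ∈ I, κ i)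
    {k : ℝ} (hk : ∀ i, κ i ≤ k) : 0 < k := by
  have : 0 < n := by omega
  obtain ⟨I, hI, -⟩ := exists_mem_pSets (i := ⟨0, this⟩) hp hpn
  have h1 := hκ I hI
  have h2 : ∑ i ∈ I, κ i ≤ ∑ i ∈ I, k := Finset.sum_le_sum fun i _ => hk i
  rw [Finset.sum_const, (Finset.mem_powersetCard.1 hI).2, nsmul_eq_mul] at h2
  have h3 : (0 : ℝ) < p := by exact_mod_cast hp
  by_contra hneg
  push Not at hneg
  nlinarith

theorem abs_le_of_forall_le (hp : 1 ≤ p) (hpn : p ≤ n)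
    (hκ : ∀ I ∈ pSets n p, 0 < ∑ i ∈ I, κ i)
    {k : ℝ} (hk : ∀ i, κ i ≤ k) (i : Fin n) : |κ i| ≤ n * k := by
  have hk0 := pos_of_forall_le hp hpn hκ hk
  obtain ⟨I, hI, hi⟩ := exists_mem_pSets (i := i) hp hpn
  have h1 := hκ I hI
  rw [← Finset.add_sum_erase I κ hi] at h1
  have h2 : ∑ l ∈ I.erase i, κ l ≤ ∑ l ∈ I.erase i, k := Finset.sum_le_sum fun l _ => hk l
  rw [Finset.sum_const, nsmul_eq_mul] at h2
  have h3 : ((I.erase i).card : ℝ) ≤ n := by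
    exact_mod_cast (Finset.card_le_univ (I.erase i)).trans (by simp)
  have h4 : (1 : ℝ) ≤ n := by exact_mod_cast hp.trans hpn
  rw [abs_le]
  constructor
  · nlinarith
  · have := hk i
    nlinarith

/-- One of the sums `λ_I` is bounded, since their product is. -/
theorem inv_le_sum_linCoeff (hp : 1 ≤ p) (hpn : p ≤ n)
    (hκ : ∀ I ∈ pSets n p, 0 < ∑ i ∈ I, κ i) {L : ℝ} (hL : 0 ≤ L)
    (hprod : ∏ I ∈ pSets n p, ∑ i ∈ I, κ i ≤ L) : (L + 1)⁻¹ ≤ ∑ i, linCoeff p κ i := by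
  have hn : 0 < n := by omega
  obtain ⟨I, hI, -⟩ := exists_mem_pSets (i := ⟨0, hn⟩) hp hpn
  by_contra hlt
  push Not at hlt
  have hall : ∀ J ∈ pSets n p, L + 1 ≤ ∑ i ∈ J, κ i := by
    intro J hJ
    have h1 := (inv_sum_le_sum_linCoeff hp hκ hJ).trans hlt.le
    exact (inv_le_inv₀ (hκ J hJ) (by positivity)).1 h1
  have h2 : (L + 1) ^ (pSets n p).card ≤ ∏ J ∈ pSets n p, ∑ i ∈ J, κ i := by
    rw [← Finset.prod_const]
    exact Finset.prod_le_prod (fun _ _ => by positivity) hall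
  have h3 : L + 1 ≤ (L + 1) ^ (pSets n p).card :=
    le_self_pow₀ (by linarith) (Finset.card_ne_zero_of_mem hI)
  linarith

/-- Either the quadratic term `∑ F^{ii} κ_i²` controls `k² ∑ F^{ii}`, or all principal curvatures
are bounded below by a small negative multiple of the largest one. -/
theorem sq_mul_sum_linCoeff_le_or (hp : 1 ≤ p) (hpn : p ≤ n)
    (hκ : ∀ I ∈ pSets n p, 0 < ∑ i ∈ I, κ i) {i₀ : Fin n} (hmax : ∀ i, κ i ≤ κ i₀) :
    κ i₀ ^ 2 * ∑ i, linCoeff p κ i ≤ 4 * n ^ 3 * ∑ i, linCoeff p κ i * κ i ^ 2 ∨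
      (p < n ∧ ∀ j, -(κ i₀ / (2 * n)) ≤ κ j) := by
  have hk0 := pos_of_forall_le hp hpn hκ hmax
  have hn1 : (1 : ℝ) ≤ n := by exact_mod_cast hp.trans hpn
  -- It suffices that an index with the largest coefficient has a curvature comparable to `κ i₀`.
  have key : ∀ j, (∀ i, linCoeff p κ i ≤ linCoeff p κ j) → κ i₀ ^ 2 ≤ 4 * n ^ 2 * κ j ^ 2 →
      κ i₀ ^ 2 * ∑ i, linCoeff p κ i ≤ 4 * n ^ 3 * ∑ i, linCoeff p κ i * κ i ^ 2 := by
    intro j hj hkj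
    have h1 : ∑ i, linCoeff p κ i ≤ n * linCoeff p κ j := by
      refine (Finset.sum_le_sum fun i _ => hj i).trans ?_
      simp
    have h2 : linCoeff p κ j * κ j ^ 2 ≤ ∑ i, linCoeff p κ i * κ i ^ 2 :=
      Finset.single_le_sum (f := fun i => linCoeff p κ i * κ i ^ 2)
        (fun i _ => mul_nonneg (linCoeff_nonneg hκ i) (sq_nonneg _)) (Finset.mem_univ j)
    have h3 := linCoeff_nonneg hκ j
    calc κ i₀ ^ 2 * ∑ i, linCoeff p κ i ≤ κ i₀ ^ 2 * (n * linCoeff p κ j) := by gcongr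
      _ ≤ (4 * n ^ 2 * κ j ^ 2) * (n * linCoeff p κ j) := by gcongr
      _ = 4 * n ^ 3 * (linCoeff p κ j * κ j ^ 2) := by ring
      _ ≤ _ := by gcongr
  by_cases hall : ∀ j, -(κ i₀ / (2 * n)) ≤ κ j
  · rcases hpn.lt_or_eq with hlt | rfl
    · exact Or.inr ⟨hlt, hall⟩
    · left
      -- For `p = n` all coefficients are equal.
      refine key i₀ (fun i => le_of_eq ?_) ?_
      · have : pSets p p = {Finset.univ} := by
          have := Finset.powersetCard_self (Finset.univ : Finset (Fin p))
          simpa using this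
        simp only [linCoeff]
        rw [this]
        simp [Finset.filter_singleton]
      · have h4 : (1 : ℝ) ≤ 4 * (p : ℝ) ^ 2 := by nlinarith
        exact le_mul_of_one_le_left (sq_nonneg _) h4
  · left
    push Not at hall
    obtain ⟨j, hj⟩ := hall
    obtain ⟨l, -, hl⟩ := Finset.exists_min_image Finset.univ κ ⟨j, Finset.mem_univ j⟩
    refine key l (fun i => linCoeff_anti hκ (hl i (Finset.mem_univ i))) ?_
    have h1 : κ l < -(κ i₀ / (2 * n)) := (hl j (Finset.mem_univ j)).trans_lt hj
    have h2 : κ i₀ / (2 * n) ≤ -κ l := by linarith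
    have h3 : κ i₀ ≤ 2 * n * (-κ l) := by
      rw [div_le_iff₀ (by positivity)] at h2
      linarith
    calc κ i₀ ^ 2 ≤ (2 * n * (-κ l)) ^ 2 := by gcongr
      _ = _ := by ring

theorem half_le_sum {i₀ : Fin n} (hk0 : 0 < κ i₀)
    (hlow : ∀ j, -(κ i₀ / (2 * n)) ≤ κ j) {I : Finset (Fin n)} (hi : i₀ ∈ I) :
    κ i₀ / 2 ≤ ∑ i ∈ I, κ i := by
  have hn : 0 < n := i₀.pos
  rw [← Finset.add_sum_erase I κ hi]
  have h2 : ∑ l ∈ I.erase i₀, -(κ i₀ / (2 * n)) ≤ ∑ l ∈ I.erase i₀, κ l :=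
    Finset.sum_le_sum fun l _ => hlow l
  rw [Finset.sum_const, nsmul_eq_mul] at h2
  have h3 : ((I.erase i₀).card : ℝ) ≤ n := by
    exact_mod_cast (Finset.card_le_univ (I.erase i₀)).trans (by simp)
  have hn' : (0 : ℝ) < n := by exact_mod_cast hn
  have h4 : ((I.erase i₀).card : ℝ) * (κ i₀ / (2 * n)) ≤ n * (κ i₀ / (2 * n)) := by gcongr
  have h5 : (n : ℝ) * (κ i₀ / (2 * n)) = κ i₀ / 2 := by field_simp
  linarith

theorem linCoeff_le_of_lower_bound {i₀ : Fin n} (hk0 : 0 < κ i₀)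
    (hlow : ∀ j, -(κ i₀ / (2 * n)) ≤ κ j) :
    linCoeff p κ i₀ ≤ 2 * (pSets n p).card / κ i₀ := by
  have h1 : linCoeff p κ i₀ ≤ ∑ I ∈ pSets n p with i₀ ∈ I, 2 / κ i₀ := by
    refine Finset.sum_le_sum fun I hI => ?_
    rw [Finset.mem_filter] at hI
    have := inv_anti₀ (by positivity) (half_le_sum hk0 hlow hI.2)
    rwa [inv_div] at this
  refine h1.trans ?_
  rw [Finset.sum_const, nsmul_eq_mul, mul_comm 2, mul_div_assoc]
  gcongr
  exact Finset.filter_subset _ _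

theorem card_pSets_filter_mem (hp : 1 ≤ p) (i : Fin n) :
    ((pSets n p).filter fun I => i ∈ I).card = (n - 1).choose (p - 1) := by
  have h : ((pSets n p).filter fun I => i ∈ I).card =
      (Finset.powersetCard (p - 1) (Finset.univ.erase i)).card := by
    refine Finset.card_nbij' (fun I => I.erase i) (fun I => insert i I) ?_ ?_ ?_ ?_
    · intro I hI
      simp only [Finset.coe_filter, Set.mem_ofPred_eq, Finset.mem_powersetCard] at hI
      simp only [Finset.mem_coe, Finset.mem_powersetCard]
      exact ⟨Finset.erase_subset_erase _ (Finset.subset_univ _), by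
        rw [Finset.card_erase_of_mem hI.2, hI.1.2]⟩
    · intro I hI
      simp only [Finset.mem_coe, Finset.mem_powersetCard] at hI
      have hi : i ∉ I := fun h => by simpa using hI.1 h
      simp only [Finset.coe_filter, Set.mem_ofPred_eq, Finset.mem_powersetCard]
      refine ⟨⟨Finset.subset_univ _, ?_⟩, by simp⟩
      rw [Finset.card_insert_of_notMem hi, hI.2]; omega
    · intro I hI
      simp only [Finset.coe_filter, Set.mem_ofPred_eq] at hI
      exact Finset.insert_erase hI.2
    · intro I hI
      simp only [Finset.mem_coe, Finset.mem_powersetCard] at hI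
      have hi : i ∉ I := fun h => by simpa using hI.1 h
      exact Finset.erase_insert hi
  rw [h, Finset.card_powersetCard, Finset.card_erase_of_mem (Finset.mem_univ _)]
  simp

theorem card_pSets_filter_notMem (i : Fin n) :
    ((pSets n p).filter fun I => i ∉ I).card = (n - 1).choose p := by
  have h : (pSets n p).filter (fun I => i ∉ I) =
      Finset.powersetCard p (Finset.univ.erase i) := by
    ext I
    simp only [Finset.mem_filter, Finset.mem_powersetCard]
    constructor
    · rintro ⟨h1, h2⟩
      exact ⟨fun l hl => Finset.mem_erase.2 ⟨fun h => h2 (h ▸ hl), Finset.mem_univ _⟩, h1.2⟩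
    · rintro ⟨h1, h2⟩
      exact ⟨⟨Finset.subset_univ _, h2⟩, fun h => by simpa using h1 h⟩
  rw [h, Finset.card_powersetCard, Finset.card_erase_of_mem (Finset.mem_univ _)]
  simp

/-- This is where the assumption `p ≥ n / 2` is used. -/
theorem choose_pred_le_choose_pred (hp : 1 ≤ p) (hpn : p < n) (hn : n ≤ 2 * p) :
    (n - 1).choose p ≤ (n - 1).choose (p - 1) := by
  obtain ⟨q, rfl⟩ : ∃ q, p = q + 1 := ⟨p - 1, by omega⟩
  obtain ⟨m, rfl⟩ : ∃ m, n = m + 1 := ⟨n - 1, by omega⟩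
  simp only [Nat.add_sub_cancel]
  have h := Nat.choose_succ_right_eq m q
  have h1 : m - q ≤ q + 1 := by omega
  have h2 : m.choose (q + 1) * (q + 1) ≤ m.choose q * (q + 1) := by
    rw [h]; exact Nat.mul_le_mul_left _ h1
  exact Nat.le_of_mul_le_mul_right h2 (by omega)

/-- If all principal curvatures are bounded below by a small negative multiple of the largest one,
then the sums `λ_I` with `i₀ ∈ I` are at least `κ i₀ / 2`. As `p ≥ n / 2`, they are at least as many
as the others, and the bound on the product makes one of the others as small as a multiple of
`1 / κ i₀`. -/
theorem le_sum_linCoeff_of_lower_bound (hp : 1 ≤ p) (hpn : p < n) (hn : n ≤ 2 * p)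
    (hκ : ∀ I ∈ pSets n p, 0 < ∑ i ∈ I, κ i) {L : ℝ} (hL : 0 ≤ L)
    (hprod : ∏ I ∈ pSets n p, ∑ i ∈ I, κ i ≤ L) {i₀ : Fin n} (hk : 2 ≤ κ i₀)
    (hlow : ∀ j, -(κ i₀ / (2 * n)) ≤ κ j) :
    κ i₀ / (2 * (L + 1)) ≤ ∑ i, linCoeff p κ i := by
  by_contra hlt
  push Not at hlt
  set k := κ i₀ with hkdef
  have hall : ∀ J ∈ pSets n p, 2 * (L + 1) / k ≤ ∑ i ∈ J, κ i := by
    intro J hJ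
    have h1 := (inv_sum_le_sum_linCoeff hp hκ hJ).trans hlt.le
    have h2 : k / (2 * (L + 1)) = (2 * (L + 1) / k)⁻¹ := by rw [inv_div]
    rw [h2] at h1
    exact (inv_le_inv₀ (hκ J hJ) (by positivity)).1 h1
  set M := (n - 1).choose (p - 1) with hM
  set M' := (n - 1).choose p with hM'
  have hMM : M' ≤ M := choose_pred_le_choose_pred hp hpn hn
  have hM'1 : M' ≠ 0 := (Nat.choose_pos (by omega)).ne'
  have e1 : (k / 2) ^ M ≤ ∏ I ∈ pSets n p with i₀ ∈ I, ∑ i ∈ I, κ i := by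
    rw [hM, ← card_pSets_filter_mem hp i₀, ← Finset.prod_const]
    refine Finset.prod_le_prod (fun _ _ => by positivity) fun I hI => ?_
    rw [Finset.mem_filter] at hI
    exact half_le_sum (by linarith) hlow hI.2
  have e2 : (2 * (L + 1) / k) ^ M' ≤ ∏ I ∈ pSets n p with i₀ ∉ I, ∑ i ∈ I, κ i := by
    rw [hM', ← card_pSets_filter_notMem i₀, ← Finset.prod_const]
    refine Finset.prod_le_prod (fun _ _ => by positivity) fun I hI => ?_
    rw [Finset.mem_filter] at hI
    exact hall I hI.1
  have e3 : (k / 2) ^ M' ≤ (k / 2) ^ M := pow_le_pow_right₀ (by linarith) hMM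
  have e4 : (k / 2) ^ M' * (2 * (L + 1) / k) ^ M' ≤ L := by
    refine le_trans ?_ hprod
    rw [← Finset.prod_filter_mul_prod_filter_not (pSets n p) (fun I => i₀ ∈ I)]
    exact mul_le_mul (e3.trans e1) e2 (by positivity) (le_trans (by positivity) e1)
  rw [← mul_pow] at e4
  have e5 : k / 2 * (2 * (L + 1) / k) = L + 1 := by field_simp
  rw [e5] at e4
  have e6 : L + 1 ≤ (L + 1) ^ M' := le_self_pow₀ (by linarith) hM'1
  linarith

end Cone

end PrescribedCurvature

namespace PrescribedCurvature

open Filter Topology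

/-! ### Representing the graph as a graph over one of its tangent planes -/

section TangentGraph

variable {n : ℕ}

theorem areaElement_pos (u : Space n → ℝ) (x : Space n) : 0 < areaElement u x :=
  Real.sqrt_pos.2 (by positivity)

theorem areaElement_sq (u : Space n → ℝ) (x : Space n) :
    areaElement u x ^ 2 = 1 + ‖gradient u x‖ ^ 2 :=
  Real.sq_sqrt (by positivity)

theorem continuousSMul_of_normedSpace {E : Type*} [NormedAddCommGroup E] [NormedSpace ℝ E] :
    ContinuousSMul ℝ E := inferInstance

/-- A shortcut: instance search does not find this one in reasonable time. -/
instance instContinuousSMulAmbient : ContinuousSMul ℝ (WithLp 2 (Space n × ℝ)) :=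
  continuousSMul_of_normedSpace

theorem toLp_pair_fst (a : Space n) (s : ℝ) : (WithLp.toLp 2 (a, s) : Ambient n).fst = a := rfl

theorem toLp_pair_snd (a : Space n) (s : ℝ) : (WithLp.toLp 2 (a, s) : Ambient n).snd = s := rfl

/-- The upward normal `(-Du, 1)`, not normalized. -/
noncomputable def rawNormal (u : Space n → ℝ) (x : Space n) : Ambient n :=
  WithLp.toLp 2 (-gradient u x, (1 : ℝ))

theorem upwardNormal_eq_smul (u : Space n → ℝ) (x : Space n) :
    upwardNormal u x = (areaElement u x)⁻¹ • rawNormal u x := by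
  refine congrArg (WithLp.toLp 2) (Prod.ext ?_ ?_)
  · simp [rawNormal]
  · simp [rawNormal]

theorem norm_rawNormal (u : Space n → ℝ) (x : Space n) : ‖rawNormal u x‖ = areaElement u x := by
  have h : ‖rawNormal u x‖ ^ 2 = areaElement u x ^ 2 := by
    rw [areaElement_sq, ← real_inner_self_eq_norm_sq, rawNormal, WithLp.prod_inner_apply]
    simp
    ring
  exact (pow_left_inj₀ (norm_nonneg _) (areaElement_pos u x).le two_ne_zero).1 h

theorem norm_upwardNormal (u : Space n → ℝ) (x : Space n) : ‖upwardNormal u x‖ = 1 := by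
  rw [upwardNormal_eq_smul, norm_smul, norm_rawNormal, norm_inv, Real.norm_of_nonneg
    (areaElement_pos u x).le, inv_mul_cancel₀ (areaElement_pos u x).ne']

theorem inner_rawNormal (u : Space n → ℝ) (x : Space n) (W : Ambient n) :
    inner ℝ (rawNormal u x) W = W.snd - fderiv ℝ u x W.fst := by
  rw [rawNormal, WithLp.prod_inner_apply, ← inner_gradient_left]
  simp only [inner_neg_left, RCLike.inner_apply, conj_trivial, mul_one, WithLp.ofLp_fst,
    WithLp.ofLp_snd]
  ring

theorem toLp_eq_add (a : Space n) (s : ℝ) :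
    (WithLp.toLp 2 (a, s) : Ambient n) =
      WithLp.toLp 2 (a, 0) + s • WithLp.toLp 2 ((0 : Space n), (1 : ℝ)) := by
  rw [← WithLp.toLp_smul, ← WithLp.toLp_add, Prod.smul_mk, Prod.mk_add_mk]
  simp

/-- The identification of `ℝⁿ × ℝ` with `ℝⁿ⁺¹` as a continuous linear map. -/
noncomputable abbrev ambientL (n : ℕ) : Space n × ℝ →L[ℝ] Ambient n :=
  ((WithLp.prodContinuousLinearEquiv 2 ℝ (Space n) ℝ).symm : Space n × ℝ →L[ℝ] Ambient n)

theorem metricForm_eq_inner (u : Space n → ℝ) (x a b : Space n) :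
    metricForm u x a b = inner ℝ (WithLp.toLp 2 (a, fderiv ℝ u x a) : Ambient n)
      (WithLp.toLp 2 (b, fderiv ℝ u x b)) := by
  rw [metricForm, WithLp.prod_inner_apply]
  simp [mul_comm]

theorem metricForm_self (u : Space n → ℝ) (x a : Space n) :
    metricForm u x a a = ‖a‖ ^ 2 + fderiv ℝ u x a ^ 2 := by
  rw [metricForm, real_inner_self_eq_norm_sq, sq (fderiv ℝ u x a)]

theorem hasFDerivAt_graph {u : Space n → ℝ} {x : Space n} (hu : DifferentiableAt ℝ u x) :
    HasFDerivAt (fun x => (WithLp.toLp 2 (x, u x) : Ambient n))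
      ((ambientL n).comp ((ContinuousLinearMap.id ℝ (Space n)).prod (fderiv ℝ u x))) x :=
  (ambientL n).hasFDerivAt.comp x ((hasFDerivAt_id x).prodMk hu.hasFDerivAt)

theorem exists_isometry_map_vertical {V : Ambient n} (hV : ‖V‖ = 1) :
    ∃ O : Ambient n ≃ₗᵢ[ℝ] Ambient n, O (WithLp.toLp 2 ((0 : Space n), (1 : ℝ))) = V := by
  refine ⟨Submodule.reflection (ℝ ∙ ((WithLp.toLp 2 ((0 : Space n), (1 : ℝ)) : Ambient n) - V))ᗮ,
    Submodule.reflection_sub ?_⟩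
  rw [hV]
  have : ‖(WithLp.toLp 2 ((0 : Space n), (1 : ℝ)) : Ambient n)‖ ^ 2 = 1 := by
    rw [← real_inner_self_eq_norm_sq, WithLp.prod_inner_apply]
    simp
  exact (pow_eq_one_iff_of_nonneg (norm_nonneg _) two_ne_zero).1 this

/-- Near `x₀` the graph of `u` is also the graph of a function `v` over the tangent plane at
`(x₀, u x₀)`, by the inverse function theorem applied to the projection to that plane. -/
theorem exists_local_graph {Ω : Set (Space n)} (hΩ : IsOpen Ω) {u : Space n → ℝ}
    (hu : ContDiffOn ℝ 4 u Ω) {x₀ : Space n} (hx₀ : x₀ ∈ Ω) :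
    ∃ (O : Ambient n ≃ₗᵢ[ℝ] Ambient n) (v : Space n → ℝ) (φ : Space n → Space n),
      O (WithLp.toLp 2 ((0 : Space n), (1 : ℝ))) = upwardNormal u x₀ ∧ φ 0 = x₀ ∧ v 0 = 0 ∧
      ContDiffAt ℝ 4 v 0 ∧ ContDiffAt ℝ 4 φ 0 ∧
      ∀ᶠ y in 𝓝 0, (WithLp.toLp 2 (φ y, u (φ y)) : Ambient n) =
        WithLp.toLp 2 (x₀, u x₀) + O (WithLp.toLp 2 (y, v y)) := by
  obtain ⟨O, hO⟩ := exists_isometry_map_vertical (norm_upwardNormal u x₀)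
  have hux : ContDiffAt ℝ 4 u x₀ := hu.contDiffAt (hΩ.mem_nhds hx₀)
  have hud : DifferentiableAt ℝ u x₀ := hux.differentiableAt (by norm_num)
  let OL : Ambient n →L[ℝ] Ambient n := (O.symm.toContinuousLinearEquiv : Ambient n →L[ℝ] Ambient n)
  let P : Ambient n →L[ℝ] Space n := (WithLp.fstL 2 ℝ (Space n) ℝ).comp OL
  let Q : Ambient n →L[ℝ] ℝ := (WithLp.sndL 2 ℝ (Space n) ℝ).comp OL
  let X : Space n → Ambient n := fun x => WithLp.toLp 2 (x, u x)
  have hX : ContDiffAt ℝ 4 X x₀ :=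
    (ambientL n).contDiff.contDiffAt.comp x₀ (contDiffAt_id.prodMk hux)
  let ψ : Space n → Space n := fun x => P (X x - X x₀)
  have hψ : ContDiffAt ℝ 4 ψ x₀ :=
    P.contDiff.contDiffAt.comp x₀ (hX.sub contDiffAt_const)
  let DX : Space n →L[ℝ] Ambient n :=
    (ambientL n).comp ((ContinuousLinearMap.id ℝ (Space n)).prod (fderiv ℝ u x₀))
  have hDX : HasFDerivAt X DX x₀ := hasFDerivAt_graph hud
  have hψ' : HasFDerivAt ψ (P.comp DX) x₀ :=
    P.hasFDerivAt.comp x₀ (hDX.sub_const (X x₀))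
  -- The only tangent vector that is also normal is zero.
  have hinj : Function.Injective (P.comp DX : Space n →L[ℝ] Space n).toLinearMap := by
    rw [injective_iff_map_eq_zero]
    intro a ha
    have h1 : (O.symm (DX a)).fst = 0 := ha
    have h2 : O.symm (DX a) = (O.symm (DX a)).snd • WithLp.toLp 2 ((0 : Space n), (1 : ℝ)) := by
      have h3 : O.symm (DX a) =
          WithLp.toLp 2 ((O.symm (DX a)).fst, (O.symm (DX a)).snd) := rfl
      conv_lhs => rw [h3, h1, toLp_eq_add]
      have : (WithLp.toLp 2 ((0 : Space n), (0 : ℝ)) : Ambient n) = 0 := rfl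
      rw [this, zero_add]
    have h3 : DX a = (O.symm (DX a)).snd • upwardNormal u x₀ := by
      have := congrArg O h2
      rwa [O.apply_symm_apply, map_smul, hO] at this
    have h4 : inner ℝ (upwardNormal u x₀) (DX a) = 0 := by
      rw [upwardNormal_eq_smul, real_inner_smul_left, inner_rawNormal]
      have e1 : (DX a).fst = a := rfl
      have e2 : (DX a).snd = fderiv ℝ u x₀ a := rfl
      rw [e1, e2]; simp
    rw [h3, real_inner_smul_right, real_inner_self_eq_norm_sq, norm_upwardNormal] at h4
    have h5 : (O.symm (DX a)).snd = 0 := by simpa using h4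
    rw [h5, zero_smul] at h3
    exact congrArg (fun W : Ambient n => W.fst) h3
  let e : Space n ≃L[ℝ] Space n := (LinearEquiv.ofInjectiveEndo _ hinj).toContinuousLinearEquiv
  have he : (e : Space n →L[ℝ] Space n) = P.comp DX := by
    ext a; rfl
  have hψe : HasFDerivAt ψ (e : Space n →L[ℝ] Space n) x₀ := by rw [he]; exact hψ'
  have h40 : (4 : WithTop ℕ∞) ≠ 0 := by norm_num
  have hψ0 : ψ x₀ = 0 := by simp [ψ]
  let φ := hψ.localInverse hψe h40
  have hφ : ContDiffAt ℝ 4 φ 0 := by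
    have := hψ.to_localInverse hψe h40
    rwa [hψ0] at this
  have hφ0 : φ 0 = x₀ := by
    have := hψ.localInverse_apply_image hψe h40
    rwa [hψ0] at this
  have hright : ∀ᶠ y in 𝓝 0, ψ (φ y) = y := by
    have := (hψ.hasStrictFDerivAt' hψe h40).eventually_right_inverse
    rwa [hψ0] at this
  refine ⟨O, fun y => Q (X (φ y) - X x₀), φ, hO, hφ0, by simp [hφ0], ?_, hφ, ?_⟩
  · refine Q.contDiff.contDiffAt.comp 0 (ContDiffAt.sub ?_ contDiffAt_const)
    exact ContDiffAt.comp (g := X) 0 (by rw [hφ0]; exact hX) hφ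
  · filter_upwards [hright] with y hy
    have h1 : O.symm (X (φ y) - X x₀) = WithLp.toLp 2 (y, Q (X (φ y) - X x₀)) := by
      have h3 : O.symm (X (φ y) - X x₀) =
          WithLp.toLp 2 (ψ (φ y), Q (X (φ y) - X x₀)) := rfl
      rw [h3, hy]
    rw [← h1, O.apply_symm_apply]
    simp [X]

/-- `O` maps the vertical direction to the upward normal at `x₀`, and near `0` the graph of `v`,
moved by the rigid motion `Z ↦ (x₀, u x₀) + O Z`, is the graph of `u` near `x₀`. The metric, the
second fundamental form and the normal correspond to each other. -/
structure IsTangentGraph (Ω : Set (Space n)) (u : Space n → ℝ) (x₀ : Space n)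
    (O : Ambient n ≃ₗᵢ[ℝ] Ambient n) (v : Space n → ℝ) : Prop where
  map_vertical : O (WithLp.toLp 2 ((0 : Space n), (1 : ℝ))) = upwardNormal u x₀
  contDiffAt : ContDiffAt ℝ 4 v 0
  apply_zero : v 0 = 0
  fderiv_zero : fderiv ℝ v 0 = 0
  eventually_graph : ∀ᶠ y in 𝓝 0,
    (WithLp.toLp 2 (x₀, u x₀) + O (WithLp.toLp 2 (y, v y))).fst ∈ Ω ∧
    u (WithLp.toLp 2 (x₀, u x₀) + O (WithLp.toLp 2 (y, v y))).fst =
      (WithLp.toLp 2 (x₀, u x₀) + O (WithLp.toLp 2 (y, v y))).snd ∧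
    upwardNormal u (WithLp.toLp 2 (x₀, u x₀) + O (WithLp.toLp 2 (y, v y))).fst =
      O (upwardNormal v y) ∧
    ∃ D : Space n →L[ℝ] Space n,
      (∀ a b, metricForm u (WithLp.toLp 2 (x₀, u x₀) + O (WithLp.toLp 2 (y, v y))).fst
        (D a) (D b) = metricForm v y a b) ∧
      (∀ a b, secondForm u (WithLp.toLp 2 (x₀, u x₀) + O (WithLp.toLp 2 (y, v y))).fst
        (D a) (D b) = secondForm v y a b)

/-- First order: the tangent vectors correspond to each other. -/
theorem tangent_eq_of_eventuallyEq {u v : Space n → ℝ} {φ : Space n → Space n} {X₀ : Ambient n}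
    {O : Ambient n ≃ₗᵢ[ℝ] Ambient n} {y : Space n} (hu : DifferentiableAt ℝ u (φ y))
    (hv : DifferentiableAt ℝ v y) (hφ : DifferentiableAt ℝ φ y)
    (h : ∀ᶠ z in 𝓝 y, (WithLp.toLp 2 (φ z, u (φ z)) : Ambient n) =
        X₀ + O (WithLp.toLp 2 (z, v z))) (a : Space n) :
    (WithLp.toLp 2 (fderiv ℝ φ y a, fderiv ℝ u (φ y) (fderiv ℝ φ y a)) : Ambient n) =
      O (WithLp.toLp 2 (a, fderiv ℝ v y a)) := by
  have h1 := (hasFDerivAt_graph hu).comp y hφ.hasFDerivAt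
  have h2 := ((O.toContinuousLinearEquiv : Ambient n →L[ℝ] Ambient n).hasFDerivAt.comp y
    (hasFDerivAt_graph hv)).const_add X₀
  have h3 := h1.congr_of_eventuallyEq (h.mono fun z hz => hz.symm)
  have := congrArg (fun L : Space n →L[ℝ] Ambient n => L a) (h3.unique h2)
  exact this

/-- The normals are determined by the tangent spaces up to sign; the sign is that of the inner
product in `hc`. -/
theorem upwardNormal_eq_of_tangent {u v : Space n → ℝ} {x y : Space n} {D : Space n → Space n}
    {O : Ambient n ≃ₗᵢ[ℝ] Ambient n}
    (hT : ∀ a, (WithLp.toLp 2 (D a, fderiv ℝ u x (D a)) : Ambient n) =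
      O (WithLp.toLp 2 (a, fderiv ℝ v y a)))
    (hc : 0 < inner ℝ (rawNormal u x) (O (WithLp.toLp 2 ((0 : Space n), (1 : ℝ))))) :
    upwardNormal u x = O (upwardNormal v y) ∧
      areaElement u x =
        inner ℝ (rawNormal u x) (O (WithLp.toLp 2 ((0 : Space n), (1 : ℝ)))) * areaElement v y := by
  set c := inner ℝ (rawNormal u x) (O (WithLp.toLp 2 ((0 : Space n), (1 : ℝ)))) with hcdef
  have h0 : ∀ a, inner ℝ (rawNormal u x) (O (WithLp.toLp 2 (a, 0))) = - fderiv ℝ v y a * c := by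
    intro a
    have h1 : inner ℝ (rawNormal u x) (O (WithLp.toLp 2 (a, fderiv ℝ v y a))) = 0 := by
      rw [← hT a, inner_rawNormal]
      simp
    rw [toLp_eq_add, map_add, inner_add_right, map_smul, real_inner_smul_right] at h1
    linarith
  have hN : rawNormal u x = c • O (rawNormal v y) := by
    refine ext_inner_right ℝ fun W => ?_
    obtain ⟨Z, rfl⟩ := O.surjective W
    have hZ : Z = WithLp.toLp 2 (Z.fst, Z.snd) := rfl
    rw [real_inner_smul_left, O.inner_map_map, inner_rawNormal v y]
    conv_lhs => rw [hZ, toLp_eq_add, map_add, map_smul, inner_add_right, real_inner_smul_right, h0]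
    ring
  have hw : areaElement u x = c * areaElement v y := by
    rw [← norm_rawNormal, ← norm_rawNormal, hN, norm_smul, O.norm_map, Real.norm_of_nonneg hc.le]
  refine ⟨?_, hw⟩
  rw [upwardNormal_eq_smul, upwardNormal_eq_smul, hw, hN, smul_smul, map_smul]
  congr 1
  field_simp

/-- Second order: differentiating the orthogonality of tangent vectors and normal. -/
theorem hess_eq_of_eventually_tangent {u v : Space n → ℝ} {φ : Space n → Space n}
    {O : Ambient n ≃ₗᵢ[ℝ] Ambient n} {y : Space n} (hu : DifferentiableAt ℝ (fderiv ℝ u) (φ y))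
    (hv : DifferentiableAt ℝ (fderiv ℝ v) y) (hφ : DifferentiableAt ℝ φ y)
    (hT : ∀ᶠ z in 𝓝 y, ∀ a,
      (WithLp.toLp 2 (fderiv ℝ φ z a, fderiv ℝ u (φ z) (fderiv ℝ φ z a)) : Ambient n) =
        O (WithLp.toLp 2 (a, fderiv ℝ v z a))) (a b : Space n) :
    hess u (φ y) (fderiv ℝ φ y b) (fderiv ℝ φ y a) =
      inner ℝ (rawNormal u (φ y)) (O (WithLp.toLp 2 ((0 : Space n), (1 : ℝ)))) * hess v y b a := by
  set e : Ambient n := O (WithLp.toLp 2 ((0 : Space n), (1 : ℝ))) with he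
  let W : Space n → Ambient n := fun z => O (WithLp.toLp 2 (a, 0)) + (fderiv ℝ v z a) • e
  have hWeq : ∀ z, W z = O (WithLp.toLp 2 (a, fderiv ℝ v z a)) := by
    intro z
    simp only [W]
    rw [toLp_eq_add a (fderiv ℝ v z a), map_add, map_smul]
  have hva : HasFDerivAt (fun z => fderiv ℝ v z a) ((hess v y).flip a) y := by
    have := hv.hasFDerivAt.clm_apply (hasFDerivAt_const a y)
    simpa [hess] using this
  have hW : HasFDerivAt W (((hess v y).flip a).smulRight e) y :=
    (hva.smul_const e).const_add _
  have h1 := (WithLp.sndL 2 ℝ (Space n) ℝ).hasFDerivAt.comp y hW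
  have h2 := (WithLp.fstL 2 ℝ (Space n) ℝ).hasFDerivAt.comp y hW
  have h3 := (hu.hasFDerivAt.comp y hφ.hasFDerivAt).clm_apply h2
  have h4 := h1.sub h3
  have h0 : HasFDerivAt (fun _ : Space n => (0 : ℝ)) (0 : Space n →L[ℝ] ℝ) y :=
    hasFDerivAt_const _ _
  have h5 := h0.congr_of_eventuallyEq (f₁ := fun z => (W z).snd - fderiv ℝ u (φ z) (W z).fst) (by
    filter_upwards [hT] with z hz
    rw [hWeq, ← hz a]
    simp)
  have h6 := congrArg (fun L : Space n →L[ℝ] ℝ => L b) (h4.unique h5)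
  have hWy : (W y).fst = fderiv ℝ φ y a := by
    rw [hWeq, ← hT.self_of_nhds a, toLp_pair_fst]
  simp [hWy] at h6
  rw [inner_rawNormal]
  have e1 : fderiv ℝ (fderiv ℝ u) (φ y) = hess u (φ y) := rfl
  rw [e1] at h6
  linarith

theorem exists_isTangentGraph {Ω : Set (Space n)} (hΩ : IsOpen Ω) {u : Space n → ℝ}
    (hu : ContDiffOn ℝ 4 u Ω) {x₀ : Space n} (hx₀ : x₀ ∈ Ω) :
    ∃ O v, IsTangentGraph Ω u x₀ O v := by
  obtain ⟨O, v, φ, hO, hφ0, hv0, hv, hφ, hX⟩ := exists_local_graph hΩ hu hx₀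
  have hcont : ContinuousAt φ 0 := hφ.continuousAt
  have hmem : ∀ᶠ y in 𝓝 0, φ y ∈ Ω :=
    hcont.eventually (by rw [hφ0]; exact hΩ.mem_nhds hx₀)
  have hu4 : ∀ x ∈ Ω, ContDiffAt ℝ 4 u x := fun x hx => hu.contDiffAt (hΩ.mem_nhds hx)
  have hud : ∀ x ∈ Ω, DifferentiableAt ℝ u x := fun x hx =>
    (hu4 x hx).differentiableAt (by norm_num)
  have hudd : ∀ x ∈ Ω, DifferentiableAt ℝ (fderiv ℝ u) x := fun x hx =>
    ((hu4 x hx).fderiv_right (m := 3) (by norm_num)).differentiableAt (by norm_num)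
  have hvev : ∀ᶠ y in 𝓝 0, ContDiffAt ℝ 4 v y := hv.eventually (by simp)
  have hφev : ∀ᶠ y in 𝓝 0, ContDiffAt ℝ 4 φ y := hφ.eventually (by simp)
  have hT : ∀ᶠ y in 𝓝 0, ∀ a,
      (WithLp.toLp 2 (fderiv ℝ φ y a, fderiv ℝ u (φ y) (fderiv ℝ φ y a)) : Ambient n) =
        O (WithLp.toLp 2 (a, fderiv ℝ v y a)) := by
    filter_upwards [hX.eventually_nhds, hvev, hφev, hmem] with y h1 h2 h3 h4
    exact tangent_eq_of_eventuallyEq (hud _ h4) (h2.differentiableAt (by norm_num))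
      (h3.differentiableAt (by norm_num)) h1
  -- The inner product deciding the orientation is positive at the base point.
  have hc : ∀ᶠ y in 𝓝 0,
      0 < inner ℝ (rawNormal u (φ y)) (O (WithLp.toLp 2 ((0 : Space n), (1 : ℝ)))) := by
    have hcc : ContinuousAt (fun y => inner ℝ (rawNormal u (φ y))
        (O (WithLp.toLp 2 ((0 : Space n), (1 : ℝ))))) 0 := by
      simp_rw [inner_rawNormal]
      refine continuousAt_const.sub (ContinuousAt.clm_apply ?_ continuousAt_const)
      exact ContinuousAt.comp (g := fderiv ℝ u)
        (by rw [hφ0]; exact (hudd x₀ hx₀).continuousAt) hcont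
    refine hcc.eventually (lt_mem_nhds ?_)
    simp only [hφ0]
    rw [hO, upwardNormal_eq_smul, real_inner_smul_right, real_inner_self_eq_norm_sq,
      norm_rawNormal]
    have := areaElement_pos u x₀
    positivity
  refine ⟨O, v, hO, hv, hv0, ?_, ?_⟩
  · ext a
    have h1 := hT.self_of_nhds a
    have h2 : inner ℝ (upwardNormal u x₀) (O (WithLp.toLp 2 (a, fderiv ℝ v 0 a))) = 0 := by
      rw [← h1, upwardNormal_eq_smul, real_inner_smul_left, inner_rawNormal, hφ0]
      simp
    rw [← hO, O.inner_map_map, WithLp.prod_inner_apply] at h2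
    simpa using h2
  · filter_upwards [hX, hT.eventually_nhds, hc, hvev, hφev, hmem] with y h1 h2 h3 h4 h5 h6
    have e1 : (WithLp.toLp 2 (x₀, u x₀) + O (WithLp.toLp 2 (y, v y))).fst = φ y := by
      rw [← h1]; rfl
    have e2 : (WithLp.toLp 2 (x₀, u x₀) + O (WithLp.toLp 2 (y, v y))).snd = u (φ y) := by
      rw [← h1]; rfl
    rw [e1, e2]
    obtain ⟨k1, k2⟩ := upwardNormal_eq_of_tangent h2.self_of_nhds h3
    refine ⟨h6, rfl, k1, fderiv ℝ φ y, fun a b => ?_, fun a b => ?_⟩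
    · rw [metricForm_eq_inner, metricForm_eq_inner, h2.self_of_nhds a, h2.self_of_nhds b,
        O.inner_map_map]
    · rw [secondForm, secondForm, hess_eq_of_eventually_tangent (hudd _ h6)
        ((h4.fderiv_right (m := 3) (by norm_num)).differentiableAt (by norm_num))
        (h5.differentiableAt (by norm_num)) h2, k2]
      exact mul_div_mul_left _ _ h3.ne'

end TangentGraph

end PrescribedCurvature

namespace PrescribedCurvature

open Filter Topology

set_option maxSynthPendingDepth 3

/-! ### Second order expansions over a tangent plane -/

section Derivatives

variable {E : Type*} [NormedAddCommGroup E] [NormedSpace ℝ E]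

/-- `D³v(y)`, a trilinear form. -/
noncomputable def third (v : E → ℝ) (y : E) :
    E →L[ℝ] E →L[ℝ] E →L[ℝ] ℝ :=
  fderiv ℝ (fderiv ℝ (fderiv ℝ v)) y

/-- `D⁴v(y)`, a quadrilinear form. -/
noncomputable def fourth (v : E → ℝ) (y : E) :
    E →L[ℝ] E →L[ℝ] E →L[ℝ] E →L[ℝ] ℝ :=
  fderiv ℝ (third v) y

variable {v : E → ℝ}

theorem fderiv_fderiv_symm {y : E} (hv : ContDiffAt ℝ 2 v y) (a b : E) :
    fderiv ℝ (fderiv ℝ v) y a b = fderiv ℝ (fderiv ℝ v) y b a :=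
  (hv.isSymmSndFDerivAt (by simp)).eq a b

theorem third_symm {y : E} (hv : ContDiffAt ℝ 3 v y) (a b c : E) :
    third v y a b c = third v y b a c := by
  have h : ContDiffAt ℝ 2 (fderiv ℝ v) y := hv.fderiv_right (by norm_num)
  have := (h.isSymmSndFDerivAt (by simp)).eq a b
  exact congrArg (fun L : E →L[ℝ] ℝ => L c) this

theorem third_symm' {y : E} (hv : ContDiffAt ℝ 3 v y) (a b c : E) :
    third v y a b c = third v y a c b := by
  have hd : DifferentiableAt ℝ (fderiv ℝ (fderiv ℝ v)) y :=
    ((hv.fderiv_right (m := 2) (by norm_num)).fderiv_right (m := 1) (by norm_num)).differentiableAt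
      (by norm_num)
  have h1 : ∀ b c : E, HasFDerivAt (fun z => fderiv ℝ (fderiv ℝ v) z b c)
      (((third v y).flip b).flip c) y := by
    intro b c
    have := (hd.hasFDerivAt.clm_apply (hasFDerivAt_const b y)).clm_apply (hasFDerivAt_const c y)
    refine this.congr_fderiv ?_
    ext a
    simp [third]
  have h2 := (h1 b c).congr_of_eventuallyEq (f₁ := fun z => fderiv ℝ (fderiv ℝ v) z c b) (by
    filter_upwards [hv.eventually (by simp)] with z hz
    exact fderiv_fderiv_symm (hz.of_le (by norm_num)) c b)
  have := congrArg (fun L : E →L[ℝ] ℝ => L a) (h2.unique (h1 c b))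
  simpa using this

theorem fourth_symm₁₂ {y : E} (hv : ContDiffAt ℝ 4 v y) (a b c d : E) :
    fourth v y a b c d = fourth v y b a c d := by
  have h : ContDiffAt ℝ 2 (fderiv ℝ (fderiv ℝ v)) y :=
    (hv.fderiv_right (m := 3) (by norm_num)).fderiv_right (by norm_num)
  have := (h.isSymmSndFDerivAt (by simp)).eq a b
  exact congrArg (fun L : E →L[ℝ] E →L[ℝ] ℝ => L c d) this

theorem hasFDerivAt_third_apply {y : E} (hv : ContDiffAt ℝ 4 v y) (b c d : E) :
    HasFDerivAt (fun z => third v z b c d)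
      ((((fourth v y).flip b).flip c).flip d) y := by
  have hd : DifferentiableAt ℝ (third v) y :=
    (((hv.fderiv_right (m := 3) (by norm_num)).fderiv_right (m := 2) (by norm_num)).fderiv_right
      (m := 1) (by norm_num)).differentiableAt (by norm_num)
  have := ((hd.hasFDerivAt.clm_apply (hasFDerivAt_const b y)).clm_apply
    (hasFDerivAt_const c y)).clm_apply (hasFDerivAt_const d y)
  refine this.congr_fderiv ?_
  ext a
  simp [fourth]

theorem fourth_symm₂₃ {y : E} (hv : ContDiffAt ℝ 4 v y) (a b c d : E) :
    fourth v y a b c d = fourth v y a c b d := by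
  have h2 := (hasFDerivAt_third_apply hv b c d).congr_of_eventuallyEq
    (f₁ := fun z => third v z c b d) (by
    filter_upwards [hv.eventually (by simp)] with z hz
    exact third_symm (hz.of_le (by norm_num)) c b d)
  have := congrArg (fun L : E →L[ℝ] ℝ => L a) (h2.unique (hasFDerivAt_third_apply hv c b d))
  simpa using this

theorem fourth_symm₃₄ {y : E} (hv : ContDiffAt ℝ 4 v y) (a b c d : E) :
    fourth v y a b c d = fourth v y a b d c := by
  have h2 := (hasFDerivAt_third_apply hv b c d).congr_of_eventuallyEq
    (f₁ := fun z => third v z b d c) (by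
    filter_upwards [hv.eventually (by simp)] with z hz
    exact third_symm' (hz.of_le (by norm_num)) b d c)
  have := congrArg (fun L : E →L[ℝ] ℝ => L a) (h2.unique (hasFDerivAt_third_apply hv b d c))
  simpa using this

theorem fourth_swap {y : E} (hv : ContDiffAt ℝ 4 v y) (a b : E) :
    fourth v y a a b b = fourth v y b b a a := by
  rw [fourth_symm₂₃ hv, fourth_symm₁₂ hv, fourth_symm₃₄ hv, fourth_symm₂₃ hv]


theorem hasJet_fderiv_fderiv (hv : ContDiffAt ℝ 4 v 0) (d : E) :
    HasJet (fun t : ℝ => fderiv ℝ (fderiv ℝ v) (t • d)) (fderiv ℝ (fderiv ℝ v) 0) (third v 0 d)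
      (fourth v 0 d d) := by
  have h : ContDiffAt ℝ 2 (fderiv ℝ (fderiv ℝ v)) 0 :=
    (hv.fderiv_right (m := 3) (by norm_num)).fderiv_right (by norm_num)
  refine (HasJet.comp h (HasJet.smul_id d)).of_eq rfl rfl ?_
  rw [map_zero, zero_add]; rfl

/-- The expansion of the second derivative, evaluated on a curve of vectors. -/
theorem hasJet_fderiv_fderiv_apply (hv : ContDiffAt ℝ 4 v 0) (d : E) {e : ℝ → E} {a b c : E}
    (he : HasJet e a b c) :
    HasJet (fun t : ℝ => fderiv ℝ (fderiv ℝ v) (t • d) (e t) (e t))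
      (fderiv ℝ (fderiv ℝ v) 0 a a)
      (third v 0 d a a + 2 * fderiv ℝ (fderiv ℝ v) 0 a b)
      (fourth v 0 d d a a + 4 * third v 0 d a b + 2 * fderiv ℝ (fderiv ℝ v) 0 b b +
        2 * fderiv ℝ (fderiv ℝ v) 0 a c) := by
  have h := ((hasJet_fderiv_fderiv hv d).apply he).apply he
  have s1 := fderiv_fderiv_symm (hv.of_le (by norm_num)) b a
  have s2 := fderiv_fderiv_symm (hv.of_le (by norm_num)) c a
  have s3 := third_symm' (hv.of_le (by norm_num)) d b a
  refine (h.of_eq rfl ?_ ?_)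
  · simp only [add_apply]
    rw [s1]; ring
  · simp only [add_apply, smul_apply, smul_eq_mul]
    rw [s2, s3]; ring

end Derivatives

section Expansions

variable {n : ℕ}

/-- The vector representing a linear form on `ℝⁿ`, as a continuous linear map. -/
noncomputable def sharp (n : ℕ) : (Space n →L[ℝ] ℝ) →L[ℝ] Space n :=
  ∑ i : Fin n, (ContinuousLinearMap.apply ℝ ℝ (EuclideanSpace.single i (1 : ℝ))).smulRight
    (EuclideanSpace.single i (1 : ℝ))

theorem inner_sharp (ℓ : Space n →L[ℝ] ℝ) (a : Space n) : inner ℝ (sharp n ℓ) a = ℓ a := by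
  conv_rhs => rw [eq_sum_single a]
  simp [sharp, sum_inner, real_inner_smul_left, EuclideanSpace.inner_single_left, mul_comm]

theorem gradient_eq_sharp (v : Space n → ℝ) (y : Space n) :
    gradient v y = sharp n (fderiv ℝ v y) := by
  refine ext_inner_right ℝ fun a => ?_
  rw [inner_gradient_left, inner_sharp]

theorem norm_sharp (ℓ : Space n →L[ℝ] ℝ) : ‖sharp n ℓ‖ = ‖ℓ‖ := by
  have h : (InnerProductSpace.toDual ℝ (Space n)) (sharp n ℓ) = ℓ := by
    ext a
    rw [InnerProductSpace.toDual_apply_apply, inner_sharp]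
  rw [← h, LinearIsometryEquiv.norm_map, h]

variable {v : Space n → ℝ} (hv : ContDiffAt ℝ 4 v 0) (hv1 : fderiv ℝ v 0 = 0)
include hv hv1

theorem hasJet_apply (d : Space n) :
    HasJet (fun t : ℝ => v (t • d)) (v 0) 0 (hess v 0 d d) := by
  refine (HasJet.comp (hv.of_le (by norm_num)) (HasJet.smul_id d)).of_eq rfl ?_ ?_
  · rw [hv1]; rfl
  · rw [map_zero, zero_add]; rfl

theorem hasJet_fderiv (d : Space n) :
    HasJet (fun t : ℝ => fderiv ℝ v (t • d)) 0 (hess v 0 d) (third v 0 d d) := by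
  have h : ContDiffAt ℝ 2 (fderiv ℝ v) 0 := hv.fderiv_right (by norm_num)
  refine (HasJet.comp h (HasJet.smul_id d)).of_eq hv1 rfl ?_
  rw [map_zero, zero_add]; rfl

theorem hasJet_gradient (d : Space n) :
    HasJet (fun t : ℝ => gradient v (t • d)) 0 (sharp n (hess v 0 d))
      (sharp n (third v 0 d d)) := by
  simp_rw [gradient_eq_sharp]
  exact ((hasJet_fderiv hv hv1 d).clm (sharp n)).of_eq (map_zero _) rfl rfl

theorem hasJet_gradient_norm_sq (d : Space n) :
    HasJet (fun t : ℝ => ‖gradient v (t • d)‖ ^ 2) 0 0 (2 * ‖sharp n (hess v 0 d)‖ ^ 2) := by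
  simp_rw [← real_inner_self_eq_norm_sq]
  refine ((hasJet_gradient hv hv1 d).inner (hasJet_gradient hv hv1 d)).of_eq ?_ ?_ ?_ <;> simp

theorem hasJet_inv_areaElement (d : Space n) :
    HasJet (fun t : ℝ => (areaElement v (t • d))⁻¹) 1 0 (-‖sharp n (hess v 0 d)‖ ^ 2) := by
  have h1 : HasDerivAt (fun s : ℝ => (√(1 + s))⁻¹) (-(1 / (2 * √(1 + 0))) / √(1 + 0) ^ 2) 0 :=
    (((hasDerivAt_id (0 : ℝ)).const_add 1).sqrt (by norm_num)).inv (by norm_num)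
  refine ((hasJet_gradient_norm_sq hv hv1 d).scomp_zero h1).of_eq ?_ rfl ?_
  · norm_num
  · norm_num; ring

/-- The expansion of the second fundamental form along a curve of tangent vectors. -/
theorem hasJet_secondForm (d : Space n) {e : ℝ → Space n} {a b c : Space n}
    (he : HasJet e a b c) :
    HasJet (fun t : ℝ => secondForm v (t • d) (e t) (e t)) (hess v 0 a a)
      (third v 0 d a a + 2 * hess v 0 a b)
      (fourth v 0 d d a a + 4 * third v 0 d a b + 2 * hess v 0 b b + 2 * hess v 0 a c
        - ‖sharp n (hess v 0 d)‖ ^ 2 * hess v 0 a a) := by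
  refine ((hasJet_fderiv_fderiv_apply hv d he).mul (hasJet_inv_areaElement hv hv1 d)).of_eq
    ?_ ?_ ?_
  · simp [hess]
  · simp [hess]
  · simp only [hess]; ring

theorem hasJet_metricForm (d a : Space n) :
    HasJet (fun t : ℝ => metricForm v (t • d) a a) (‖a‖ ^ 2) 0 (2 * hess v 0 d a ^ 2) := by
  have h := (hasJet_fderiv hv hv1 d).clm (ContinuousLinearMap.apply ℝ ℝ a)
  have h2 := (HasJet.const (‖a‖ ^ 2)).add (h.mul h)
  refine (h2.congr (Eventually.of_forall fun t => ?_)).of_eq ?_ ?_ ?_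
  · simp only [metricForm_self, ContinuousLinearMap.apply_apply]; ring
  · simp
  · simp
  · simp; ring

theorem hasJet_upwardNormal (d : Space n) :
    HasJet (fun t : ℝ => upwardNormal v (t • d)) (WithLp.toLp 2 ((0 : Space n), (1 : ℝ)))
      (WithLp.toLp 2 (-sharp n (hess v 0 d), (0 : ℝ)))
      (WithLp.toLp 2 (-sharp n (third v 0 d d), -‖sharp n (hess v 0 d)‖ ^ 2)) := by
  have h1 := ((hasJet_gradient hv hv1 d).neg.prodMk (HasJet.const (1 : ℝ))).clm (ambientL n)
  have h2 := (hasJet_inv_areaElement hv hv1 d).smul h1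
  refine (h2.congr (Eventually.of_forall fun t => upwardNormal_eq_smul v (t • d))).of_eq ?_ ?_ ?_
  · refine congrArg (WithLp.toLp 2) (Prod.ext ?_ ?_) <;> simp
  · refine congrArg (WithLp.toLp 2) (Prod.ext ?_ ?_) <;> simp
  · refine congrArg (WithLp.toLp 2) (Prod.ext ?_ ?_) <;> simp

omit hv hv1

/-- The symmetric inverse square root `I - Dv ⊗ Dv / (w (1 + w))` of the metric `I + Dv ⊗ Dv`. It
maps orthonormal frames to frames that are orthonormal for the metric. -/
noncomputable def invSqrtMetric (v : Space n → ℝ) (y a : Space n) : Space n :=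
  a - ((areaElement v y * (1 + areaElement v y))⁻¹ * inner ℝ (gradient v y) a) • gradient v y

theorem metricForm_invSqrtMetric (v : Space n → ℝ) (y a b : Space n) :
    metricForm v y (invSqrtMetric v y a) (invSqrtMetric v y b) = inner ℝ a b := by
  have hw := areaElement_pos v y
  have hw2 := areaElement_sq v y
  rw [metricForm, ← inner_gradient_left, ← inner_gradient_left]
  simp only [invSqrtMetric, inner_sub_left, inner_sub_right, real_inner_smul_left,
    real_inner_smul_right]
  rw [real_inner_self_eq_norm_sq, real_inner_comm (gradient v y) a,
    (by linarith : ‖gradient v y‖ ^ 2 = areaElement v y ^ 2 - 1)]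
  generalize areaElement v y = w at hw ⊢
  have : 1 + w ≠ 0 := by positivity
  field_simp
  ring

theorem hasJet_invSqrtMetric (hv : ContDiffAt ℝ 4 v 0) (hv1 : fderiv ℝ v 0 = 0) (d : Space n)
    {e : ℝ → Space n} {a b c : Space n} (he : HasJet e a b c) :
    HasJet (fun t : ℝ => invSqrtMetric v (t • d) (e t)) a b
      (c - (hess v 0 d a) • sharp n (hess v 0 d)) := by
  have hd : DifferentiableAt ℝ (fun s : ℝ => (√(1 + s) * (1 + √(1 + s)))⁻¹) 0 := by
    have h1 : DifferentiableAt ℝ (fun s : ℝ => √(1 + s)) 0 :=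
      DifferentiableAt.sqrt (by fun_prop) (by norm_num)
    exact (h1.mul (h1.const_add 1)).inv (by norm_num)
  have hg := hasJet_gradient hv hv1 d
  have h1 := (hasJet_gradient_norm_sq hv hv1 d).scomp_zero hd.hasDerivAt
  have h2 := he.sub ((h1.mul (hg.inner he)).smul hg)
  refine (h2.congr (Eventually.of_forall fun t => rfl)).of_eq ?_ ?_ ?_
  · simp
  · simp
  · simp only [inner_zero_left, mul_zero, zero_mul, add_zero, smul_zero, zero_add, zero_smul,
      Real.sqrt_one, inner_sharp]
    rw [smul_smul]
    norm_num
    rw [← mul_assoc]; norm_num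

/-- The reflection in the hyperplane orthogonal to `m`. -/
noncomputable def householder (m a : Space n) : Space n :=
  a - (2 * (inner ℝ a m * (‖m‖ ^ 2)⁻¹)) • m

theorem inner_householder {m : Space n} (hm : m ≠ 0) (a b : Space n) :
    inner ℝ (householder m a) (householder m b) = inner ℝ a b := by
  have : ‖m‖ ≠ 0 := norm_ne_zero_iff.2 hm
  simp only [householder, inner_sub_left, inner_sub_right, real_inner_smul_left,
    real_inner_smul_right]
  rw [real_inner_self_eq_norm_sq, real_inner_comm m b]
  field_simp
  ring

theorem hasJet_householder {m τ : Space n} (hm : ‖m‖ = 1) (hτ : inner ℝ m τ = 0) (a : Space n) :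
    HasJet (fun t : ℝ => householder (m + t • τ) a) (a - (2 * inner ℝ a m) • m)
      (-(2 * inner ℝ a τ) • m - (2 * inner ℝ a m) • τ)
      ((4 * inner ℝ a m * ‖τ‖ ^ 2) • m - (4 * inner ℝ a τ) • τ) := by
  have h1 := HasJet.line m τ
  have h2 : HasJet (fun t : ℝ => ‖m + t • τ‖ ^ 2) 1 0 (2 * ‖τ‖ ^ 2) := by
    simp_rw [← real_inner_self_eq_norm_sq]
    refine (h1.inner h1).of_eq ?_ ?_ ?_
    · rw [real_inner_self_eq_norm_sq, hm]; norm_num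
    · rw [hτ, real_inner_comm, hτ]; norm_num
    · simp
  have h3 := h2.scomp_zero (hasDerivAt_inv (one_ne_zero))
  have h4 := (HasJet.const a).sub
    (((HasJet.const (2 : ℝ)).mul (((HasJet.const a).inner h1).mul h3)).smul h1)
  refine h4.of_eq ?_ ?_ ?_
  · simp
  · simp; module
  · simp; module

end Expansions

end PrescribedCurvature

namespace PrescribedCurvature

open Filter Topology

set_option maxSynthPendingDepth 3

/-! ### Differential inequalities at a maximum point -/

section MaximumPoint

variable {n : ℕ} {v : Space n → ℝ} {b : OrthonormalBasis (Fin n) ℝ (Space n)} {κ F : Fin n → ℝ}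
  {ψ : Space n → ℝ} {c₀ : ℝ}

/-- The function `∑ F^{ii} h(e_i, e_i) - ψ` has a minimum along every curve of orthonormal
frames. -/
theorem jet_le_of_frame (hv : ContDiffAt ℝ 4 v 0) (hv1 : fderiv ℝ v 0 = 0)
    (hop : ∀ᶠ y in 𝓝 0, ∀ e : Fin n → Space n,
      (∀ k l, metricForm v y (e k) (e l) = if k = l then 1 else 0) →
      ψ y ≤ c₀ + ∑ i, F i * secondForm v y (e i) (e i))
    (h0 : ψ 0 = c₀ + ∑ i, F i * κ i) (d : Space n) {ψ₁ ψ₂ : ℝ}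
    (hψ : HasJet (fun t : ℝ => ψ (t • d)) (ψ 0) ψ₁ ψ₂) {e : Fin n → ℝ → Space n}
    {A B C : Fin n → Space n} (he : ∀ i, HasJet (e i) (A i) (B i) (C i))
    (horth : ∀ t k l, metricForm v (t • d) (e k t) (e l t) = if k = l then 1 else 0)
    (hA : ∀ i, hess v 0 (A i) (A i) = κ i) :
    ψ₁ = ∑ i, F i * (third v 0 d (A i) (A i) + 2 * hess v 0 (A i) (B i)) ∧
    ψ₂ ≤ ∑ i, F i * (fourth v 0 d d (A i) (A i) + 4 * third v 0 d (A i) (B i) +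
      2 * hess v 0 (B i) (B i) + 2 * hess v 0 (A i) (C i) - ‖sharp n (hess v 0 d)‖ ^ 2 * κ i) := by
  have h1 := (HasJet.const c₀).add (HasJet.sum Finset.univ fun i _ =>
    (HasJet.const (F i)).mul (hasJet_secondForm hv hv1 d (he i)))
  have hlim := tendsto_smul_zero d
  have hle := hlim.eventually hop
  have h2 := hψ.of_eventually_le h1 (hle.mono fun t ht => ht (fun i => e i t) (horth t))
    (by rw [h0]; simp [hA])
  simp only [zero_add, zero_mul, add_zero, mul_zero, hA] at h2
  exact h2

theorem hess_basis (hH : ∀ i a, hess v 0 (b i) a = κ i * inner ℝ (b i) a) (i : Fin n) :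
    hess v 0 (b i) (b i) = κ i := by
  rw [hH, real_inner_self_eq_norm_sq, b.norm_eq_one]; ring

theorem sharp_hess_basis (hH : ∀ i a, hess v 0 (b i) a = κ i * inner ℝ (b i) a) (i : Fin n) :
    sharp n (hess v 0 (b i)) = κ i • b i := by
  refine ext_inner_right ℝ fun a => ?_
  rw [inner_sharp, hH, real_inner_smul_left]

theorem inner_basis (b : OrthonormalBasis (Fin n) ℝ (Space n)) (i j : Fin n) :
    inner ℝ (b i) (b j) = if i = j then 1 else 0 :=
  orthonormal_iff_ite.1 b.orthonormal i j

/-- The equation, differentiated once. -/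
theorem deriv_eq_sum_third (hv : ContDiffAt ℝ 4 v 0) (hv1 : fderiv ℝ v 0 = 0)
    (hH : ∀ i a, hess v 0 (b i) a = κ i * inner ℝ (b i) a)
    (hop : ∀ᶠ y in 𝓝 0, ∀ e : Fin n → Space n,
      (∀ k l, metricForm v y (e k) (e l) = if k = l then 1 else 0) →
      ψ y ≤ c₀ + ∑ i, F i * secondForm v y (e i) (e i))
    (h0 : ψ 0 = c₀ + ∑ i, F i * κ i) (d : Space n) {ψ₁ ψ₂ : ℝ}
    (hψ : HasJet (fun t : ℝ => ψ (t • d)) (ψ 0) ψ₁ ψ₂) :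
    ψ₁ = ∑ i, F i * third v 0 d (b i) (b i) := by
  have := (jet_le_of_frame hv hv1 hop h0 d hψ
    (fun i => hasJet_invSqrtMetric hv hv1 d (HasJet.const (b i)))
    (fun t k l => by rw [metricForm_invSqrtMetric, inner_basis]) (hess_basis hH)).1
  simpa using this

/-- The equation, differentiated twice in a principal direction. The orthonormal frame is the
eigenbasis reflected in the hyperplane orthogonal to `b i₀ + t ∑ τ_i b_i`, made orthonormal for the
metric by `invSqrtMetric`; it turns with an angular velocity proportional to `τ`, which is at our
disposal. The terms with `τ` replace the second derivatives of the curvature operator. -/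
theorem deriv_two_le_sum_fourth (hv : ContDiffAt ℝ 4 v 0) (hv1 : fderiv ℝ v 0 = 0)
    (hH : ∀ i a, hess v 0 (b i) a = κ i * inner ℝ (b i) a)
    (hop : ∀ᶠ y in 𝓝 0, ∀ e : Fin n → Space n,
      (∀ k l, metricForm v y (e k) (e l) = if k = l then 1 else 0) →
      ψ y ≤ c₀ + ∑ i, F i * secondForm v y (e i) (e i))
    (h0 : ψ 0 = c₀ + ∑ i, F i * κ i) (i₀ : Fin n) {ψ₁ ψ₂ : ℝ}
    (hψ : HasJet (fun t : ℝ => ψ (t • b i₀)) (ψ 0) ψ₁ ψ₂) {τ : Fin n → ℝ} (hτ : τ i₀ = 0) :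
    ψ₂ ≤ ∑ i, F i * (fourth v 0 (b i₀) (b i₀) (b i) (b i) - κ i₀ ^ 2 * κ i)
      - 2 * F i₀ * κ i₀ ^ 3 +
      ∑ i, (F i - F i₀) * (-8 * τ i * third v 0 (b i) (b i₀) (b i₀) +
        8 * τ i ^ 2 * (κ i₀ - κ i)) := by
  set T : Space n := ∑ i, τ i • b i with hT
  have hTi : ∀ i, inner ℝ (b i) T = τ i := fun i => b.orthonormal.inner_right_fintype τ i
  have hm0 : ∀ t : ℝ, b i₀ + t • T ≠ 0 := by
    intro t h
    have := congrArg (inner ℝ (b i₀)) h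
    simp [inner_add_right, real_inner_smul_right, hTi, hτ] at this
  have hTT : ‖T‖ ^ 2 = ∑ i, τ i ^ 2 := by
    rw [← real_inner_self_eq_norm_sq]
    conv_lhs => rw [hT, sum_inner]
    refine Finset.sum_congr rfl fun i _ => ?_
    rw [real_inner_smul_left, ← hT, hTi, sq]
  have hHT : ∀ a, hess v 0 T a = ∑ i, τ i * (κ i * inner ℝ (b i) a) := by
    intro a
    simp [hT, hH]
  obtain ⟨X, hX⟩ : ∃ X : Fin n → ℝ, ∀ i, X i = -8 * τ i * third v 0 (b i) (b i₀) (b i₀) +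
      8 * τ i ^ 2 * (κ i₀ - κ i) := ⟨_, fun _ => rfl⟩
  have hframe := fun i => hasJet_invSqrtMetric hv hv1 (b i₀)
    (hasJet_householder (b.norm_eq_one i₀) (by rw [hTi, hτ]) (b i))
  have hb := hess_basis hH
  have hA : ∀ i, hess v 0 (b i - (2 * inner ℝ (b i) (b i₀)) • b i₀)
      (b i - (2 * inner ℝ (b i) (b i₀)) • b i₀) = κ i := by
    intro i
    rw [inner_basis]
    by_cases h : i = i₀
    · subst h
      have e : b i - (2 * (1 : ℝ)) • b i = -b i := by module
      rw [if_pos rfl, e]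
      simp [hb]
    · simp [h, hb]
  have key := (jet_le_of_frame hv hv1 hop h0 (b i₀) hψ hframe
    (fun t k l => by
      rw [metricForm_invSqrtMetric, inner_householder (hm0 t), inner_basis]) hA).2
  have hS : ‖sharp n (hess v 0 (b i₀))‖ ^ 2 = κ i₀ ^ 2 := by
    rw [sharp_hess_basis hH, norm_smul, b.norm_eq_one, mul_one, Real.norm_eq_abs, sq_abs]
  rw [hS] at key
  have hsym := fun a c => third_symm (hv.of_le (by norm_num) : ContDiffAt ℝ 3 v 0) a (b i₀) c
  have hsym' := fun a c d => third_symm' (hv.of_le (by norm_num) : ContDiffAt ℝ 3 v 0) a c d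
  -- Only `b i₀` is moved to first order in a direction other than `b i₀`, so the terms with
  -- `i ≠ i₀` and `i = i₀` are computed separately.
  have hne : ∀ i, i ≠ i₀ →
      F i * (fourth v 0 (b i₀) (b i₀) (b i - (2 * inner ℝ (b i) (b i₀)) • b i₀)
        (b i - (2 * inner ℝ (b i) (b i₀)) • b i₀) +
        4 * third v 0 (b i₀) (b i - (2 * inner ℝ (b i) (b i₀)) • b i₀)
          (-(2 * inner ℝ (b i) T) • b i₀ - (2 * inner ℝ (b i) (b i₀)) • T) +
        2 * hess v 0 (-(2 * inner ℝ (b i) T) • b i₀ - (2 * inner ℝ (b i) (b i₀)) • T)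
          (-(2 * inner ℝ (b i) T) • b i₀ - (2 * inner ℝ (b i) (b i₀)) • T) +
        2 * hess v 0 (b i - (2 * inner ℝ (b i) (b i₀)) • b i₀)
          ((4 * inner ℝ (b i) (b i₀) * ‖T‖ ^ 2) • b i₀ - (4 * inner ℝ (b i) T) • T
            - (hess v 0 (b i₀) (b i - (2 * inner ℝ (b i) (b i₀)) • b i₀)) •
              sharp n (hess v 0 (b i₀))) - κ i₀ ^ 2 * κ i) =
      F i * (fourth v 0 (b i₀) (b i₀) (b i) (b i) - κ i₀ ^ 2 * κ i) +
        F i * X i := by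
    intro i hi
    have h1 : inner ℝ (b i) (b i₀) = 0 := by rw [inner_basis, if_neg hi]
    have h2 : inner ℝ (b i₀) (b i) = 0 := by rw [inner_basis, if_neg (Ne.symm hi)]
    have h3 : hess v 0 (b i₀) (b i) = 0 := by rw [hH, h2, mul_zero]
    have h4 := (hsym (b i) (b i₀)).symm
    rw [h1, hTi, hX]
    simp only [mul_zero, zero_mul, zero_smul, sub_zero, zero_sub, h3, h4, map_smul, map_neg,
      smul_apply, smul_eq_mul, hb, hH i T, hTi]
    ring
  have heq :
      F i₀ * (fourth v 0 (b i₀) (b i₀) (b i₀ - (2 * inner ℝ (b i₀) (b i₀)) • b i₀)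
        (b i₀ - (2 * inner ℝ (b i₀) (b i₀)) • b i₀) +
        4 * third v 0 (b i₀) (b i₀ - (2 * inner ℝ (b i₀) (b i₀)) • b i₀)
          (-(2 * inner ℝ (b i₀) T) • b i₀ - (2 * inner ℝ (b i₀) (b i₀)) • T) +
        2 * hess v 0 (-(2 * inner ℝ (b i₀) T) • b i₀ - (2 * inner ℝ (b i₀) (b i₀)) • T)
          (-(2 * inner ℝ (b i₀) T) • b i₀ - (2 * inner ℝ (b i₀) (b i₀)) • T) +
        2 * hess v 0 (b i₀ - (2 * inner ℝ (b i₀) (b i₀)) • b i₀)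
          ((4 * inner ℝ (b i₀) (b i₀) * ‖T‖ ^ 2) • b i₀ - (4 * inner ℝ (b i₀) T) • T
            - (hess v 0 (b i₀) (b i₀ - (2 * inner ℝ (b i₀) (b i₀)) • b i₀)) •
              sharp n (hess v 0 (b i₀))) - κ i₀ ^ 2 * κ i₀) =
      F i₀ * (fourth v 0 (b i₀) (b i₀) (b i₀) (b i₀) - κ i₀ ^ 2 * κ i₀) - 2 * F i₀ * κ i₀ ^ 3
        - F i₀ * ∑ i, X i := by
    have h1 : inner ℝ (b i₀) (b i₀) = (1 : ℝ) := by rw [inner_basis, if_pos rfl]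
    have e : b i₀ - (2 * (1 : ℝ)) • b i₀ = -b i₀ := by module
    have h3 : third v 0 (b i₀) (b i₀) T = ∑ i, τ i * third v 0 (b i) (b i₀) (b i₀) := by
      simp only [hT, map_sum, map_smul, smul_eq_mul]
      refine Finset.sum_congr rfl fun i _ => ?_
      rw [hsym' (b i₀) (b i₀) (b i), ← hsym (b i) (b i₀)]
    have h4 : hess v 0 T T = ∑ i, τ i ^ 2 * κ i := by
      rw [hHT]
      refine Finset.sum_congr rfl fun i _ => ?_
      rw [hTi]; ring
    have h5 : ∑ i, X i =
        -8 * third v 0 (b i₀) (b i₀) T + 8 * κ i₀ * ‖T‖ ^ 2 - 8 * hess v 0 T T := by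
      rw [h3, h4, hTT, Finset.mul_sum, Finset.mul_sum, Finset.mul_sum, ← Finset.sum_add_distrib,
        ← Finset.sum_sub_distrib]
      exact Finset.sum_congr rfl fun i _ => by rw [hX]; ring
    rw [h5, h1, hTi, hτ, e, sharp_hess_basis hH]
    simp only [mul_zero, neg_zero, zero_smul, sub_zero, zero_sub, map_smul, map_neg, map_sub,
      smul_apply, neg_apply, smul_eq_mul, hb, mul_one]
    ring
  refine key.trans (le_of_eq ?_)
  have hX0 : X i₀ = 0 := by rw [hX, hτ]; ring
  rw [Finset.sum_congr rfl fun i _ => (show _ = F i * (fourth v 0 (b i₀) (b i₀) (b i) (b i) -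
      κ i₀ ^ 2 * κ i) + F i * X i +
      (if i = i₀ then -(2 * F i₀ * κ i₀ ^ 3) - F i₀ * ∑ i, X i else 0) by
    by_cases hi : i = i₀
    · subst hi
      rw [heq, hX0, if_pos rfl]; ring
    · rw [hne i hi, if_neg hi, add_zero])]
  simp_rw [← hX]
  rw [Finset.sum_add_distrib, Finset.sum_add_distrib, Finset.sum_ite_eq' Finset.univ i₀,
    if_pos (Finset.mem_univ _)]
  simp_rw [sub_mul (F _) (F i₀)]
  rw [Finset.sum_sub_distrib, ← Finset.mul_sum]
  ring

/-- The conditions of first and second order at a maximum point of `h(b₀, b₀) / (V g(b₀, b₀))`. -/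
theorem max_conditions (hv : ContDiffAt ℝ 4 v 0) (hv1 : fderiv ℝ v 0 = 0)
    (hH : ∀ i a, hess v 0 (b i) a = κ i * inner ℝ (b i) a) {i₀ : Fin n} {V : Space n → ℝ} {Λ : ℝ}
    (hmax : ∀ᶠ y in 𝓝 0,
      secondForm v y (b i₀) (b i₀) ≤ Λ * V y * metricForm v y (b i₀) (b i₀))
    (h0 : κ i₀ = Λ * V 0) {i : Fin n} {V₁ V₂ : ℝ}
    (hV : HasJet (fun t : ℝ => V (t • b i)) (V 0) V₁ V₂) :
    third v 0 (b i) (b i₀) (b i₀) = Λ * V₁ ∧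
    fourth v 0 (b i) (b i) (b i₀) (b i₀) - κ i ^ 2 * κ i₀ ≤
      Λ * V₂ + if i = i₀ then 2 * κ i₀ ^ 3 else 0 := by
  have h1 := hasJet_secondForm hv hv1 (b i) (HasJet.const (b i₀))
  have h2 := ((HasJet.const Λ).mul hV).mul (hasJet_metricForm hv hv1 (b i) (b i₀))
  have hlim := tendsto_smul_zero (b i)
  have h3 := h1.of_eventually_le h2 (hlim.eventually hmax) (by
    rw [hess_basis hH, h0, b.norm_eq_one]; ring)
  have hS : ‖sharp n (hess v 0 (b i))‖ ^ 2 = κ i ^ 2 := by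
    rw [sharp_hess_basis hH, norm_smul, b.norm_eq_one, mul_one, Real.norm_eq_abs, sq_abs]
  simp only [map_zero, mul_zero, add_zero, zero_mul, one_pow, mul_one, zero_add,
    b.norm_eq_one, hS, hess_basis hH] at h3
  rw [hH i (b i₀), inner_basis] at h3
  refine ⟨h3.1, h3.2.trans (le_of_eq ?_)⟩
  split_ifs with h
  · subst h
    rw [← h0]; ring
  · ring

/-- The fourth derivatives cancel between the equation and the second order condition. -/
theorem main_inequality (hv : ContDiffAt ℝ 4 v 0) (hv1 : fderiv ℝ v 0 = 0)
    (hH : ∀ i a, hess v 0 (b i) a = κ i * inner ℝ (b i) a) (hF : ∀ i, 0 ≤ F i)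
    (hop : ∀ᶠ y in 𝓝 0, ∀ e : Fin n → Space n,
      (∀ k l, metricForm v y (e k) (e l) = if k = l then 1 else 0) →
      ψ y ≤ c₀ + ∑ i, F i * secondForm v y (e i) (e i))
    (hψ0 : ψ 0 = c₀ + ∑ i, F i * κ i) {i₀ : Fin n} {ψ₁ ψ₂ : ℝ}
    (hψ : HasJet (fun t : ℝ => ψ (t • b i₀)) (ψ 0) ψ₁ ψ₂)
    {V : Space n → ℝ} {Λ : ℝ}
    (hmax : ∀ᶠ y in 𝓝 0,
      secondForm v y (b i₀) (b i₀) ≤ Λ * V y * metricForm v y (b i₀) (b i₀))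
    (h0 : κ i₀ = Λ * V 0) {V₁ V₂ : Fin n → ℝ}
    (hV : ∀ i, HasJet (fun t : ℝ => V (t • b i)) (V 0) (V₁ i) (V₂ i))
    {τ : Fin n → ℝ} (hτ : τ i₀ = 0) :
    ψ₂ + κ i₀ ^ 2 * ∑ i, F i * κ i - κ i₀ * ∑ i, F i * κ i ^ 2 ≤
      Λ * ∑ i, F i * V₂ i +
      ∑ i, (F i - F i₀) * (-8 * τ i * (Λ * V₁ i) + 8 * τ i ^ 2 * (κ i₀ - κ i)) := by
  have h1 := deriv_two_le_sum_fourth hv hv1 hH hop hψ0 i₀ hψ hτ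
  have h2 := fun i => max_conditions hv hv1 hH hmax h0 (hV i)
  simp_rw [fun i => (h2 i).1] at h1
  have h3 : ∑ i, F i * (fourth v 0 (b i₀) (b i₀) (b i) (b i) - κ i₀ ^ 2 * κ i) ≤
      ∑ i, F i * (Λ * V₂ i + (if i = i₀ then 2 * κ i₀ ^ 3 else 0) + κ i ^ 2 * κ i₀
        - κ i₀ ^ 2 * κ i) := by
    refine Finset.sum_le_sum fun i _ => mul_le_mul_of_nonneg_left ?_ (hF i)
    have := (h2 i).2
    rw [fourth_swap hv] at this
    linarith
  have h4 : ∑ i, F i * (Λ * V₂ i + (if i = i₀ then 2 * κ i₀ ^ 3 else 0) + κ i ^ 2 * κ i₀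
        - κ i₀ ^ 2 * κ i) = Λ * ∑ i, F i * V₂ i + 2 * F i₀ * κ i₀ ^ 3 +
        κ i₀ * ∑ i, F i * κ i ^ 2 - κ i₀ ^ 2 * ∑ i, F i * κ i := by
    have e : 2 * F i₀ * κ i₀ ^ 3 = ∑ i, F i * (if i = i₀ then 2 * κ i₀ ^ 3 else 0) := by
      simp; ring
    rw [e, Finset.mul_sum, Finset.mul_sum, Finset.mul_sum, ← Finset.sum_add_distrib,
      ← Finset.sum_add_distrib, ← Finset.sum_sub_distrib]
    exact Finset.sum_congr rfl fun i _ => by ring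
  linarith

end MaximumPoint

end PrescribedCurvature

namespace PrescribedCurvature

set_option maxSynthPendingDepth 3

/-! ### Bounding the largest principal curvature -/

section Estimates

variable {n p : ℕ}

theorem le_of_mul_sq_le {A P Q k : ℝ} (hA : 0 < A) (hQ : 0 ≤ Q) (hk : 1 ≤ k)
    (h : A * k ^ 2 ≤ P * k + Q) : k ≤ (P + Q) / A := by
  rw [le_div_iff₀ hA]
  have h1 : (A * k) * k ≤ (P + Q) * k := by nlinarith
  have := le_of_mul_le_mul_right h1 (by linarith)
  linarith

/-- The numbers entering the inequality at the maximum point for the test function with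
parameters `a` and `B`: `β_i` and `α` are the tangential and normal components of the vertical
vector, `q_i` and `s_i + κ_i r` are the first and second derivatives of `|x - z|² / 2` in principal
directions, `ψβ` is the first derivative of the logarithm of the right-hand side in the direction
of `β`, and `ψ₂` its second derivative in the direction `i₀`. The vector `τ` is proportional to the
angular velocity of the frame. -/
def MaxInequality (p : ℕ) (κ : Fin n → ℝ) (i₀ : Fin n) (a B α : ℝ) (β q s : Fin n → ℝ)
    (r ψβ ψ₂ : ℝ) : Prop :=
  ∀ τ : Fin n → ℝ, τ i₀ = 0 →
    ψ₂ + κ i₀ ^ 2 * ∑ i, linCoeff p κ i * κ i - κ i₀ * ∑ i, linCoeff p κ i * κ i ^ 2 ≤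
      κ i₀ * ((-ψβ - α * ∑ i, linCoeff p κ i * κ i ^ 2) / (α - a) +
        ∑ i, linCoeff p κ i * (2 * (κ i * β i / (α - a)) * (B * q i) + (B * q i) ^ 2 -
          B * (s i + κ i * r))) +
      ∑ i, (linCoeff p κ i - linCoeff p κ i₀) *
        (-8 * τ i * (κ i₀ * (-(κ i * β i / (α - a)) - B * q i)) + 8 * τ i ^ 2 * (κ i₀ - κ i))

/-- The estimate when the right-hand side does not depend on the normal. -/
theorem le_of_maxInequality_of_const {κ : Fin n → ℝ} {i₀ : Fin n} {α : ℝ}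
    {β q s : Fin n → ℝ} {r ψβ ψ₂ : ℝ} {α₀ D : ℝ} (hp : 1 ≤ p) (hpn : p ≤ n)
    (hκ : ∀ I ∈ pSets n p, 0 < ∑ i ∈ I, κ i) (hα₀ : 0 < α₀) (hα : α₀ ≤ α) (hD : 0 ≤ D)
    (hψβ : |ψβ| ≤ D) (hψ₂ : -(D * (1 + κ i₀)) ≤ ψ₂)
    (h : MaxInequality p κ i₀ 0 0 α β q s r ψβ ψ₂) :
    κ i₀ ≤ 1 + (2 * D + D / α₀) := by
  rcases le_total (κ i₀) 1 with hk | hk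
  · have : 0 ≤ 2 * D + D / α₀ := by positivity
    linarith
  have h1 := h 0 rfl
  rw [sum_linCoeff_mul_self hκ] at h1
  have hN : (1 : ℝ) ≤ (pSets n p).card := by
    obtain ⟨I, hI, -⟩ := exists_mem_pSets (i := i₀) hp hpn
    exact_mod_cast Finset.card_pos.2 ⟨I, hI⟩
  generalize ((pSets n p).card : ℝ) = M at h1 hN
  generalize ∑ i, linCoeff p κ i * κ i ^ 2 = W at h1
  simp only [Pi.zero_apply, mul_zero, zero_mul, sub_zero, ne_eq, OfNat.ofNat_ne_zero,
    not_false_eq_true, zero_pow, add_zero, Finset.sum_const_zero] at h1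
  have hα' : 0 < α := hα₀.trans_le hα
  have e1 : (-ψβ - α * W) / α = -ψβ / α - W := by field_simp
  have e2 : -ψβ / α ≤ D / α₀ := by
    have h3 : -ψβ ≤ D := (neg_le_abs ψβ).trans hψβ
    calc -ψβ / α ≤ D / α := by gcongr
      _ ≤ D / α₀ := by gcongr
  generalize κ i₀ = k at *
  rw [e1] at h1
  have e3 : k * (-ψβ / α) ≤ k * (D / α₀) := by gcongr
  have e4 : 1 * k ^ 2 ≤ (D + D / α₀) * k + D := by nlinarith [sq_nonneg k]
  have := le_of_mul_sq_le one_pos hD hk e4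
  linarith

/-- The inequality at the maximum point, divided by the largest curvature `k`. Here `W`, `S`, `X`,
`Y` stand for `∑ F_i κ_i²`, `∑ F_i`, the terms quadratic in the gradient of the test function, and
`∑ F_i s_i`. -/
theorem div_curvature_le {α₀ α N k M W S X Y B r R D c ψβ ψ₂ rot z E : ℝ} (hα₀ : 0 < α₀)
    (hN : α = N + α₀ / 2) (hN0 : α₀ / 2 ≤ N) (hN1 : N ≤ 1) (hk : 1 ≤ k) (hM : 0 ≤ M) (hW : 0 ≤ W)
    (hB : 0 ≤ B) (hD : 0 ≤ D) (hr : |r| ≤ R) (hY : α₀ ^ 2 * S ≤ Y) (hψβ : |ψβ| ≤ D * (1 + k))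
    (hz : z ≤ k * (c * k + E)) (hψ₂ : -(D * (1 + k ^ 2 + z)) ≤ ψ₂)
    (h : ψ₂ + k ^ 2 * M - k * W ≤ k * ((-ψβ - α * W) / N + (X - B * Y - B * r * M)) + rot) :
    α₀ / 2 * W + B * α₀ ^ 2 * S ≤
      (D * (2 + c) + 4 * D / α₀) * k + (D * E + B * R * M) + X + rot / k := by
  have hNpos : 0 < N := by linarith
  have hkpos : 0 < k := by linarith
  have e3 : (-ψβ - α * W) / N = -ψβ / N - W - α₀ / 2 * W / N := by
    rw [hN]; field_simp; ring
  have e4 : α₀ / 2 * W ≤ α₀ / 2 * W / N := by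
    rw [le_div_iff₀ hNpos]
    exact mul_le_of_le_one_right (by positivity) hN1
  have e5 : -ψβ / N ≤ 4 * D / α₀ * k := by
    have h3 : -ψβ ≤ D * (1 + k) := (neg_le_abs ψβ).trans hψβ
    calc -ψβ / N ≤ D * (1 + k) / N := by gcongr
      _ ≤ D * (k + k) / (α₀ / 2) := by gcongr
      _ = 4 * D / α₀ * k := by field_simp; ring
  have e6 : -(k * (D * (2 + c) * k + D * E)) ≤ ψ₂ := by
    refine le_trans ?_ hψ₂
    have h4 : D * (1 + k ^ 2 + z) ≤ D * (k ^ 2 + k ^ 2 + k * (c * k + E)) := by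
      gcongr
      exact one_le_pow₀ hk
    linarith
  have e7 : -(B * r * M) ≤ B * R * M := by
    have h5 : -r ≤ R := (neg_le_abs r).trans hr
    have h6 : B * M * -r ≤ B * M * R := by gcongr
    linarith
  have e8 : B * α₀ ^ 2 * S ≤ B * Y := by
    rw [mul_assoc]; gcongr
  rw [e3] at h
  have e10 : rot = k * (rot / k) := by field_simp
  have h10 : 0 ≤ k ^ 2 * M := by positivity
  have e11 : k * (α₀ / 2 * W / N + ψβ / N + B * Y + B * r * M) ≤
      k * (D * (2 + c) * k + D * E + X + rot / k) := by
    have : -ψβ / N = -(ψβ / N) := by ring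
    rw [this] at h
    rw [e10] at h
    linarith
  have e12 := le_of_mul_le_mul_left e11 hkpos
  have : -ψβ / N = -(ψβ / N) := by ring
  linarith

/-- If `∑ F_i κ_i²` controls `k² ∑ F_i`, it dominates, and the cross terms are absorbed by
Young's inequality. -/
theorem le_of_quadratic_dominates {F κ w y : Fin n → ℝ} {α₀ k L P Q E Z ρ : ℝ} (hα₀ : 0 < α₀)
    (hL : 0 ≤ L) (hP : 0 ≤ P) (hQ : 0 ≤ Q) (hρ : 0 < ρ)
    (hk : 1 ≤ k) (hF : ∀ i, 0 ≤ F i) (hw : ∀ i, |w i| ≤ 2 / α₀ * |κ i|) (hy : ∀ i, |y i| ≤ E)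
    (hS : (L + 1)⁻¹ ≤ ∑ i, F i) (hZ : 0 ≤ Z)
    (hW : k ^ 2 * ∑ i, F i ≤ ρ * ∑ i, F i * κ i ^ 2)
    (h : α₀ / 2 * ∑ i, F i * κ i ^ 2 + Z ≤
      P * k + Q + ∑ i, F i * (2 * w i * y i + y i ^ 2)) :
    k ≤ ((L + 1) * P + ((L + 1) * Q + (4 / α₀ * (2 * E / α₀) ^ 2 + E ^ 2))) /
      (α₀ / (4 * ρ)) := by
  generalize hC : 4 / α₀ * (2 * E / α₀) ^ 2 + E ^ 2 = C₃
  have hC₃ : 0 ≤ C₃ := by rw [← hC]; positivity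
  have h2 : ∑ i, F i * (2 * w i * y i + y i ^ 2) ≤
      α₀ / 4 * ∑ i, F i * κ i ^ 2 + C₃ * ∑ i, F i := by
    rw [Finset.mul_sum, Finset.mul_sum, ← Finset.sum_add_distrib]
    refine Finset.sum_le_sum fun i _ => ?_
    have e : α₀ / 4 * (F i * κ i ^ 2) + C₃ * F i = F i * (α₀ / 4 * κ i ^ 2 + C₃) := by ring
    rw [e]
    refine mul_le_mul_of_nonneg_left ?_ (hF i)
    have hE : 0 ≤ E := (abs_nonneg _).trans (hy i)
    have h3 : 2 * w i * y i ≤ 2 * (2 / α₀ * |κ i|) * E := by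
      calc _ ≤ |2 * w i * y i| := le_abs_self _
        _ = 2 * |w i| * |y i| := by rw [abs_mul, abs_mul, abs_two]
        _ ≤ _ := by
          have := hw i
          have := hy i
          gcongr
    have h4 : y i ^ 2 ≤ E ^ 2 := sq_le_sq' (abs_le.1 (hy i)).1 (abs_le.1 (hy i)).2
    have h5 : 2 * (2 / α₀ * |κ i|) * E ≤ α₀ / 4 * κ i ^ 2 + 4 / α₀ * (2 * E / α₀) ^ 2 := by
      have e1 : α₀ / 4 * κ i ^ 2 + 4 / α₀ * (2 * E / α₀) ^ 2 -
          2 * (2 / α₀ * |κ i|) * E = α₀ / 4 * (|κ i| - 4 / α₀ * (2 * E / α₀)) ^ 2 := by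
        rw [← sq_abs (κ i)]; field_simp; ring
      have e2 : 0 ≤ α₀ / 4 * (|κ i| - 4 / α₀ * (2 * E / α₀)) ^ 2 := by positivity
      linarith
    rw [← hC]
    linarith
  have hSpos : 0 < ∑ i, F i := lt_of_lt_of_le (by positivity) hS
  have h3 : 1 ≤ (L + 1) * ∑ i, F i := by
    rwa [inv_le_iff_one_le_mul₀' (by positivity)] at hS
  generalize ∑ i, F i * κ i ^ 2 = W at *
  generalize ∑ i, F i = S at *
  have h5 : α₀ / 4 * W ≤ P * k + Q + C₃ * S := by linarith
  have h6 : α₀ / (4 * ρ) * k ^ 2 * S ≤ α₀ / 4 * W := by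
    have h6 : α₀ / (4 * ρ) * (k ^ 2 * S) ≤ α₀ / (4 * ρ) * (ρ * W) := by gcongr
    have e : α₀ / (4 * ρ) * (ρ * W) = α₀ / 4 * W := by field_simp
    linarith
  have h7 : P * k + Q ≤ (P * k + Q) * ((L + 1) * S) :=
    le_mul_of_one_le_right (by positivity) h3
  have h8 : (α₀ / (4 * ρ) * k ^ 2) * S ≤ ((L + 1) * P * k + ((L + 1) * Q + C₃)) * S := by
    linarith
  exact le_of_mul_sq_le (by positivity) (by positivity) hk (le_of_mul_le_mul_right h8 hSpos)

/-- If all curvatures are bounded below by a small multiple of `-k`, the turning frame cancels the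
gradient terms, and the coefficient `Z ∑ F_i` coming from the exponential factor dominates. -/
theorem le_of_rotation {F κ w y : Fin n → ℝ} {i₀ : Fin n} {k L P Q E Z M c W : ℝ}
    (hL : 0 ≤ L) (hM : 0 ≤ M) (hk : 1 ≤ k) (hF : ∀ i, 0 ≤ F i)
    (hF1 : F i₀ ≤ 2 * M / k) (hanti : ∀ i, F i₀ ≤ F i) (hκ : ∀ i, -k ≤ κ i)
    (hz : ∀ i, |-w i - y i| ≤ c * k + E)
    (hS : k / (2 * (L + 1)) ≤ ∑ i, F i) (hW : 0 ≤ W) (hZ0 : 0 ≤ Z)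
    (hZ : 2 * (L + 1) * (P + 4 * M * n * c ^ 2 + 1) ≤ Z)
    (h : ∀ τ : Fin n → ℝ, τ i₀ = 0 → W + Z * ∑ i, F i ≤
      P * k + Q + ∑ i, F i * (2 * w i * y i + y i ^ 2) +
        (∑ i, (F i - F i₀) * (-8 * τ i * (k * (-w i - y i)) + 8 * τ i ^ 2 * (k - κ i))) / k) :
    k ≤ Q + 4 * M * n * E ^ 2 := by
  have hk0 : 0 < k := by linarith
  -- This `τ` minimizes the rotation terms in the worst case `κ i = -k`.
  have h1 := h (fun i => if i = i₀ then 0 else (-w i - y i) / 4) (by simp)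
  have h2 : (∑ i, (F i - F i₀) * (-8 * (if i = i₀ then 0 else (-w i - y i) / 4) *
      (k * (-w i - y i)) + 8 * (if i = i₀ then 0 else (-w i - y i) / 4) ^ 2 * (k - κ i))) / k ≤
      ∑ i, (F i₀ * (-w i - y i) ^ 2 - F i * (-w i - y i) ^ 2) := by
    rw [div_le_iff₀ hk0, Finset.sum_mul]
    refine Finset.sum_le_sum fun i _ => ?_
    by_cases hi : i = i₀
    · subst hi; simp
    · rw [if_neg hi]
      generalize -w i - y i = z
      have h5 : -8 * (z / 4) * (k * z) + 8 * (z / 4) ^ 2 * (k - κ i) ≤ -(z ^ 2 * k) := by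
        have := mul_nonneg (sq_nonneg z) (by linarith [hκ i] : 0 ≤ k + κ i)
        linarith
      calc _ ≤ (F i - F i₀) * -(z ^ 2 * k) :=
            mul_le_mul_of_nonneg_left h5 (sub_nonneg.2 (hanti i))
        _ = _ := by ring
  have h3 : ∑ i, F i * (2 * w i * y i + y i ^ 2) ≤ ∑ i, F i * (-w i - y i) ^ 2 := by
    refine Finset.sum_le_sum fun i _ => mul_le_mul_of_nonneg_left ?_ (hF i)
    linarith [sq_nonneg (w i)]
  have h4 : ∑ i, F i₀ * (-w i - y i) ^ 2 ≤ 4 * M * n * c ^ 2 * k + 4 * M * n * E ^ 2 := by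
    have e1 : ∀ i ∈ Finset.univ, F i₀ * (-w i - y i) ^ 2 ≤
        2 * M / k * (2 * ((c * k) ^ 2 + E ^ 2)) := by
      intro i _
      have h5 : (-w i - y i) ^ 2 ≤ 2 * ((c * k) ^ 2 + E ^ 2) := by
        have h6 : (-w i - y i) ^ 2 ≤ (c * k + E) ^ 2 :=
          sq_le_sq' (abs_le.1 (hz i)).1 (abs_le.1 (hz i)).2
        linarith [sq_nonneg (c * k - E)]
      exact mul_le_mul hF1 h5 (sq_nonneg _) (by positivity)
    refine (Finset.sum_le_sum e1).trans ?_
    rw [Finset.sum_const, Finset.card_univ, Fintype.card_fin, nsmul_eq_mul]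
    have e2 : (n : ℝ) * (2 * M / k * (2 * ((c * k) ^ 2 + E ^ 2))) =
        4 * M * n * c ^ 2 * k + 4 * M * n * E ^ 2 / k := by
      field_simp; ring
    rw [e2]
    have e3 : 4 * M * n * E ^ 2 / k ≤ 4 * M * n * E ^ 2 := div_le_self (by positivity) hk
    linarith
  rw [Finset.sum_sub_distrib] at h2
  have h5 : 2 * (L + 1) * (P + 4 * M * n * c ^ 2 + 1) * (k / (2 * (L + 1))) ≤ Z * ∑ i, F i := by
    gcongr
  have h6 : 2 * (L + 1) * (P + 4 * M * n * c ^ 2 + 1) * (k / (2 * (L + 1))) =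
      (P + 4 * M * n * c ^ 2 + 1) * k := by
    field_simp
  linarith

/-- The inequality at the maximum point, divided by the largest curvature. -/
theorem MaxInequality.divided {κ : Fin n → ℝ} {i₀ : Fin n} {B α : ℝ} {β q s : Fin n → ℝ}
    {r ψβ ψ₂ α₀ R D : ℝ} (hp : 1 ≤ p) (hpn : p ≤ n)
    (hα₀ : 0 < α₀) (hD : 0 ≤ D) (hB : 0 ≤ B) (hk : 1 ≤ κ i₀)
    (hκ : ∀ I ∈ pSets n p, 0 < ∑ i ∈ I, κ i) (hmax : ∀ i, κ i ≤ κ i₀)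
    (hα : α₀ ≤ α) (hα1 : α ≤ 1) (hβ : ∀ i, |β i| ≤ 1)
    (hq : ∀ i, |q i| ≤ R) (hs : ∀ i, α₀ ^ 2 ≤ s i) (hr : |r| ≤ R)
    (hψβ : |ψβ| ≤ D * (1 + κ i₀))
    (hψ₂ : -(D * (1 + κ i₀ ^ 2 +
      ∑ i, |κ i₀ * (-(κ i * β i / (α - α₀ / 2)) - B * q i)|)) ≤ ψ₂)
    (h : MaxInequality p κ i₀ (α₀ / 2) B α β q s r ψβ ψ₂) :
    (∀ i, |κ i * β i / (α - α₀ / 2)| ≤ 2 / α₀ * |κ i|) ∧ (∀ i, |B * q i| ≤ B * R) ∧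
    (∀ i, |-(κ i * β i / (α - α₀ / 2)) - B * q i| ≤ 2 * n / α₀ * κ i₀ + B * R) ∧
    ∀ τ : Fin n → ℝ, τ i₀ = 0 →
      α₀ / 2 * ∑ i, linCoeff p κ i * κ i ^ 2 + B * α₀ ^ 2 * ∑ i, linCoeff p κ i ≤
        (D * (2 + n * (2 * n / α₀)) + 4 * D / α₀) * κ i₀ +
        (D * (n * (B * R)) + B * R * (pSets n p).card) +
        ∑ i, linCoeff p κ i * (2 * (κ i * β i / (α - α₀ / 2)) * (B * q i) + (B * q i) ^ 2) +
        (∑ i, (linCoeff p κ i - linCoeff p κ i₀) *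
          (-8 * τ i * (κ i₀ * (-(κ i * β i / (α - α₀ / 2)) - B * q i)) +
            8 * τ i ^ 2 * (κ i₀ - κ i))) / κ i₀ := by
  have hκn := abs_le_of_forall_le hp hpn hκ hmax
  have hF := linCoeff_nonneg hκ
  have hFκ := sum_linCoeff_mul_self hκ
  have hN0 : α₀ / 2 ≤ α - α₀ / 2 := by linarith
  have hNpos : 0 < α - α₀ / 2 := by linarith
  have hw : ∀ i, |κ i * β i / (α - α₀ / 2)| ≤ 2 / α₀ * |κ i| := by
    intro i
    rw [abs_div, abs_mul, abs_of_pos hNpos]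
    calc |κ i| * |β i| / (α - α₀ / 2) ≤ |κ i| * 1 / (α₀ / 2) := by gcongr; exact hβ i
      _ = 2 / α₀ * |κ i| := by field_simp
  have hy : ∀ i, |B * q i| ≤ B * R := by
    intro i
    rw [abs_mul, abs_of_nonneg hB]
    exact mul_le_mul_of_nonneg_left (hq i) hB
  have hzle : ∀ i, |-(κ i * β i / (α - α₀ / 2)) - B * q i| ≤ 2 * n / α₀ * κ i₀ + B * R := by
    intro i
    have h1 : |-(κ i * β i / (α - α₀ / 2)) - B * q i| ≤
        |κ i * β i / (α - α₀ / 2)| + |B * q i| := by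
      have := abs_sub (-(κ i * β i / (α - α₀ / 2))) (B * q i)
      rwa [abs_neg] at this
    have h2 : 2 / α₀ * |κ i| ≤ 2 * n / α₀ * κ i₀ := by
      calc 2 / α₀ * |κ i| ≤ 2 / α₀ * (n * κ i₀) := by gcongr; exact hκn i
        _ = _ := by ring
    linarith [hw i, hy i]
  refine ⟨hw, hy, hzle, fun τ hτ => ?_⟩
  have h1 := h τ hτ
  rw [hFκ] at h1
  have e1 : ∑ i, linCoeff p κ i * (2 * (κ i * β i / (α - α₀ / 2)) * (B * q i) + (B * q i) ^ 2 -
      B * (s i + κ i * r)) =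
      ∑ i, linCoeff p κ i * (2 * (κ i * β i / (α - α₀ / 2)) * (B * q i) + (B * q i) ^ 2)
      - B * ∑ i, linCoeff p κ i * s i - B * r * (pSets n p).card := by
    rw [← hFκ, Finset.mul_sum, Finset.mul_sum, ← Finset.sum_sub_distrib,
      ← Finset.sum_sub_distrib]
    exact Finset.sum_congr rfl fun i _ => by ring
  rw [e1] at h1
  refine div_curvature_le hα₀ (by ring) hN0 (by linarith) hk (Nat.cast_nonneg _)
    (Finset.sum_nonneg fun i _ => mul_nonneg (hF i) (sq_nonneg _)) hB hD hr ?_ hψβ ?_ hψ₂ h1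
  · rw [Finset.mul_sum]
    refine Finset.sum_le_sum fun i _ => ?_
    rw [mul_comm]
    exact mul_le_mul_of_nonneg_left (hs i) (hF i)
  · have h2 : ∀ i ∈ Finset.univ, |κ i₀ * (-(κ i * β i / (α - α₀ / 2)) - B * q i)| ≤
        κ i₀ * (2 * n / α₀ * κ i₀ + B * R) := by
      intro i _
      rw [abs_mul, abs_of_pos (by linarith : 0 < κ i₀)]
      exact mul_le_mul_of_nonneg_left (hzle i) (by linarith)
    refine (Finset.sum_le_sum h2).trans (le_of_eq ?_)
    rw [Finset.sum_const, Finset.card_univ, Fintype.card_fin, nsmul_eq_mul]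
    ring

/-- The estimate when the right-hand side depends on the normal, for a suitable parameter `B`. -/
theorem exists_bound_of_maxInequality (hp : 1 ≤ p) (hpn : p ≤ n) (hn : n ≤ 2 * p) {α₀ R D L : ℝ}
    (hα₀ : 0 < α₀) (hR : 0 ≤ R) (hD : 0 ≤ D) (hL : 0 ≤ L) :
    ∃ B : ℝ, 0 ≤ B ∧ ∃ K : ℝ, 0 ≤ K ∧ ∀ (κ : Fin n → ℝ) (i₀ : Fin n) (α : ℝ) (β q s : Fin n → ℝ)
      (r ψβ ψ₂ : ℝ), (∀ I ∈ pSets n p, 0 < ∑ i ∈ I, κ i) → (∀ i, κ i ≤ κ i₀) →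
      ∏ I ∈ pSets n p, ∑ i ∈ I, κ i ≤ L → α₀ ≤ α → α ≤ 1 → (∀ i, |β i| ≤ 1) →
      (∀ i, |q i| ≤ R) → (∀ i, α₀ ^ 2 ≤ s i) → |r| ≤ R → |ψβ| ≤ D * (1 + κ i₀) →
      -(D * (1 + κ i₀ ^ 2 + ∑ i, |κ i₀ * (-(κ i * β i / (α - α₀ / 2)) - B * q i)|)) ≤ ψ₂ →
      MaxInequality p κ i₀ (α₀ / 2) B α β q s r ψβ ψ₂ → κ i₀ ≤ K := by
  have hn0 : (0 : ℝ) < n := by exact_mod_cast hp.trans hpn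
  obtain ⟨M, hM⟩ : ∃ M : ℝ, M = (pSets n p).card := ⟨_, rfl⟩
  have hM0 : 0 ≤ M := hM ▸ Nat.cast_nonneg _
  obtain ⟨P, hP⟩ : ∃ P : ℝ, P = D * (2 + n * (2 * n / α₀)) + 4 * D / α₀ := ⟨_, rfl⟩
  have hP0 : 0 ≤ P := by rw [hP]; positivity
  -- With this choice the good term `B α₀² ∑ F_i ≥ B α₀² k / (2 (L + 1))` beats all terms linear
  -- in `k`.
  obtain ⟨B, hB⟩ : ∃ B : ℝ,
      B = 2 * (L + 1) * (P + 4 * M * n * (2 * n / α₀) ^ 2 + 1) / α₀ ^ 2 := ⟨_, rfl⟩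
  have hB0 : 0 ≤ B := by rw [hB]; positivity
  obtain ⟨Q, hQ⟩ : ∃ Q : ℝ, Q = D * (n * (B * R)) + B * R * M := ⟨_, rfl⟩
  have hQ0 : 0 ≤ Q := by rw [hQ]; positivity
  obtain ⟨K₁, hK₁⟩ : ∃ K₁ : ℝ, K₁ = ((L + 1) * P + ((L + 1) * Q +
    (4 / α₀ * (2 * (B * R) / α₀) ^ 2 + (B * R) ^ 2))) / (α₀ / (4 * (4 * n ^ 3))) := ⟨_, rfl⟩
  have hK₁0 : 0 ≤ K₁ := by rw [hK₁]; positivity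
  obtain ⟨K₂, hK₂⟩ : ∃ K₂ : ℝ, K₂ = Q + 4 * M * n * (B * R) ^ 2 := ⟨_, rfl⟩
  have hK₂0 : 0 ≤ K₂ := by rw [hK₂]; positivity
  refine ⟨B, hB0, 2 + K₁ + K₂, by positivity, ?_⟩
  intro κ i₀ α β q s r ψβ ψ₂ hκ hmax hprod hα hα1 hβ hq hs hr hψβ hψ₂ h
  rcases le_total (κ i₀) 2 with hk | hk
  · linarith
  have hk1 : 1 ≤ κ i₀ := by linarith
  have hk0 : 0 < κ i₀ := by linarith
  have hF := linCoeff_nonneg hκ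
  have hS := inv_le_sum_linCoeff hp hpn hκ hL hprod
  obtain ⟨hw, hy, hz, hdiv⟩ :=
    h.divided hp hpn hα₀ hD hB0 hk1 hκ hmax hα hα1 hβ hq hs hr hψβ hψ₂
  rw [← hP, ← hM, ← hQ] at hdiv
  rcases sq_mul_sum_linCoeff_le_or hp hpn hκ hmax with hcase | ⟨hlt, hlow⟩
  · have h1 := hdiv 0 rfl
    simp only [Pi.zero_apply, mul_zero, zero_mul, ne_eq, OfNat.ofNat_ne_zero, not_false_eq_true,
      zero_pow, add_zero, Finset.sum_const_zero, zero_div] at h1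
    have h2 : κ i₀ ≤ K₁ := by
      rw [hK₁]
      refine le_of_quadratic_dominates hα₀ hL hP0 hQ0 (by positivity) hk1 hF hw hy hS ?_ hcase h1
      exact mul_nonneg (by positivity) (Finset.sum_nonneg fun i _ => hF i)
    linarith
  · have hlow' : ∀ i, -κ i₀ ≤ κ i := by
      intro i
      refine le_trans ?_ (hlow i)
      have : κ i₀ / (2 * n) ≤ κ i₀ := by
        refine div_le_self hk0.le ?_
        have : (1 : ℝ) ≤ n := by exact_mod_cast hp.trans hpn
        linarith
      linarith
    have h2 : κ i₀ ≤ K₂ := by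
      rw [hK₂]
      refine le_of_rotation hL hM0 hk1 hF ?_ (fun i => linCoeff_anti hκ (hmax i)) hlow' hz
        (le_sum_linCoeff_of_lower_bound hp hlt hn hκ hL hprod hk hlow) ?_ ?_ ?_ hdiv
      · rw [hM]; exact linCoeff_le_of_lower_bound (p := p) hk0 hlow
      · have : 0 ≤ ∑ i, linCoeff p κ i * κ i ^ 2 :=
          Finset.sum_nonneg fun i _ => mul_nonneg (hF i) (sq_nonneg _)
        positivity
      · positivity
      · rw [hB]; field_simp; exact le_rfl
    linarith

end Estimates

end PrescribedCurvature

namespace PrescribedCurvature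

open Filter Topology

set_option maxSynthPendingDepth 3

/-! ### The equation and the test function in the tangent graph representation -/

section Geometry

variable {n p : ℕ} {Ω : Set (Space n)} {u : Space n → ℝ} {x₀ : Space n}
  {O : Ambient n ≃ₗᵢ[ℝ] Ambient n} {v : Space n → ℝ}

theorem ambient_inner (X Y : Ambient n) :
    inner ℝ X Y = inner ℝ X.fst Y.fst + X.snd * Y.snd := by
  rw [WithLp.prod_inner_apply]
  simp only [RCLike.inner_apply, conj_trivial, WithLp.ofLp_fst, WithLp.ofLp_snd]
  ring

/-- An orthonormal basis of eigenvectors of `D²v(y)`. -/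
theorem exists_eigenbasis {y : Space n} (hv : ContDiffAt ℝ 2 v y) :
    ∃ (b : OrthonormalBasis (Fin n) ℝ (Space n)) (κ : Fin n → ℝ),
      ∀ i a, hess v y (b i) a = κ i * inner ℝ (b i) a := by
  have hs : (((sharp n).comp (hess v y) : Space n →L[ℝ] Space n) :
      Space n →ₗ[ℝ] Space n).IsSymmetric := by
    intro a b
    change inner ℝ (sharp n (hess v y a)) b = inner ℝ a (sharp n (hess v y b))
    rw [inner_sharp, real_inner_comm, inner_sharp]
    exact fderiv_fderiv_symm hv a b
  refine ⟨hs.eigenvectorBasis (by simp), hs.eigenvalues (by simp), fun i a => ?_⟩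
  have h := hs.apply_eigenvectorBasis (by simp) i
  have h2 := congrArg (fun c => inner ℝ c a) h
  change inner ℝ (sharp n (hess v y _)) a = _ at h2
  rw [inner_sharp] at h2
  rw [h2]
  exact real_inner_smul_left _ _ _

/-- The point of the graph of `u` corresponding to the point of the graph of `v` over `y`. -/
noncomputable def tangentPoint (u : Space n → ℝ) (x₀ : Space n) (O : Ambient n ≃ₗᵢ[ℝ] Ambient n)
    (v : Space n → ℝ) (y : Space n) : Ambient n :=
  WithLp.toLp 2 (x₀, u x₀) + O (WithLp.toLp 2 (y, v y))

theorem IsTangentGraph.tangentPoint_zero (hT : IsTangentGraph Ω u x₀ O v) :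
    tangentPoint u x₀ O v 0 = WithLp.toLp 2 (x₀, u x₀) := by
  have : (WithLp.toLp 2 ((0 : Space n), (0 : ℝ)) : Ambient n) = 0 := rfl
  rw [tangentPoint, hT.apply_zero, this, map_zero, add_zero]

theorem IsTangentGraph.eventually (hT : IsTangentGraph Ω u x₀ O v) : ∀ᶠ y in 𝓝 0,
    (tangentPoint u x₀ O v y).fst ∈ Ω ∧
    u (tangentPoint u x₀ O v y).fst = (tangentPoint u x₀ O v y).snd ∧
    upwardNormal u (tangentPoint u x₀ O v y).fst = O (upwardNormal v y) ∧
    ∃ D : Space n →L[ℝ] Space n,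
      (∀ a b, metricForm u (tangentPoint u x₀ O v y).fst (D a) (D b) = metricForm v y a b) ∧
      (∀ a b, secondForm u (tangentPoint u x₀ O v y).fst (D a) (D b) = secondForm v y a b) :=
  hT.eventually_graph

theorem metricForm_of_fderiv_eq_zero {y : Space n} (hv : fderiv ℝ v y = 0) (a b : Space n) :
    metricForm v y a b = inner ℝ a b := by
  simp [metricForm, hv]

theorem secondForm_of_fderiv_eq_zero {y : Space n} (hv : fderiv ℝ v y = 0) (a b : Space n) :
    secondForm v y a b = hess v y a b := by
  simp [secondForm, areaElement, gradient_eq_sharp, hv]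

theorem IsTangentGraph.exists_tangentMap (hT : IsTangentGraph Ω u x₀ O v) :
    ∃ D : Space n →L[ℝ] Space n, Function.Surjective D ∧
      (∀ a b, metricForm u x₀ (D a) (D b) = inner ℝ a b) ∧
      (∀ a b, secondForm u x₀ (D a) (D b) = hess v 0 a b) := by
  obtain ⟨-, -, -, D, h1, h2⟩ := hT.eventually.self_of_nhds
  rw [hT.tangentPoint_zero, toLp_pair_fst] at h1 h2
  simp_rw [metricForm_of_fderiv_eq_zero hT.fderiv_zero] at h1
  simp_rw [secondForm_of_fderiv_eq_zero hT.fderiv_zero] at h2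
  refine ⟨D, ?_, h1, h2⟩
  have hinj : Function.Injective (D : Space n →ₗ[ℝ] Space n) := by
    rw [← LinearMap.ker_eq_bot, LinearMap.ker_eq_bot']
    intro a ha
    have h3 := h1 a a
    rw [show D a = 0 from ha] at h3
    have : metricForm u x₀ 0 0 = 0 := by simp [metricForm]
    rw [this] at h3
    exact inner_self_eq_zero.1 h3.symm
  exact LinearMap.surjective_of_injective hinj

variable {b : OrthonormalBasis (Fin n) ℝ (Space n)} {κ : Fin n → ℝ}

theorem IsTangentGraph.principalCurvatures_eq (hT : IsTangentGraph Ω u x₀ O v)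
    (hH : ∀ i a, hess v 0 (b i) a = κ i * inner ℝ (b i) a) :
    principalCurvatures u x₀ = (Finset.univ : Finset (Fin n)).val.map κ := by
  obtain ⟨D, -, h1, h2⟩ := hT.exists_tangentMap
  refine principalCurvatures_eq_map (e := fun i => D (b i)) (fun k l => ?_) fun k l => ?_
  · rw [h1, inner_basis]
  · rw [h2, hH, inner_basis, mul_ite, mul_one, mul_zero]

theorem inner_self_eq_sum_sq (b : OrthonormalBasis (Fin n) ℝ (Space n)) (a : Space n) :
    inner ℝ a a = ∑ i, inner ℝ (b i) a ^ 2 := by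
  rw [← b.sum_inner_mul_inner a a]
  exact Finset.sum_congr rfl fun i _ => by rw [real_inner_comm, sq]

theorem hess_self_eq_sum (hH : ∀ i a, hess v 0 (b i) a = κ i * inner ℝ (b i) a) (a : Space n) :
    hess v 0 a a = ∑ i, κ i * inner ℝ (b i) a ^ 2 := by
  conv_lhs => enter [1]; rw [← b.sum_repr' a]
  simp only [map_sum, map_smul, _root_.sum_apply, _root_.smul_apply, smul_eq_mul, hH]
  exact Finset.sum_congr rfl fun i _ => by ring

/-- At every point there is a frame of principal directions. -/
theorem exists_principal_frame (hΩ : IsOpen Ω) (hu : ContDiffOn ℝ 4 u Ω) (hx₀ : x₀ ∈ Ω) :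
    ∃ (e : Fin n → Space n) (κ : Fin n → ℝ),
      principalCurvatures u x₀ = (Finset.univ : Finset (Fin n)).val.map κ ∧
      (∀ i, metricForm u x₀ (e i) (e i) = 1 ∧ secondForm u x₀ (e i) (e i) = κ i) ∧
      ∀ ξ, ∃ c : Fin n → ℝ, metricForm u x₀ ξ ξ = ∑ i, c i ^ 2 ∧
        secondForm u x₀ ξ ξ = ∑ i, κ i * c i ^ 2 := by
  obtain ⟨O, v, hT⟩ := exists_isTangentGraph hΩ hu hx₀
  obtain ⟨b, κ, hH⟩ := exists_eigenbasis (hT.contDiffAt.of_le (by norm_num))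
  obtain ⟨D, hD, h1, h2⟩ := hT.exists_tangentMap
  refine ⟨fun i => D (b i), κ, hT.principalCurvatures_eq hH, fun i => ⟨?_, ?_⟩, fun ξ => ?_⟩
  · rw [h1, inner_basis, if_pos rfl]
  · rw [h2, hess_basis hH]
  · obtain ⟨a, rfl⟩ := hD ξ
    refine ⟨fun i => inner ℝ (b i) a, ?_, ?_⟩
    · rw [h1, inner_self_eq_sum_sq b]
    · rw [h2, hess_self_eq_sum hH]

theorem forall_pos_of_prod_pos {s : Multiset ℝ} (h0 : ∀ a ∈ s, 0 ≤ a) (h : 0 < s.prod) :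
    ∀ a ∈ s, 0 < a := fun a ha =>
  lt_of_le_of_ne (h0 a ha) fun h1 => h.ne' (Multiset.prod_eq_zero (h1 ▸ ha))

theorem pos_of_pSums_pos {s : Multiset ℝ} (hs : s = (Finset.univ : Finset (Fin n)).val.map κ)
    (h : ∀ a ∈ pSums p s, 0 < a) : ∀ I ∈ pSets n p, 0 < ∑ i ∈ I, κ i := by
  intro I hI
  refine h _ ?_
  rw [hs, pSums_map_univ]
  exact Multiset.mem_map_of_mem (fun I : Finset (Fin n) => ∑ i ∈ I, κ i) hI

/-- The logarithm of the curvature operator lies below its linearization, evaluated in any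
orthonormal frame. -/
theorem IsTangentGraph.log_curvatureOperator_le (hT : IsTangentGraph Ω u x₀ O v)
    (hpos : ∀ x ∈ Ω, ∀ s ∈ pSums p (principalCurvatures u x), 0 < s)
    (hκ : ∀ I ∈ pSets n p, 0 < ∑ i ∈ I, κ i) :
    ∀ᶠ y in 𝓝 0, ∀ e : Fin n → Space n,
      (∀ k l, metricForm v y (e k) (e l) = if k = l then 1 else 0) →
      Real.log (curvatureOperator p u (tangentPoint u x₀ O v y).fst) ≤
        (∑ I ∈ pSets n p, Real.log (∑ i ∈ I, κ i) - ∑ i, linCoeff p κ i * κ i) +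
          ∑ i, linCoeff p κ i * secondForm v y (e i) (e i) := by
  filter_upwards [hT.eventually, hT.contDiffAt.eventually (by simp)] with y ⟨hy, _, _, D, h1, h2⟩ hv
    e he
  have hfr : ∀ k l, metricForm u (tangentPoint u x₀ O v y).fst (D (e k)) (D (e l)) =
      if k = l then 1 else 0 := fun k l => by rw [h1, he]
  have hB := principalCurvatures_eq_of_frame hfr
  simp only [h2] at hB
  have hherm : (Matrix.of fun k l => secondForm v y (e k) (e l)).IsHermitian := by
    ext k l
    simp only [Matrix.conjTranspose_apply, Matrix.of_apply, star_trivial, secondForm]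
    rw [hess, fderiv_fderiv_symm (hv.of_le (by norm_num))]
  have h3 := log_prod_pSums_le (p := p) hherm (by rw [← hB]; exact hpos _ hy) hκ
  rw [curvatureOperator, hB]
  simp only [Matrix.of_apply] at h3
  linarith

theorem IsTangentGraph.hasJet_tangentPoint (hT : IsTangentGraph Ω u x₀ O v) (d : Space n) :
    HasJet (fun t : ℝ => tangentPoint u x₀ O v (t • d)) (WithLp.toLp 2 (x₀, u x₀))
      (O (WithLp.toLp 2 (d, (0 : ℝ)))) (O (WithLp.toLp 2 ((0 : Space n), hess v 0 d d))) := by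
  have h1 := (HasJet.smul_id d).prodMk (hasJet_apply hT.contDiffAt hT.fderiv_zero d)
  have h2 := (h1.clm (ambientL n)).clm (O : Ambient n →L[ℝ] Ambient n)
  have h3 := (HasJet.const (WithLp.toLp 2 (x₀, u x₀) : Ambient n)).add h2
  refine h3.of_eq ?_ ?_ ?_
  · have : (WithLp.toLp 2 ((0 : Space n), (0 : ℝ)) : Ambient n) = 0 := rfl
    rw [hT.apply_zero]
    change _ + O (WithLp.toLp 2 ((0 : Space n), (0 : ℝ))) = _
    rw [this, map_zero, add_zero]
  · rw [zero_add]; rfl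
  · rw [zero_add]; rfl

theorem IsTangentGraph.hasJet_normal (hT : IsTangentGraph Ω u x₀ O v) (d : Space n) :
    HasJet (fun t : ℝ => O (upwardNormal v (t • d))) (upwardNormal u x₀)
      (O (WithLp.toLp 2 (-sharp n (hess v 0 d), (0 : ℝ))))
      (O (WithLp.toLp 2 (-sharp n (third v 0 d d), -‖sharp n (hess v 0 d)‖ ^ 2))) := by
  exact ((hasJet_upwardNormal hT.contDiffAt hT.fderiv_zero d).clm
    (O : Ambient n →L[ℝ] Ambient n)).of_eq hT.map_vertical rfl rfl

/-- The vertical direction, in the coordinates of the tangent graph. -/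
noncomputable def verticalDir (O : Ambient n ≃ₗᵢ[ℝ] Ambient n) : Ambient n :=
  O.symm (WithLp.toLp 2 ((0 : Space n), (1 : ℝ)))

theorem snd_eq_inner_verticalDir (O : Ambient n ≃ₗᵢ[ℝ] Ambient n) (N : Ambient n) :
    (O N).snd = inner ℝ N (verticalDir O) := by
  rw [← O.inner_map_map, verticalDir, O.apply_symm_apply, ambient_inner]
  simp

theorem norm_verticalDir (O : Ambient n ≃ₗᵢ[ℝ] Ambient n) : ‖verticalDir O‖ = 1 := by
  rw [verticalDir, LinearIsometryEquiv.norm_map]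
  have h : ‖(WithLp.toLp 2 ((0 : Space n), (1 : ℝ)) : Ambient n)‖ ^ 2 = 1 := by
    rw [WithLp.prod_norm_sq_eq_of_L2]; simp
  exact (pow_eq_one_iff_of_nonneg (norm_nonneg _) two_ne_zero).1 h

theorem IsTangentGraph.verticalDir_snd (hT : IsTangentGraph Ω u x₀ O v) :
    (verticalDir O).snd = (areaElement u x₀)⁻¹ := by
  have h := snd_eq_inner_verticalDir O (WithLp.toLp 2 ((0 : Space n), (1 : ℝ)))
  rw [hT.map_vertical, ambient_inner] at h
  simpa [upwardNormal] using h.symm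

/-- The vertical component `1 / w` of the normal. -/
theorem IsTangentGraph.hasJet_inv_areaElement (hT : IsTangentGraph Ω u x₀ O v)
    (hH : ∀ i a, hess v 0 (b i) a = κ i * inner ℝ (b i) a) (i : Fin n) :
    HasJet (fun t : ℝ => (areaElement u (tangentPoint u x₀ O v (t • b i)).fst)⁻¹)
      (areaElement u x₀)⁻¹ (-(κ i * inner ℝ (b i) (verticalDir O).fst))
      (-third v 0 (b i) (b i) (verticalDir O).fst - κ i ^ 2 * (areaElement u x₀)⁻¹) := by
  have hlim := tendsto_smul_zero (b i)
  have h1 := (hasJet_upwardNormal hT.contDiffAt hT.fderiv_zero (b i)).inner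
    (HasJet.const (verticalDir O))
  refine (h1.congr ?_).of_eq ?_ ?_ ?_
  · filter_upwards [hlim.eventually hT.eventually] with t ⟨_, _, h, _⟩
    rw [← snd_eq_inner_verticalDir, ← h]
    rfl
  · rw [ambient_inner, ← hT.verticalDir_snd]; simp
  · rw [inner_zero_right, zero_add, ambient_inner, sharp_hess_basis hH]
    simp [real_inner_smul_left]
  · rw [inner_zero_right, inner_zero_right, ambient_inner, ← hT.verticalDir_snd,
      sharp_hess_basis hH, norm_smul, b.norm_eq_one, mul_one, Real.norm_eq_abs, sq_abs,
      toLp_pair_fst, toLp_pair_snd, inner_neg_left, inner_sharp]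
    ring

/-- Half the squared distance to the vertical line over `z`. -/
theorem IsTangentGraph.hasJet_half_norm_sq (hT : IsTangentGraph Ω u x₀ O v)
    (hH : ∀ i a, hess v 0 (b i) a = κ i * inner ℝ (b i) a) (z : Space n) (i : Fin n) :
    HasJet (fun t : ℝ => ‖(tangentPoint u x₀ O v (t • b i)).fst - z‖ ^ 2 / 2)
      (‖x₀ - z‖ ^ 2 / 2) (inner ℝ (O (WithLp.toLp 2 (b i, (0 : ℝ)))).fst (x₀ - z))
      (‖(O (WithLp.toLp 2 (b i, (0 : ℝ)))).fst‖ ^ 2 +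
        κ i * inner ℝ (upwardNormal u x₀).fst (x₀ - z)) := by
  have h1 := ((hT.hasJet_tangentPoint (b i)).clm (WithLp.fstL 2 ℝ (Space n) ℝ)).sub
    (HasJet.const z)
  have h2 := (HasJet.const (1 / 2 : ℝ)).mul (h1.inner h1)
  have e : (O (WithLp.toLp 2 ((0 : Space n), hess v 0 (b i) (b i)))) = κ i • upwardNormal u x₀ := by
    rw [hess_basis hH, toLp_eq_add, ← hT.map_vertical, map_add, map_smul]
    have : (WithLp.toLp 2 ((0 : Space n), (0 : ℝ)) : Ambient n) = 0 := rfl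
    rw [this, map_zero, zero_add]
  refine (h2.congr (Eventually.of_forall fun t => ?_)).of_eq ?_ ?_ ?_
  · change ‖(tangentPoint u x₀ O v (t • b i)).fst - z‖ ^ 2 / 2 =
      1 / 2 * inner ℝ ((tangentPoint u x₀ O v (t • b i)).fst - z)
        ((tangentPoint u x₀ O v (t • b i)).fst - z)
    rw [real_inner_self_eq_norm_sq]
    ring
  · change 1 / 2 * inner ℝ (x₀ - z) (x₀ - z) = _
    rw [real_inner_self_eq_norm_sq]
    ring
  · change 1 / 2 * (inner ℝ (x₀ - z) ((O (WithLp.toLp 2 (b i, (0 : ℝ)))).fst - 0) +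
      inner ℝ ((O (WithLp.toLp 2 (b i, (0 : ℝ)))).fst - 0) (x₀ - z)) + 0 * _ = _
    rw [sub_zero, real_inner_comm (x₀ - z)]
    ring
  · rw [e]
    change 1 / 2 * (inner ℝ (x₀ - z) (κ i • (upwardNormal u x₀).fst - 0) +
      2 * inner ℝ ((O (WithLp.toLp 2 (b i, (0 : ℝ)))).fst - 0)
        ((O (WithLp.toLp 2 (b i, (0 : ℝ)))).fst - 0) +
      inner ℝ (κ i • (upwardNormal u x₀).fst - 0) (x₀ - z)) + 2 * (0 * _) + 0 * _ = _
    rw [sub_zero, sub_zero, real_inner_smul_right, real_inner_smul_left,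
      real_inner_self_eq_norm_sq, real_inner_comm _ (x₀ - z)]
    ring

end Geometry

end PrescribedCurvature

namespace PrescribedCurvature

open Filter Topology

set_option maxSynthPendingDepth 3

/-! ### The curvature bound at an interior maximum point -/

section InteriorMaximum

variable {n p : ℕ} {Ω : Set (Space n)} {u : Space n → ℝ} {x₀ : Space n}
  {O : Ambient n ≃ₗᵢ[ℝ] Ambient n} {v : Space n → ℝ}
  {b : OrthonormalBasis (Fin n) ℝ (Space n)} {κ : Fin n → ℝ}

/-- The weight `(1 / w - a) exp (-B |x - z|² / 2)` in the test function. -/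
noncomputable def testWeight (a B : ℝ) (z : Space n) (u : Space n → ℝ) (x : Space n) : ℝ :=
  ((areaElement u x)⁻¹ - a) * Real.exp (-(B * (‖x - z‖ ^ 2 / 2)))

/-- Over `Ω`, the quotient `h(ξ, ξ) / (V g(ξ, ξ))` has the maximum `Λ`, attained at `x₀`. -/
structure IsWeightedMax (Ω : Set (Space n)) (u V : Space n → ℝ) (x₀ : Space n) (Λ : ℝ) :
    Prop where
  le : ∀ x ∈ Ω, ∀ ξ, secondForm u x ξ ξ ≤ Λ * V x * metricForm u x ξ ξ
  exists_eq : ∃ ξ, ξ ≠ 0 ∧ secondForm u x₀ ξ ξ = Λ * V x₀ * metricForm u x₀ ξ ξ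

/-- At the maximum point the maximal direction is a principal one. -/
theorem IsTangentGraph.exists_index (hT : IsTangentGraph Ω u x₀ O v) (hx₀ : x₀ ∈ Ω)
    (hH : ∀ i a, hess v 0 (b i) a = κ i * inner ℝ (b i) a) {V : Space n → ℝ} {Λ : ℝ}
    (hmax : IsWeightedMax Ω u V x₀ Λ) :
    ∃ i₀, κ i₀ = Λ * V x₀ ∧ ∀ i, κ i ≤ κ i₀ := by
  obtain ⟨D, hD, h1, h2⟩ := hT.exists_tangentMap
  have hle : ∀ i, κ i ≤ Λ * V x₀ := by
    intro i
    have := hmax.le x₀ hx₀ (D (b i))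
    rwa [h1, h2, hess_basis hH, inner_basis, if_pos rfl, mul_one] at this
  suffices h : ∃ i₀, Λ * V x₀ ≤ κ i₀ by
    obtain ⟨i₀, h⟩ := h
    exact ⟨i₀, le_antisymm (hle i₀) h, fun i => (hle i).trans h⟩
  by_contra! hlt
  obtain ⟨ξ, hξ, h3⟩ := hmax.exists_eq
  obtain ⟨a, rfl⟩ := hD ξ
  have ha : a ≠ 0 := by rintro rfl; simp at hξ
  have e2 := inner_self_eq_sum_sq b a
  rw [h1, h2, hess_self_eq_sum hH, e2, Finset.mul_sum] at h3
  refine absurd h3 (ne_of_lt (Finset.sum_lt_sum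
    (fun i _ => mul_le_mul_of_nonneg_right (hle i) (sq_nonneg _)) ?_))
  by_contra! hall
  refine ha ?_
  rw [← inner_self_eq_zero (𝕜 := ℝ), e2]
  refine Finset.sum_eq_zero fun i hi => ?_
  have h4 := hall i hi
  nlinarith [hlt i, sq_nonneg (inner ℝ (b i) a : ℝ)]

/-- The weight in a principal direction. The third derivatives of `v` enter through `1 / w`; summed
against `F^{ii}` they are a first derivative of the right-hand side. -/
theorem IsTangentGraph.hasJet_testWeight (hT : IsTangentGraph Ω u x₀ O v)
    (hH : ∀ i a, hess v 0 (b i) a = κ i * inner ℝ (b i) a) {a B : ℝ} {z : Space n}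
    (ha : a < (areaElement u x₀)⁻¹) (i : Fin n) {α β q s r : ℝ} (hα : (areaElement u x₀)⁻¹ = α)
    (hβ : inner ℝ (b i) (verticalDir O).fst = β)
    (hq : inner ℝ (O (WithLp.toLp 2 (b i, (0 : ℝ)))).fst (x₀ - z) = q)
    (hs : ‖(O (WithLp.toLp 2 (b i, (0 : ℝ)))).fst‖ ^ 2 = s)
    (hr : inner ℝ (upwardNormal u x₀).fst (x₀ - z) = r) :
    HasJet (fun t : ℝ => testWeight a B z u (tangentPoint u x₀ O v (t • b i)).fst)
      (testWeight a B z u x₀)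
      (testWeight a B z u x₀ * (-(κ i * β / (α - a)) - B * q))
      (testWeight a B z u x₀ * ((-third v 0 (b i) (b i) (verticalDir O).fst - κ i ^ 2 * α) / (α - a)
        + 2 * (κ i * β / (α - a)) * (B * q) + (B * q) ^ 2 - B * (s + κ i * r))) := by
  have h1 := (hT.hasJet_inv_areaElement hH i).sub (HasJet.const a)
  have h2 := ((HasJet.const B).mul (hT.hasJet_half_norm_sq hH z i)).neg.exp
  have hN : α - a ≠ 0 := by linarith
  refine (h1.mul h2).of_eq rfl ?_ ?_
  · rw [testWeight, hα, hβ, hq]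
    field_simp
    ring
  · rw [testWeight, hα, hβ, hq, hs, hr]
    field_simp
    ring

/-- The inequality at the maximum point, for the graph of `u`. -/
theorem IsTangentGraph.maxInequality (hT : IsTangentGraph Ω u x₀ O v)
    (hH : ∀ i a, hess v 0 (b i) a = κ i * inner ℝ (b i) a)
    (hpos : ∀ x ∈ Ω, ∀ s ∈ pSums p (principalCurvatures u x), 0 < s)
    (hκ : ∀ I ∈ pSets n p, 0 < ∑ i ∈ I, κ i) {a B : ℝ} {z : Space n} {Λ : ℝ}
    (ha : a < (areaElement u x₀)⁻¹)
    (hmax : IsWeightedMax Ω u (testWeight a B z u) x₀ Λ) {i₀ : Fin n}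
    (h0 : κ i₀ = Λ * testWeight a B z u x₀) {ψβ ψβ₂ : ℝ}
    (hψβ : HasJet (fun t : ℝ => Real.log (curvatureOperator p u
      (tangentPoint u x₀ O v (t • (verticalDir O).fst)).fst))
      (Real.log (curvatureOperator p u x₀)) ψβ ψβ₂) {α r : ℝ} {β q s : Fin n → ℝ}
    (hα : (areaElement u x₀)⁻¹ = α)
    (hβ : ∀ i, inner ℝ (b i) (verticalDir O).fst = β i)
    (hq : ∀ i, inner ℝ (O (WithLp.toLp 2 (b i, (0 : ℝ)))).fst (x₀ - z) = q i)
    (hs : ∀ i, ‖(O (WithLp.toLp 2 (b i, (0 : ℝ)))).fst‖ ^ 2 = s i)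
    (hr : inner ℝ (upwardNormal u x₀).fst (x₀ - z) = r) :
    (∀ i, third v 0 (b i) (b i₀) (b i₀) = κ i₀ * (-(κ i * β i / (α - a)) - B * q i)) ∧
    ∀ ψ₁ ψ₂ : ℝ, HasJet (fun t : ℝ => Real.log (curvatureOperator p u
      (tangentPoint u x₀ O v (t • b i₀)).fst)) (Real.log (curvatureOperator p u x₀)) ψ₁ ψ₂ →
      MaxInequality p κ i₀ a B α β q s r ψβ ψ₂ := by
  have hz := hT.tangentPoint_zero
  have hz1 : (tangentPoint u x₀ O v 0).fst = x₀ := by rw [hz]; rfl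
  have hop := hT.log_curvatureOperator_le hpos hκ
  have hψ0 : Real.log (curvatureOperator p u (tangentPoint u x₀ O v 0).fst) =
      (∑ I ∈ pSets n p, Real.log (∑ i ∈ I, κ i) - ∑ i, linCoeff p κ i * κ i) +
        ∑ i, linCoeff p κ i * κ i := by
    rw [hz1, curvatureOperator, hT.principalCurvatures_eq hH, prod_pSums_map_univ,
      Real.log_prod fun I hI => (hκ I hI).ne']
    ring
  have hle : ∀ᶠ y in 𝓝 0, secondForm v y (b i₀) (b i₀) ≤
      Λ * testWeight a B z u (tangentPoint u x₀ O v y).fst * metricForm v y (b i₀) (b i₀) := by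
    filter_upwards [hT.eventually] with y ⟨hy, _, _, D, h1, h2⟩
    rw [← h1, ← h2]
    exact hmax.le _ hy _
  have hV := fun i => hT.hasJet_testWeight hH (B := B) ha i hα (hβ i) (hq i) (hs i) hr
  have h0' : κ i₀ = Λ * testWeight a B z u (tangentPoint u x₀ O v 0).fst := by rw [hz1]; exact h0
  have hV' : ∀ i, HasJet (fun t : ℝ => testWeight a B z u (tangentPoint u x₀ O v (t • b i)).fst)
      (testWeight a B z u (tangentPoint u x₀ O v 0).fst) _ _ := fun i => by
    rw [hz1]; exact hV i
  have hκV : ∀ c, Λ * (testWeight a B z u x₀ * c) = κ i₀ * c := fun c => by rw [h0, mul_assoc]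
  refine ⟨fun i => ?_, fun ψ₁ ψ₂ hψ τ hτ => ?_⟩
  · rw [(max_conditions hT.contDiffAt hT.fderiv_zero hH
      (V := fun y => testWeight a B z u (tangentPoint u x₀ O v y).fst) hle h0' (hV' i)).1, hκV]
  have hβ1 := deriv_eq_sum_third
    (ψ := fun y => Real.log (curvatureOperator p u (tangentPoint u x₀ O v y).fst))
    hT.contDiffAt hT.fderiv_zero hH hop hψ0 (verticalDir O).fst (by rw [hz1]; exact hψβ)
  have key := main_inequality
    (ψ := fun y => Real.log (curvatureOperator p u (tangentPoint u x₀ O v y).fst))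
    (V := fun y => testWeight a B z u (tangentPoint u x₀ O v y).fst)
    hT.contDiffAt hT.fderiv_zero hH (linCoeff_nonneg hκ) hop hψ0 (by rw [hz1]; exact hψ) hle h0'
    hV' hτ
  simp only [hκV] at key
  refine key.trans (le_of_eq ?_)
  congr 1
  have h3 : ContDiffAt ℝ 3 v 0 := hT.contDiffAt.of_le (by norm_num)
  have e : ψβ = ∑ i, linCoeff p κ i * third v 0 (b i) (b i) (verticalDir O).fst := by
    rw [hβ1]
    refine Finset.sum_congr rfl fun i _ => ?_
    rw [third_symm h3, third_symm' h3 (b i)]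
  have hN : α - a ≠ 0 := by linarith
  rw [e, Finset.mul_sum, ← Finset.sum_neg_distrib, Finset.mul_sum, ← Finset.sum_sub_distrib,
    Finset.sum_div, ← Finset.sum_add_distrib, Finset.mul_sum]
  have h0Λ : ∀ i, Λ * (linCoeff p κ i * (testWeight a B z u x₀ *
      ((-third v 0 (b i) (b i) (verticalDir O).fst - κ i ^ 2 * α) / (α - a)
        + 2 * (κ i * β i / (α - a)) * (B * q i) + (B * q i) ^ 2 - B * (s i + κ i * r)))) =
      κ i₀ * (linCoeff p κ i * ((-third v 0 (b i) (b i) (verticalDir O).fst - κ i ^ 2 * α) / (α - a)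
        + 2 * (κ i * β i / (α - a)) * (B * q i) + (B * q i) ^ 2 - B * (s i + κ i * r))) := by
    intro i
    rw [h0]; ring
  refine Finset.sum_congr rfl fun i _ => ?_
  rw [h0Λ]
  congr 1
  ring

/-- The 2-jet of the logarithm of the right-hand side along a curve. -/
theorem exists_hasJet_log {G : Type*} [NormedAddCommGroup G] [NormedSpace ℝ G] {g : G → ℝ}
    {γ : ℝ → G} {q q' q'' : G} {m L : ℝ} (hm : 0 < m) (hg : ContDiffAt ℝ 2 g q) (h0 : m ≤ g q)
    (h1 : ‖fderiv ℝ g q‖ ≤ L) (h2 : ‖fderiv ℝ (fderiv ℝ g) q‖ ≤ L) (hγ : HasJet γ q q' q'')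
    {φ : ℝ → ℝ} (hφ : ∀ᶠ t in 𝓝 0, φ t = g (γ t)) :
    ∃ ψ₁ ψ₂, HasJet (fun t => Real.log (φ t)) (Real.log (g q)) ψ₁ ψ₂ ∧ |ψ₁| ≤ L / m * ‖q'‖ ∧
      -(L / m * ‖q''‖ + (L / m + (L / m) ^ 2) * ‖q'‖ ^ 2) ≤ ψ₂ := by
  have hq : 0 < g q := hm.trans_le h0
  have hL : 0 ≤ L := (norm_nonneg _).trans h1
  refine ⟨_, _, ((HasJet.comp hg hγ).log hq.ne').congr (hφ.mono fun t ht => by simp only [ht]), ?_⟩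
  have e1 : |fderiv ℝ g q q'| ≤ L * ‖q'‖ :=
    ((fderiv ℝ g q).le_opNorm q').trans (by gcongr)
  have e2 : |fderiv ℝ g q q''| ≤ L * ‖q''‖ :=
    ((fderiv ℝ g q).le_opNorm q'').trans (by gcongr)
  have e3 : |fderiv ℝ (fderiv ℝ g) q q' q'| ≤ L * ‖q'‖ ^ 2 := by
    refine ((fderiv ℝ (fderiv ℝ g) q).le_opNorm₂ q' q').trans ?_
    rw [mul_assoc, ← sq]; gcongr
  have e4 : |fderiv ℝ g q q' / g q| ≤ L / m * ‖q'‖ := by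
    rw [abs_div, abs_of_pos hq]
    calc _ ≤ L * ‖q'‖ / m := by gcongr
      _ = _ := by ring
  refine ⟨e4, ?_⟩
  have e5 : |(fderiv ℝ g q q'' + fderiv ℝ (fderiv ℝ g) q q' q') / g q| ≤
      L / m * ‖q''‖ + L / m * ‖q'‖ ^ 2 := by
    rw [abs_div, abs_of_pos hq]
    calc _ ≤ (L * ‖q''‖ + L * ‖q'‖ ^ 2) / m := by
          gcongr
          exact (abs_add_le _ _).trans (add_le_add e2 e3)
      _ = _ := by ring
  have e6 : (fderiv ℝ g q q' / g q) ^ 2 ≤ (L / m) ^ 2 * ‖q'‖ ^ 2 := by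
    rw [← mul_pow]
    exact sq_le_sq' (abs_le.1 e4).1 (abs_le.1 e4).2
  have := (abs_le.1 e5).1
  linarith

theorem norm_fderiv_le_of_iteratedFDeriv {G : Type*} [NormedAddCommGroup G] [NormedSpace ℝ G]
    {g : G → ℝ} {q : G} {L : ℝ} (h : ∀ k ≤ 2, ‖iteratedFDeriv ℝ k g q‖ ≤ L) :
    |g q| ≤ L ∧ ‖fderiv ℝ g q‖ ≤ L ∧ ‖fderiv ℝ (fderiv ℝ g) q‖ ≤ L := by
  refine ⟨?_, ?_, ?_⟩
  · simpa using h 0 (by norm_num)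
  · rw [← norm_iteratedFDeriv_one]; exact h 1 (by norm_num)
  · rw [← norm_iteratedFDeriv_one, norm_iteratedFDeriv_fderiv]; exact h 2 le_rfl

theorem norm_prodMk_fst_snd_le (X : Ambient n) : ‖(X.fst, X.snd)‖ ≤ ‖X‖ :=
  max_le (WithLp.norm_fst_le _ X) (WithLp.norm_snd_le _ X)

theorem norm_toLp_zero_right (d : Space n) : ‖(WithLp.toLp 2 (d, (0 : ℝ)) : Ambient n)‖ = ‖d‖ := by
  have h : ‖(WithLp.toLp 2 (d, (0 : ℝ)) : Ambient n)‖ ^ 2 = ‖d‖ ^ 2 := by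
    rw [WithLp.prod_norm_sq_eq_of_L2]; simp
  exact (pow_left_inj₀ (norm_nonneg _) (norm_nonneg _) two_ne_zero).1 h

theorem norm_toLp_zero_left (s : ℝ) : ‖(WithLp.toLp 2 ((0 : Space n), s) : Ambient n)‖ = |s| := by
  have h : ‖(WithLp.toLp 2 ((0 : Space n), s) : Ambient n)‖ ^ 2 = |s| ^ 2 := by
    rw [WithLp.prod_norm_sq_eq_of_L2]; simp
  exact (pow_left_inj₀ (norm_nonneg _) (abs_nonneg _) two_ne_zero).1 h

theorem norm_toLp_le (d : Space n) (s : ℝ) :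
    ‖(WithLp.toLp 2 (d, s) : Ambient n)‖ ≤ ‖d‖ + |s| := by
  have h : (WithLp.toLp 2 (d, s) : Ambient n) =
      WithLp.toLp 2 (d, (0 : ℝ)) + WithLp.toLp 2 ((0 : Space n), s) := by
    rw [← WithLp.toLp_add, Prod.mk_add_mk, add_zero, zero_add]
  rw [h, ← norm_toLp_zero_right d, ← norm_toLp_zero_left (n := n) s]
  exact norm_add_le _ _

/-- Bounds for the components of the vertical direction. -/
theorem verticalDir_bounds (O : Ambient n ≃ₗᵢ[ℝ] Ambient n)
    (b : OrthonormalBasis (Fin n) ℝ (Space n)) (i : Fin n) :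
    ‖(verticalDir O).fst‖ ≤ 1 ∧ |inner ℝ (b i) (verticalDir O).fst| ≤ 1 ∧
    (verticalDir O).snd ^ 2 ≤ ‖(O (WithLp.toLp 2 (b i, (0 : ℝ)))).fst‖ ^ 2 := by
  have h1 : ‖(verticalDir O).fst‖ ≤ 1 := by
    rw [← norm_verticalDir O]; exact WithLp.norm_fst_le _ _
  have h2 : |inner ℝ (b i) (verticalDir O).fst| ≤ ‖(verticalDir O).fst‖ := by
    have := abs_real_inner_le_norm (b i) (verticalDir O).fst
    rwa [b.norm_eq_one, one_mul] at this
  refine ⟨h1, h2.trans h1, ?_⟩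
  have h3 := WithLp.prod_norm_sq_eq_of_L2 (verticalDir O)
  have h4 := WithLp.prod_norm_sq_eq_of_L2 (O (WithLp.toLp 2 (b i, (0 : ℝ))))
  rw [norm_verticalDir, Real.norm_eq_abs, sq_abs] at h3
  rw [LinearIsometryEquiv.norm_map, norm_toLp_zero_right, b.norm_eq_one, Real.norm_eq_abs,
    snd_eq_inner_verticalDir, ambient_inner] at h4
  rw [toLp_pair_snd, zero_mul, add_zero] at h4
  change 1 ^ 2 = ‖(O (WithLp.toLp 2 (b i, (0 : ℝ)))).fst‖ ^ 2 +
    |inner ℝ (b i) (verticalDir O).fst| ^ 2 at h4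
  have h5 : |inner ℝ (b i) (verticalDir O).fst| ^ 2 ≤ ‖(verticalDir O).fst‖ ^ 2 := by gcongr
  linarith

end InteriorMaximum

end PrescribedCurvature

namespace PrescribedCurvature

open Filter Topology

set_option maxSynthPendingDepth 3

/-! ### The interior bound under the structure conditions on the right-hand side -/

section InteriorBound

variable {n p : ℕ}

/-- The lower bound for `1 / w` under the gradient bound `|Du| ≤ K₁`. -/
noncomputable def minTilt (K₁ : ℝ) : ℝ := (√(1 + K₁ ^ 2))⁻¹

theorem minTilt_pos (K₁ : ℝ) : 0 < minTilt K₁ :=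
  inv_pos.2 (Real.sqrt_pos.2 (by positivity))

theorem minTilt_le {u : Space n → ℝ} {x : Space n} {K₁ : ℝ} (h : ‖gradient u x‖ ≤ K₁) :
    minTilt K₁ ≤ (areaElement u x)⁻¹ :=
  inv_anti₀ (areaElement_pos u x) (Real.sqrt_le_sqrt (by gcongr))

theorem inv_areaElement_le_one (u : Space n → ℝ) (x : Space n) : (areaElement u x)⁻¹ ≤ 1 :=
  inv_le_one_of_one_le₀ (Real.one_le_sqrt.2 (le_add_of_nonneg_right (by positivity)))

variable {Ω : Set (Space n)} {u : Space n → ℝ} {x₀ : Space n}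
  {O : Ambient n ≃ₗᵢ[ℝ] Ambient n} {v : Space n → ℝ}
  {b : OrthonormalBasis (Fin n) ℝ (Space n)} {κ : Fin n → ℝ}

theorem IsTangentGraph.hasJet_point (hT : IsTangentGraph Ω u x₀ O v) (d : Space n) :
    HasJet (fun t : ℝ => ((tangentPoint u x₀ O v (t • d)).fst, (tangentPoint u x₀ O v (t • d)).snd))
      (x₀, u x₀) ((O (WithLp.toLp 2 (d, (0 : ℝ)))).fst, (O (WithLp.toLp 2 (d, (0 : ℝ)))).snd)
      ((O (WithLp.toLp 2 ((0 : Space n), hess v 0 d d))).fst,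
        (O (WithLp.toLp 2 ((0 : Space n), hess v 0 d d))).snd) :=
  ((hT.hasJet_tangentPoint d).clm
    ((WithLp.prodContinuousLinearEquiv 2 ℝ (Space n) ℝ : Ambient n ≃L[ℝ] Space n × ℝ) :
      Ambient n →L[ℝ] Space n × ℝ))

theorem norm_horizontal_le (O : Ambient n ≃ₗᵢ[ℝ] Ambient n) (d : Space n) :
    ‖((O (WithLp.toLp 2 (d, (0 : ℝ)))).fst, (O (WithLp.toLp 2 (d, (0 : ℝ)))).snd)‖ ≤ ‖d‖ := by
  refine (norm_prodMk_fst_snd_le _).trans (le_of_eq ?_)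
  rw [LinearIsometryEquiv.norm_map, norm_toLp_zero_right]

theorem norm_vertical_le (O : Ambient n ≃ₗᵢ[ℝ] Ambient n) (s : ℝ) :
    ‖((O (WithLp.toLp 2 ((0 : Space n), s))).fst, (O (WithLp.toLp 2 ((0 : Space n), s))).snd)‖ ≤
      |s| := by
  refine (norm_prodMk_fst_snd_le _).trans (le_of_eq ?_)
  rw [LinearIsometryEquiv.norm_map, norm_toLp_zero_left]

/-- The interior bound when the right-hand side does not depend on the normal. -/
theorem exists_interior_bound_of_const (hp : 1 ≤ p) (hpn : p ≤ n) (K₁ L : ℝ) {m : ℝ} (hm : 0 < m) :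
    ∃ K : ℝ, 0 ≤ K ∧ ∀ (Ω : Set (Space n)) (f : Space n × ℝ → ℝ) (u : Space n → ℝ) (x₀ : Space n)
      (Λ : ℝ), IsOpen Ω → x₀ ∈ Ω → ContDiffOn ℝ ∞ f (Ω ×ˢ Set.univ) → m ≤ f (x₀, u x₀) →
      (∀ k ≤ 2, ‖iteratedFDeriv ℝ k f (x₀, u x₀)‖ ≤ L) → ContDiffOn ℝ 4 u Ω →
      ‖gradient u x₀‖ ≤ K₁ → (∀ x ∈ Ω, ∀ s ∈ pSums p (principalCurvatures u x), 0 < s) →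
      (∀ x ∈ Ω, curvatureOperator p u x = f (x, u x)) →
      IsWeightedMax Ω u (testWeight 0 0 0 u) x₀ Λ → Λ * testWeight 0 0 0 u x₀ ≤ K := by
  obtain ⟨D, hD⟩ : ∃ D : ℝ, D = |L| / m + (|L| / m) ^ 2 := ⟨_, rfl⟩
  have hD0 : 0 ≤ D := by rw [hD]; positivity
  refine ⟨1 + (2 * D + D / minTilt K₁), by have := minTilt_pos K₁; positivity, ?_⟩
  intro Ω f u x₀ Λ hΩ hx₀ hf hfm hfL hu hK₁ hpos heq hmax
  obtain ⟨O, v, hT⟩ := exists_isTangentGraph hΩ hu hx₀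
  obtain ⟨b, κ, hH⟩ := exists_eigenbasis (hT.contDiffAt.of_le (by norm_num))
  have hκ := pos_of_pSums_pos (hT.principalCurvatures_eq hH) (hpos x₀ hx₀)
  obtain ⟨i₀, h0, hi₀⟩ := hT.exists_index hx₀ hH hmax
  obtain ⟨hL0, hL1, hL2⟩ := norm_fderiv_le_of_iteratedFDeriv hfL
  have hL : L = |L| := (abs_of_nonneg ((abs_nonneg _).trans hL0)).symm
  rw [hL] at hL1 hL2
  have hfc : ContDiffAt ℝ 2 f (x₀, u x₀) :=
    (hf.contDiffAt ((hΩ.prod isOpen_univ).mem_nhds ⟨hx₀, Set.mem_univ _⟩)).of_le (by norm_cast)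
  have hφ : ∀ d : Space n, ∀ᶠ t in 𝓝 (0 : ℝ),
      curvatureOperator p u (tangentPoint u x₀ O v (t • d)).fst =
        f ((tangentPoint u x₀ O v (t • d)).fst, (tangentPoint u x₀ O v (t • d)).snd) := by
    intro d
    filter_upwards [(tendsto_smul_zero d).eventually hT.eventually] with t ⟨h1, h2, _⟩
    rw [heq _ h1, h2]
  have hjet := fun d => exists_hasJet_log hm hfc hfm hL1 hL2 (hT.hasJet_point d) (hφ d)
  simp_rw [← heq x₀ hx₀] at hjet
  obtain ⟨ψβ, ψβ₂, hψβ, hψβ1, -⟩ := hjet (verticalDir O).fst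
  obtain ⟨ψ₁, ψ₂, hψ, -, hψ2⟩ := hjet (b i₀)
  have hk := pos_of_forall_le hp hpn hκ hi₀
  have hα := minTilt_le hK₁
  obtain ⟨-, key⟩ := hT.maxInequality hH hpos hκ ((minTilt_pos K₁).trans_le hα) hmax h0 hψβ rfl
    (fun i => rfl) (fun i => rfl) (fun i => rfl) rfl
  rw [← h0]
  refine le_of_maxInequality_of_const hp hpn hκ (minTilt_pos K₁) hα hD0 ?_ ?_ (key ψ₁ ψ₂ hψ)
  · refine hψβ1.trans ?_
    have h1 : ‖((O (WithLp.toLp 2 ((verticalDir O).fst, (0 : ℝ)))).fst,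
        (O (WithLp.toLp 2 ((verticalDir O).fst, (0 : ℝ)))).snd)‖ ≤ 1 :=
      (norm_horizontal_le O _).trans (verticalDir_bounds O b i₀).1
    calc _ ≤ |L| / m * 1 := by gcongr
      _ ≤ D := by rw [hD, mul_one]; exact le_add_of_nonneg_right (by positivity)
  · refine le_trans ?_ hψ2
    have h1 := norm_horizontal_le O (b i₀)
    have h2 := norm_vertical_le O (hess v 0 (b i₀) (b i₀))
    rw [b.norm_eq_one] at h1
    rw [hess_basis hH, abs_of_pos hk] at h2
    rw [neg_le_neg_iff, hess_basis hH]
    have h3 := pow_le_one₀ (n := 2) (norm_nonneg _) h1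
    have h4 : 0 ≤ |L| / m := by positivity
    calc _ ≤ |L| / m * κ i₀ + (|L| / m + (|L| / m) ^ 2) * 1 := by gcongr
      _ ≤ D * (1 + κ i₀) := by
        rw [hD]
        have : 0 ≤ (|L| / m) ^ 2 * κ i₀ := by positivity
        linarith

theorem IsTangentGraph.hasJet_point_normal (hT : IsTangentGraph Ω u x₀ O v) (d : Space n) :
    HasJet (fun t : ℝ => ((tangentPoint u x₀ O v (t • d)).fst,
        ((tangentPoint u x₀ O v (t • d)).snd, O (upwardNormal v (t • d)))))
      (x₀, (u x₀, upwardNormal u x₀)) ((O (WithLp.toLp 2 (d, (0 : ℝ)))).fst,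
        ((O (WithLp.toLp 2 (d, (0 : ℝ)))).snd,
          O (WithLp.toLp 2 (-sharp n (hess v 0 d), (0 : ℝ)))))
      ((O (WithLp.toLp 2 ((0 : Space n), hess v 0 d d))).fst,
        ((O (WithLp.toLp 2 ((0 : Space n), hess v 0 d d))).snd,
          O (WithLp.toLp 2 (-sharp n (third v 0 d d), -‖sharp n (hess v 0 d)‖ ^ 2)))) := by
  have h1 := (hT.hasJet_tangentPoint d).clm (WithLp.fstL 2 ℝ (Space n) ℝ)
  have h2 := (hT.hasJet_tangentPoint d).clm (WithLp.sndL 2 ℝ (Space n) ℝ)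
  exact h1.prodMk (h2.prodMk (hT.hasJet_normal d))

theorem norm_triple_le {a : Space n} {s : ℝ} {N : Ambient n} {A B : ℝ} (h1 : ‖(a, s)‖ ≤ A)
    (h2 : ‖N‖ ≤ B) : ‖(a, (s, N))‖ ≤ max A B := by
  rw [Prod.norm_def, max_le_iff] at h1
  exact max_le (h1.1.trans (le_max_left _ _))
    (max_le (h1.2.trans (le_max_left _ _)) (h2.trans (le_max_right _ _)))

theorem norm_le_sum_abs_inner (b : OrthonormalBasis (Fin n) ℝ (Space n)) (a : Space n) :
    ‖a‖ ≤ ∑ i, |inner ℝ (b i) a| := by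
  conv_lhs => rw [← b.sum_repr' a]
  refine (norm_sum_le _ _).trans (Finset.sum_le_sum fun i _ => ?_)
  rw [norm_smul, b.norm_eq_one, mul_one, Real.norm_eq_abs]

theorem abs_inner_le_of_norm_le {a c : Space n} {R : ℝ} (ha : ‖a‖ ≤ 1) (hc : ‖c‖ ≤ R) :
    |inner ℝ a c| ≤ R :=
  (abs_real_inner_le_norm a c).trans
    ((mul_le_of_le_one_left (norm_nonneg _) ha).trans hc)

/-- The interior bound when the right-hand side depends on the normal, for a suitable weight. -/
theorem exists_interior_bound (hp : 1 ≤ p) (hpn : p ≤ n) (hn : n ≤ 2 * p) (K₁ L R : ℝ) {m : ℝ}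
    (hm : 0 < m) :
    ∃ B : ℝ, 0 ≤ B ∧ ∃ K : ℝ, 0 ≤ K ∧ ∀ (Ω : Set (Space n)) (f : Space n × ℝ × Ambient n → ℝ)
      (u : Space n → ℝ) (x₀ z : Space n) (Λ : ℝ), IsOpen Ω → x₀ ∈ Ω → ‖x₀ - z‖ ≤ R →
      ContDiffOn ℝ ∞ (sphereExtension f) (Ω ×ˢ (Set.univ ×ˢ {0}ᶜ)) →
      m ≤ f (x₀, u x₀, upwardNormal u x₀) →
      (∀ k ≤ 2, ‖iteratedFDeriv ℝ k (sphereExtension f) (x₀, u x₀, upwardNormal u x₀)‖ ≤ L) →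
      ContDiffOn ℝ 4 u Ω →
      ‖gradient u x₀‖ ≤ K₁ → (∀ x ∈ Ω, ∀ s ∈ pSums p (principalCurvatures u x), 0 < s) →
      (∀ x ∈ Ω, curvatureOperator p u x = f (x, u x, upwardNormal u x)) →
      IsWeightedMax Ω u (testWeight (minTilt K₁ / 2) B z u) x₀ Λ →
      Λ * testWeight (minTilt K₁ / 2) B z u x₀ ≤ K := by
  obtain ⟨ℓ, hℓ⟩ : ∃ ℓ : ℝ, ℓ = |L| / m := ⟨_, rfl⟩
  have hℓ0 : 0 ≤ ℓ := by rw [hℓ]; positivity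
  obtain ⟨D, hD⟩ : ∃ D : ℝ, D = ℓ * n ^ 2 + (4 * ℓ + 2 * ℓ ^ 2) := ⟨_, rfl⟩
  have hD0 : 0 ≤ D := by rw [hD]; positivity
  obtain ⟨B, hB, K, hK, hbound⟩ := exists_bound_of_maxInequality hp hpn hn (minTilt_pos K₁)
    (abs_nonneg R) hD0 (abs_nonneg L)
  refine ⟨B, hB, K, hK, ?_⟩
  intro Ω f u x₀ z Λ hΩ hx₀ hz hf hfm hfL hu hK₁ hpos heq hmax
  obtain ⟨O, v, hT⟩ := exists_isTangentGraph hΩ hu hx₀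
  obtain ⟨b, κ, hH⟩ := exists_eigenbasis (hT.contDiffAt.of_le (by norm_num))
  have hκ := pos_of_pSums_pos (hT.principalCurvatures_eq hH) (hpos x₀ hx₀)
  obtain ⟨i₀, h0, hi₀⟩ := hT.exists_index hx₀ hH hmax
  obtain ⟨hL0, hL1, hL2⟩ := norm_fderiv_le_of_iteratedFDeriv hfL
  have hL : L = |L| := (abs_of_nonneg ((abs_nonneg _).trans hL0)).symm
  rw [hL] at hL0 hL1 hL2
  -- At unit vectors the extension agrees with `f`.
  have hunit : ∀ (x : Space n) (s : ℝ) (N : Ambient n), ‖N‖ = 1 →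
      sphereExtension f (x, s, N) = f (x, s, N) := by
    intro x s N hN
    simp [sphereExtension, hN]
  have hν0 : ‖upwardNormal u x₀‖ = 1 := norm_upwardNormal u x₀
  have hνne : upwardNormal u x₀ ≠ 0 := norm_ne_zero_iff.1 (by rw [hν0]; exact one_ne_zero)
  have hfc : ContDiffAt ℝ 2 (sphereExtension f) (x₀, u x₀, upwardNormal u x₀) :=
    (hf.contDiffAt ((hΩ.prod (isOpen_univ.prod isOpen_compl_singleton)).mem_nhds
      ⟨hx₀, Set.mem_univ _, Set.mem_compl_singleton_iff.2 hνne⟩)).of_le (by norm_cast)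
  have hφ : ∀ d : Space n, ∀ᶠ t in 𝓝 (0 : ℝ),
      curvatureOperator p u (tangentPoint u x₀ O v (t • d)).fst =
        sphereExtension f ((tangentPoint u x₀ O v (t • d)).fst,
          ((tangentPoint u x₀ O v (t • d)).snd, O (upwardNormal v (t • d)))) := by
    intro d
    filter_upwards [(tendsto_smul_zero d).eventually hT.eventually] with t ⟨h1, h2, h3, _⟩
    rw [heq _ h1, h2, ← h3, hunit _ _ _ (norm_upwardNormal _ _)]
  rw [← hunit _ _ _ hν0] at hfm
  have hjet := fun d => exists_hasJet_log hm hfc hfm hL1 hL2 (hT.hasJet_point_normal d) (hφ d)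
  have heq0 : sphereExtension f (x₀, u x₀, upwardNormal u x₀) = curvatureOperator p u x₀ := by
    rw [hunit _ _ _ hν0, heq x₀ hx₀]
  simp_rw [heq0, ← hℓ] at hjet
  obtain ⟨ψβ, ψβ₂, hψβ, hψβ1, -⟩ := hjet (verticalDir O).fst
  obtain ⟨ψ₁, ψ₂, hψ, -, hψ2⟩ := hjet (b i₀)
  have hk := pos_of_forall_le hp hpn hκ hi₀
  have hκn := abs_le_of_forall_le hp hpn hκ hi₀
  have hα := minTilt_le hK₁
  have hα0 := minTilt_pos K₁
  have hn1 : (1 : ℝ) ≤ n := by exact_mod_cast hp.trans hpn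
  obtain ⟨hthird, key⟩ := hT.maxInequality hH hpos hκ (by linarith) hmax h0 hψβ rfl
    (fun i => rfl) (fun i => rfl) (fun i => rfl) rfl
  rw [← h0]
  refine hbound κ i₀ _ _ _ _ _ ψβ ψ₂ hκ hi₀ ?_ hα (inv_areaElement_le_one u x₀)
    (fun i => (verticalDir_bounds O b i).2.1) (fun i => ?_) (fun i => ?_) ?_ ?_ ?_ (key ψ₁ ψ₂ hψ)
  · rw [← prod_pSums_map_univ, ← hT.principalCurvatures_eq hH, ← curvatureOperator, ← heq0]
    exact (le_abs_self _).trans hL0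
  · refine abs_inner_le_of_norm_le ?_ (hz.trans (le_abs_self R))
    refine (WithLp.norm_fst_le _ _).trans (le_of_eq ?_)
    rw [LinearIsometryEquiv.norm_map, norm_toLp_zero_right, b.norm_eq_one]
  · refine le_trans ?_ (verticalDir_bounds O b i).2.2
    rw [hT.verticalDir_snd]
    gcongr
  · refine abs_inner_le_of_norm_le ?_ (hz.trans (le_abs_self R))
    rw [← hν0]
    exact WithLp.norm_fst_le _ _
  · refine hψβ1.trans ?_
    have h1 : ‖sharp n (hess v 0 (verticalDir O).fst)‖ ≤ n ^ 2 * κ i₀ := by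
      refine (norm_le_sum_abs_inner b _).trans ?_
      have h2 : ∀ i ∈ Finset.univ, |inner ℝ (b i) (sharp n (hess v 0 (verticalDir O).fst))| ≤
          n * κ i₀ := by
        intro i _
        rw [real_inner_comm, inner_sharp, hess, fderiv_fderiv_symm (hT.contDiffAt.of_le
          (by norm_num)), ← hess, hH, abs_mul]
        exact (mul_le_of_le_one_right (abs_nonneg _) (verticalDir_bounds O b i).2.1).trans (hκn i)
      refine (Finset.sum_le_sum h2).trans (le_of_eq ?_)
      rw [Finset.sum_const, Finset.card_univ, Fintype.card_fin, nsmul_eq_mul]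
      ring
    have h2 := norm_triple_le ((norm_horizontal_le O _).trans (verticalDir_bounds O b i₀).1)
      (N := O (WithLp.toLp 2 (-sharp n (hess v 0 (verticalDir O).fst), (0 : ℝ))))
      (B := n ^ 2 * κ i₀) (by
        rw [LinearIsometryEquiv.norm_map, norm_toLp_zero_right, norm_neg]; exact h1)
    have h3 : max 1 (n ^ 2 * κ i₀) ≤ n ^ 2 * (1 + κ i₀) := by
      have : (1 : ℝ) ≤ n ^ 2 := one_le_pow₀ hn1
      refine max_le ?_ (by gcongr; linarith)
      exact one_le_mul_of_one_le_of_one_le this (by linarith)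
    calc _ ≤ ℓ * (n ^ 2 * (1 + κ i₀)) := by
          gcongr
          exact h2.trans h3
      _ ≤ D * (1 + κ i₀) := by
        rw [hD, ← mul_assoc]
        gcongr
        exact le_add_of_nonneg_right (by positivity)
  · refine le_trans ?_ hψ2
    rw [neg_le_neg_iff]
    have h1 := norm_triple_le (norm_horizontal_le O (b i₀))
      (N := O (WithLp.toLp 2 (-sharp n (hess v 0 (b i₀)), (0 : ℝ)))) (B := κ i₀) (by
        rw [LinearIsometryEquiv.norm_map, norm_toLp_zero_right, norm_neg, sharp_hess_basis hH,
          norm_smul, b.norm_eq_one, mul_one, Real.norm_eq_abs, abs_of_pos hk])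
    -- The third derivatives of `v` in the second derivative of the normal are those determined by
    -- the first order condition at the maximum.
    have h2 : ‖sharp n (third v 0 (b i₀) (b i₀))‖ ≤ ∑ i, |κ i₀ *
        (-(κ i * inner ℝ (b i) (verticalDir O).fst / ((areaElement u x₀)⁻¹ - minTilt K₁ / 2)) -
          B * inner ℝ (O (WithLp.toLp 2 (b i, (0 : ℝ)))).fst (x₀ - z))| := by
      refine (norm_le_sum_abs_inner b _).trans (le_of_eq (Finset.sum_congr rfl fun i _ => ?_))
      have h3 : ContDiffAt ℝ 3 v 0 := hT.contDiffAt.of_le (by norm_num)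
      rw [real_inner_comm, inner_sharp, ← hthird, third_symm' h3, third_symm h3]
    have h3 := norm_triple_le (norm_vertical_le O (hess v 0 (b i₀) (b i₀)))
      (N := O (WithLp.toLp 2 (-sharp n (third v 0 (b i₀) (b i₀)),
        -‖sharp n (hess v 0 (b i₀))‖ ^ 2))) (B := _ + κ i₀ ^ 2) (by
        rw [LinearIsometryEquiv.norm_map]
        refine (norm_toLp_le _ _).trans (add_le_add ((norm_neg _).trans_le h2) (le_of_eq ?_))
        rw [sharp_hess_basis hH, norm_smul, b.norm_eq_one, mul_one, Real.norm_eq_abs, sq_abs,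
          abs_neg, abs_of_nonneg (sq_nonneg _)])
    rw [hess_basis hH, abs_of_pos hk] at h3
    rw [b.norm_eq_one] at h1
    rw [hess_basis hH]
    have hsum : 0 ≤ ∑ i, |κ i₀ *
        (-(κ i * inner ℝ (b i) (verticalDir O).fst / ((areaElement u x₀)⁻¹ - minTilt K₁ / 2)) -
          B * inner ℝ (O (WithLp.toLp 2 (b i, (0 : ℝ)))).fst (x₀ - z))| :=
      Finset.sum_nonneg fun i _ => abs_nonneg _
    generalize ∑ i, |κ i₀ *
        (-(κ i * inner ℝ (b i) (verticalDir O).fst / ((areaElement u x₀)⁻¹ - minTilt K₁ / 2)) -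
          B * inner ℝ (O (WithLp.toLp 2 (b i, (0 : ℝ)))).fst (x₀ - z))| = Z at *
    have h4 := h1.trans (max_le_add_of_nonneg zero_le_one hk.le)
    have h5 : max (κ i₀) (Z + κ i₀ ^ 2) ≤ 1 + κ i₀ ^ 2 + Z := by
      refine max_le ?_ (by linarith)
      nlinarith [sq_nonneg (κ i₀ - 1)]
    have h6 := h3.trans h5
    calc _ ≤ ℓ * (1 + κ i₀ ^ 2 + Z) + (ℓ + ℓ ^ 2) * (1 + κ i₀) ^ 2 := by gcongr
      _ ≤ ℓ * (1 + κ i₀ ^ 2 + Z) + (ℓ + ℓ ^ 2) * (2 * (1 + κ i₀ ^ 2 + Z)) := by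
        gcongr
        nlinarith [sq_nonneg (κ i₀ - 1)]
      _ ≤ D * (1 + κ i₀ ^ 2 + Z) := by
        have h7 : 0 ≤ ℓ * (n ^ 2 + 1) * (1 + κ i₀ ^ 2 + Z) := by positivity
        rw [hD]
        linarith

end InteriorBound

end PrescribedCurvature

namespace PrescribedCurvature

open Filter Topology

set_option maxSynthPendingDepth 3

/-! ### From the maximum of the test function to the bound for the Hessian -/

section GlobalMaximum

variable {n p : ℕ} {Ω : Set (Space n)} {u : Space n → ℝ}

theorem secondForm_smul (u : Space n → ℝ) (x : Space n) (c : ℝ) (ξ : Space n) :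
    secondForm u x (c • ξ) (c • ξ) = c ^ 2 * secondForm u x ξ ξ := by
  simp only [secondForm, map_smul, smul_apply, smul_eq_mul]
  ring

theorem metricForm_smul (u : Space n → ℝ) (x : Space n) (c : ℝ) (ξ : Space n) :
    metricForm u x (c • ξ) (c • ξ) = c ^ 2 * metricForm u x ξ ξ := by
  simp only [metricForm_self, map_smul, norm_smul, smul_eq_mul, mul_pow, Real.norm_eq_abs, sq_abs]
  ring

theorem norm_gradient (u : Space n → ℝ) (x : Space n) : ‖gradient u x‖ = ‖fderiv ℝ u x‖ := by
  rw [gradient_eq_sharp, norm_sharp]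

/-- A symmetric bilinear form is bounded by its quadratic form. -/
theorem norm_le_of_quadratic_le {A : Space n →L[ℝ] Space n →L[ℝ] ℝ}
    (hA : ∀ a b, A a b = A b a) {C : ℝ} (hC : 0 ≤ C) (h : ∀ a, |A a a| ≤ C * ‖a‖ ^ 2) :
    ‖A‖ ≤ C := by
  refine ContinuousLinearMap.opNorm_le_of_unit_norm hC fun a ha =>
    ContinuousLinearMap.opNorm_le_of_unit_norm hC fun b hb => ?_
  have e : A a b = (A (a + b) (a + b) - A (a - b) (a - b)) / 4 := by
    simp only [map_add, map_sub, add_apply, sub_apply, hA b a]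
    ring
  have h1 := abs_le.1 (h (a + b))
  have h2 := abs_le.1 (h (a - b))
  have h3 := parallelogram_law_with_norm ℝ a b
  rw [ha, hb] at h3
  have h4 : C * ‖a + b‖ ^ 2 + C * ‖a - b‖ ^ 2 = 4 * C := by
    linear_combination C * h3
  rw [Real.norm_eq_abs, e, abs_le]
  constructor <;> linarith [h1.1, h1.2, h2.1, h2.2]

theorem boundarySupHess_nonneg (Ω : Set (Space n)) (u : Space n → ℝ) : 0 ≤ boundarySupHess Ω u :=
  Real.sSup_nonneg (by rintro _ ⟨y, -, rfl⟩; exact norm_nonneg _)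

theorem norm_le_boundarySupHess (hb : Bornology.IsBounded Ω)
    {H : Space n → (Space n →L[ℝ] Space n →L[ℝ] ℝ)} (hH : ContinuousOn H (closure Ω))
    (hHu : Set.EqOn H (hess u) Ω) {y : Space n} (hy : y ∈ frontier Ω) :
    ‖H y‖ ≤ boundarySupHess Ω u := by
  have hext : ∀ y ∈ frontier Ω, extendFrom Ω (hess u) y = H y := by
    intro y hy
    refine extendFrom_eq (frontier_subset_closure hy) ?_
    refine ((hH y (frontier_subset_closure hy)).mono_left
      (nhdsWithin_mono y subset_closure)).congr' ?_
    filter_upwards [self_mem_nhdsWithin] with x hx using hHu hx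
  have himg : (fun y => ‖extendFrom Ω (hess u) y‖) '' frontier Ω = (fun y => ‖H y‖) '' frontier Ω :=
    Set.image_congr fun y hy => by rw [hext y hy]
  rw [boundarySupHess, himg]
  have hcpt : IsCompact (frontier Ω) :=
    Metric.isCompact_of_isClosed_isBounded isClosed_frontier
      (hb.closure.subset frontier_subset_closure)
  exact le_csSup (hcpt.bddAbove_image (hH.mono frontier_subset_closure).norm)
    (Set.mem_image_of_mem _ hy)

/-- The test function has a maximum over the closure of `Ω`. If it lies over the boundary, it is
controlled by the boundary values of `D²u`. -/
theorem secondForm_le_of_interior_bound (hn : 0 < n) (hΩ : IsOpen Ω) (hne : Ω.Nonempty)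
    (hb : Bornology.IsBounded Ω) (hu : IsC2UpToBoundary Ω u) {K₁ a B E K : ℝ} {z : Space n}
    (hK₁ : ∀ x ∈ Ω, ‖gradient u x‖ ≤ K₁) (ha0 : 0 ≤ a) (ha : a < minTilt K₁) (hB : 0 ≤ B)
    (hE : ∀ x ∈ Ω, B * (‖x - z‖ ^ 2 / 2) ≤ E) (hK : 0 ≤ K)
    (hint : ∀ x₀ ∈ Ω, ∀ Λ, IsWeightedMax Ω u (testWeight a B z u) x₀ Λ →
      Λ * testWeight a B z u x₀ ≤ K) {x : Space n} (hx : x ∈ Ω) (ξ : Space n) :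
    secondForm u x ξ ξ ≤
      (K + boundarySupHess Ω u) / ((minTilt K₁ - a) * Real.exp (-E)) * metricForm u x ξ ξ := by
  obtain ⟨-, -, ⟨P, hP, hPu⟩, H, hH, hHu⟩ := hu
  obtain ⟨c, hc⟩ : ∃ c : ℝ, c = (minTilt K₁ - a) * Real.exp (-E) := ⟨_, rfl⟩
  have hc0 : 0 < c := by
    rw [hc]; exact mul_pos (by linarith) (Real.exp_pos _)
  rw [← hc]
  have hS := boundarySupHess_nonneg Ω u
  have hw : ∀ x, √(1 + ‖fderiv ℝ u x‖ ^ 2) = areaElement u x := fun x => by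
    rw [areaElement, norm_gradient]
  -- The bounds for the gradient and for the distance extend to the closure.
  have hPle : ∀ x ∈ closure Ω, ‖P x‖ ≤ K₁ := by
    intro x hx
    refine closure_minimal (s := Ω) (t := closure Ω ∩ (fun x => ‖P x‖) ⁻¹' Set.Iic K₁) ?_
      (hP.norm.preimage_isClosed_of_isClosed isClosed_closure isClosed_Iic) hx |>.2
    intro y hy
    refine ⟨subset_closure hy, ?_⟩
    change ‖P y‖ ≤ K₁
    rw [hPu hy, ← norm_gradient]
    exact hK₁ y hy
  have hEle : ∀ x ∈ closure Ω, B * (‖x - z‖ ^ 2 / 2) ≤ E := by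
    intro x hx
    exact closure_minimal (s := Ω) (t := {x | B * (‖x - z‖ ^ 2 / 2) ≤ E}) hE
      (isClosed_le (by fun_prop) continuous_const) hx
  have hW0 : ∀ x, 0 < √(1 + ‖P x‖ ^ 2) := fun x => Real.sqrt_pos.2 (by positivity)
  have hW1 : ∀ x, 1 ≤ √(1 + ‖P x‖ ^ 2) := fun x =>
    Real.one_le_sqrt.2 (le_add_of_nonneg_right (by positivity))
  obtain ⟨V, hV⟩ : ∃ V : Space n → ℝ, ∀ x,
      V x = ((√(1 + ‖P x‖ ^ 2))⁻¹ - a) * Real.exp (-(B * (‖x - z‖ ^ 2 / 2))) := ⟨_, fun _ => rfl⟩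
  have hVu : ∀ x ∈ Ω, V x = testWeight a B z u x := by
    intro x hx
    rw [hV, testWeight, hPu hx, hw]
  have hVc : ∀ x ∈ closure Ω, c ≤ V x := by
    intro x hx
    have h1 : minTilt K₁ ≤ (√(1 + ‖P x‖ ^ 2))⁻¹ :=
      inv_anti₀ (hW0 x) (Real.sqrt_le_sqrt (by gcongr; exact hPle x hx))
    rw [hc, hV]
    refine mul_le_mul (by linarith) (Real.exp_le_exp.2 (neg_le_neg (hEle x hx)))
      (Real.exp_pos _).le (by linarith)
  have hV1 : ∀ x, V x ≤ 1 := by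
    intro x
    rw [hV]
    refine mul_le_one₀ ?_ (Real.exp_pos _).le (Real.exp_le_one_iff.2 ?_)
    · have := inv_le_one_of_one_le₀ (hW1 x)
      linarith
    · have : 0 ≤ B * (‖x - z‖ ^ 2 / 2) := by positivity
      linarith
  have hg0 : ∀ x ξ, ‖ξ‖ = 1 → 1 ≤ ‖ξ‖ ^ 2 + P x ξ ^ 2 := by
    intro x ξ hξ
    rw [hξ]
    linarith [sq_nonneg (P x ξ)]
  obtain ⟨Φ, hΦ⟩ : ∃ Φ : Space n × Space n → ℝ, ∀ q, Φ q =
      H q.1 q.2 q.2 / (√(1 + ‖P q.1‖ ^ 2) * (V q.1 * (‖q.2‖ ^ 2 + P q.1 q.2 ^ 2))) :=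
    ⟨_, fun _ => rfl⟩
  have hden : ∀ x ∈ closure Ω, ∀ ξ, ‖ξ‖ = 1 →
      c ≤ √(1 + ‖P x‖ ^ 2) * (V x * (‖ξ‖ ^ 2 + P x ξ ^ 2)) := by
    intro x hx ξ hξ
    calc c = 1 * (c * 1) := by ring
      _ ≤ _ := by
        have h1 := hW1 x
        have h2 := hVc x hx
        have h3 := hg0 x ξ hξ
        gcongr
        linarith
  -- The maximum exists by compactness.
  have hcpt : IsCompact (closure Ω ×ˢ Metric.sphere (0 : Space n) 1) :=
    (Metric.isCompact_of_isClosed_isBounded isClosed_closure hb.closure).prod (isCompact_sphere 0 1)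
  have hnon : (closure Ω ×ˢ Metric.sphere (0 : Space n) 1).Nonempty := by
    refine (hne.mono subset_closure).prod ⟨EuclideanSpace.single ⟨0, hn⟩ 1, ?_⟩
    simp
  have hcont : ContinuousOn Φ (closure Ω ×ˢ Metric.sphere (0 : Space n) 1) := by
    have hP' : ContinuousOn (fun q : Space n × Space n => P q.1)
        (closure Ω ×ˢ Metric.sphere (0 : Space n) 1) :=
      hP.comp continuousOn_fst fun q hq => hq.1
    have hH' : ContinuousOn (fun q : Space n × Space n => H q.1)
        (closure Ω ×ˢ Metric.sphere (0 : Space n) 1) :=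
      hH.comp continuousOn_fst fun q hq => hq.1
    have hWc : ContinuousOn (fun q : Space n × Space n => √(1 + ‖P q.1‖ ^ 2))
        (closure Ω ×ˢ Metric.sphere (0 : Space n) 1) :=
      (continuousOn_const.add (hP'.norm.pow 2)).sqrt
    have hVc' : ContinuousOn (fun q : Space n × Space n => V q.1)
        (closure Ω ×ˢ Metric.sphere (0 : Space n) 1) := by
      simp_rw [hV]
      refine ((hWc.inv₀ fun q _ => (hW0 q.1).ne').sub continuousOn_const).mul
        (Continuous.continuousOn ?_)
      fun_prop
    rw [show Φ = _ from funext hΦ]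
    refine ((hH'.clm_apply continuousOn_snd).clm_apply continuousOn_snd).div
      (hWc.mul (hVc'.mul (((continuousOn_snd.norm).pow 2).add
        ((hP'.clm_apply continuousOn_snd).pow 2)))) ?_
    intro q hq
    exact (hc0.trans_le (hden q.1 hq.1 q.2 (by simpa using hq.2))).ne'
  obtain ⟨⟨x₀, ξ₀⟩, ⟨hx₀, hξ₀⟩, hmax⟩ := hcpt.exists_isMaxOn hnon hcont
  have hξ₀1 : ‖ξ₀‖ = 1 := by simpa using hξ₀
  obtain ⟨Λ, hΛ⟩ : ∃ Λ, Λ = Φ (x₀, ξ₀) := ⟨_, rfl⟩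
  have hform : ∀ x ∈ Ω, ∀ ξ, ‖ξ‖ = 1 →
      secondForm u x ξ ξ = Φ (x, ξ) * testWeight a B z u x * metricForm u x ξ ξ := by
    intro x hx ξ hξ
    have h1 := hden x (subset_closure hx) ξ hξ
    have h2 := hVc x (subset_closure hx)
    have h3 := hg0 x ξ hξ
    have hW := hW0 x
    rw [hΦ, secondForm, metricForm_self, ← hVu x hx, ← hw, ← hPu hx, ← hHu hx]
    have h4 : V x ≠ 0 := by linarith
    have h5 : ‖ξ‖ ^ 2 + P x ξ ^ 2 ≠ 0 := by linarith
    field_simp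
  have hunit : ∀ x ∈ Ω, ∀ ξ, ‖ξ‖ = 1 →
      secondForm u x ξ ξ ≤ Λ * testWeight a B z u x * metricForm u x ξ ξ := by
    intro x hx ξ hξ
    rw [hform x hx ξ hξ]
    have h1 : Φ (x, ξ) ≤ Λ := by
      rw [hΛ]
      exact hmax ⟨subset_closure hx, by simpa using hξ⟩
    have h2 := hVc x (subset_closure hx)
    rw [hVu x hx] at h2
    have h3 : 0 ≤ metricForm u x ξ ξ := by rw [metricForm_self]; positivity
    gcongr
    linarith
  have hle : ∀ x ∈ Ω, ∀ ξ, secondForm u x ξ ξ ≤ Λ * testWeight a B z u x * metricForm u x ξ ξ := by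
    intro x hx ξ
    rcases eq_or_ne ξ 0 with rfl | hξ
    · simp [secondForm, metricForm]
    have h1 := hunit x hx (‖ξ‖⁻¹ • ξ) (norm_smul_inv_norm (𝕜 := ℝ) hξ)
    rw [secondForm_smul, metricForm_smul] at h1
    have h2 : 0 < ‖ξ‖⁻¹ ^ 2 := by positivity
    refine le_of_mul_le_mul_left ?_ h2
    linarith
  have hΛle : Λ ≤ (K + boundarySupHess Ω u) / c := by
    rw [le_div_iff₀ hc0]
    rcases le_or_gt Λ 0 with hneg | hpos
    · exact (mul_nonpos_of_nonpos_of_nonneg hneg hc0.le).trans (by positivity)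
    by_cases hx₀Ω : x₀ ∈ Ω
    · have hwm : IsWeightedMax Ω u (testWeight a B z u) x₀ Λ := by
        refine ⟨hle, ξ₀, ?_, ?_⟩
        · exact norm_ne_zero_iff.1 (by rw [hξ₀1]; exact one_ne_zero)
        · rw [hform x₀ hx₀Ω ξ₀ hξ₀1, ← hΛ]
      have h1 := hint x₀ hx₀Ω Λ hwm
      have h2 := hVc x₀ hx₀
      rw [hVu x₀ hx₀Ω] at h2
      have h3 : Λ * c ≤ Λ * testWeight a B z u x₀ := by gcongr
      linarith
    · have hfr : x₀ ∈ frontier Ω := ⟨hx₀, by rwa [hΩ.interior_eq]⟩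
      have h1 := norm_le_boundarySupHess hb hH hHu hfr
      have h2 : H x₀ ξ₀ ξ₀ ≤ ‖H x₀‖ := by
        have := (H x₀).le_opNorm₂ ξ₀ ξ₀
        rw [hξ₀1, mul_one, mul_one] at this
        exact (le_abs_self _).trans this
      have h3 := hden x₀ hx₀ ξ₀ hξ₀1
      have h4 : Λ * (√(1 + ‖P x₀‖ ^ 2) * (V x₀ * (‖ξ₀‖ ^ 2 + P x₀ ξ₀ ^ 2))) = H x₀ ξ₀ ξ₀ := by
        rw [hΛ, hΦ]
        exact div_mul_cancel₀ _ (hc0.trans_le h3).ne'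
      have h5 : Λ * c ≤ Λ * (√(1 + ‖P x₀‖ ^ 2) * (V x₀ * (‖ξ₀‖ ^ 2 + P x₀ ξ₀ ^ 2))) := by gcongr
      linarith
  refine (hle x hx ξ).trans ?_
  have h3 : 0 ≤ metricForm u x ξ ξ := by rw [metricForm_self]; positivity
  have h4 := hVc x (subset_closure hx)
  have h5 := hV1 x
  rw [hVu x hx] at h4 h5
  refine mul_le_mul_of_nonneg_right ?_ h3
  have h6 : 0 ≤ (K + boundarySupHess Ω u) / c := by positivity
  calc Λ * testWeight a B z u x ≤ (K + boundarySupHess Ω u) / c * testWeight a B z u x := by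
        gcongr
        linarith
    _ ≤ (K + boundarySupHess Ω u) / c := mul_le_of_le_one_right h6 h5

/-- An upper bound for the second fundamental form gives a bound for `D²u`: by admissibility the
negative principal curvatures are controlled by the positive ones. -/
theorem norm_hess_le_of_secondForm_le (hp : 1 ≤ p) (hpn : p ≤ n) (hΩ : IsOpen Ω)
    (hu : ContDiffOn ℝ 4 u Ω) {x : Space n} (hx : x ∈ Ω) {K₁ Q : ℝ} (hK₁ : ‖gradient u x‖ ≤ K₁)
    (hpos : ∀ s ∈ pSums p (principalCurvatures u x), 0 < s)
    (hQ : ∀ ξ, secondForm u x ξ ξ ≤ Q * metricForm u x ξ ξ) :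
    ‖hess u x‖ ≤ n * (1 + K₁ ^ 2) ^ 2 * Q := by
  obtain ⟨e, κ, hκ, he, hξ⟩ := exists_principal_frame hΩ hu hx
  have hκpos := pos_of_pSums_pos hκ hpos
  have hκQ : ∀ i, κ i ≤ Q := by
    intro i
    have := hQ (e i)
    rwa [(he i).1, (he i).2, mul_one] at this
  have hQ0 := pos_of_forall_le hp hpn hκpos hκQ
  have hκabs := abs_le_of_forall_le hp hpn hκpos hκQ
  refine norm_le_of_quadratic_le (fderiv_fderiv_symm ((hu.contDiffAt (hΩ.mem_nhds hx)).of_le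
    (by norm_num))) (by positivity) fun ξ => ?_
  obtain ⟨c, h1, h2⟩ := hξ ξ
  have h3 : |secondForm u x ξ ξ| ≤ n * Q * metricForm u x ξ ξ := by
    rw [h1, h2, Finset.mul_sum]
    refine (Finset.abs_sum_le_sum_abs _ _).trans (Finset.sum_le_sum fun i _ => ?_)
    rw [abs_mul, abs_of_nonneg (sq_nonneg (c i))]
    exact mul_le_mul_of_nonneg_right (hκabs i) (sq_nonneg _)
  have hK : ‖fderiv ℝ u x‖ ≤ K₁ := by rwa [← norm_gradient]
  have h4 : metricForm u x ξ ξ ≤ (1 + K₁ ^ 2) * ‖ξ‖ ^ 2 := by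
    have h5 : |fderiv ℝ u x ξ| ≤ K₁ * ‖ξ‖ := ((fderiv ℝ u x).le_opNorm ξ).trans (by gcongr)
    have h6 : fderiv ℝ u x ξ ^ 2 ≤ (K₁ * ‖ξ‖) ^ 2 :=
      sq_le_sq' (abs_le.1 h5).1 (abs_le.1 h5).2
    rw [metricForm_self]
    linarith
  have hw0 := areaElement_pos u x
  have h5 : areaElement u x ≤ 1 + K₁ ^ 2 := by
    have h6 : areaElement u x ^ 2 ≤ 1 + K₁ ^ 2 := by
      rw [areaElement_sq]; gcongr
    have h7 : 1 ≤ areaElement u x :=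
      Real.one_le_sqrt.2 (le_add_of_nonneg_right (by positivity))
    nlinarith
  have h6 : hess u x ξ ξ = areaElement u x * secondForm u x ξ ξ := by
    rw [secondForm]; field_simp
  change |hess u x ξ ξ| ≤ _
  rw [h6, abs_mul, abs_of_pos hw0]
  calc areaElement u x * |secondForm u x ξ ξ|
      ≤ (1 + K₁ ^ 2) * (n * Q * ((1 + K₁ ^ 2) * ‖ξ‖ ^ 2)) := by
        refine mul_le_mul h5 (h3.trans ?_) (abs_nonneg _) (by positivity)
        gcongr
    _ = n * (1 + K₁ ^ 2) ^ 2 * Q * ‖ξ‖ ^ 2 := by ring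

/-- The global bound, given the interior bound. -/
theorem norm_hess_le_of_interior_bound (hp : 1 ≤ p) (hpn : p ≤ n) (hΩ : IsOpen Ω)
    (hb : Bornology.IsBounded Ω) (hu : ContDiffOn ℝ 4 u Ω) (hu2 : IsC2UpToBoundary Ω u)
    {K₁ a B E K : ℝ} {z : Space n}
    (hK₁ : ∀ x ∈ Ω, ‖gradient u x‖ ≤ K₁) (ha0 : 0 ≤ a) (ha : a < minTilt K₁) (hB : 0 ≤ B)
    (hE : ∀ x ∈ Ω, B * (‖x - z‖ ^ 2 / 2) ≤ E) (hK : 0 ≤ K)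
    (hpos : ∀ x ∈ Ω, ∀ s ∈ pSums p (principalCurvatures u x), 0 < s)
    (hint : ∀ x₀ ∈ Ω, ∀ Λ, IsWeightedMax Ω u (testWeight a B z u) x₀ Λ →
      Λ * testWeight a B z u x₀ ≤ K) {x : Space n} (hx : x ∈ Ω) :
    ‖hess u x‖ ≤ n * (1 + K₁ ^ 2) ^ 2 * ((K + 1) / ((minTilt K₁ - a) * Real.exp (-E))) *
      (1 + boundarySupHess Ω u) := by
  refine (norm_hess_le_of_secondForm_le hp hpn hΩ hu hx (hK₁ x hx) (hpos x hx)
    (secondForm_le_of_interior_bound (hp.trans hpn) hΩ ⟨x, hx⟩ hb hu2 hK₁ ha0 ha hB hE hK hint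
      hx)).trans ?_
  have h1 : 0 < (minTilt K₁ - a) * Real.exp (-E) := mul_pos (by linarith) (Real.exp_pos _)
  have h2 := boundarySupHess_nonneg Ω u
  rw [mul_assoc, mul_assoc (_ * _)]
  rw [← mul_assoc]
  gcongr
  rw [div_mul_eq_mul_div]
  gcongr
  have : 0 ≤ K * boundarySupHess Ω u := by positivity
  linarith

end GlobalMaximum

end PrescribedCurvature

open PrescribedCurvature in
theorem mainTheorem4 (n p : ℕ) (hp : 1 ≤ p) (hpn : p ≤ n) :
    -- right-hand side `f(x, u, ν)`, under the assumption `p ≥ n / 2`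
    (n ≤ 2 * p → ∀ K₀ K₁ m L R : ℝ, 0 < m → ∃ C : ℝ, 0 < C ∧
      ∀ (Ω : Set (Space n)) (f : Space n × ℝ × Ambient n → ℝ) (u : Space n → ℝ),
        IsOpen Ω → IsConnected Ω → Bornology.IsBounded Ω → Metric.diam Ω ≤ R →
        ContDiffOn ℝ ∞ (sphereExtension f) (Ω ×ˢ (Set.univ ×ˢ {0}ᶜ)) →
        (∀ x ∈ Ω, ∀ z : ℝ, |z| ≤ K₀ → ∀ ν : Ambient n, ‖ν‖ = 1 →
          m ≤ f (x, z, ν) ∧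
          ∀ k ≤ 2, ‖iteratedFDeriv ℝ k (sphereExtension f) (x, z, ν)‖ ≤ L) →
        ContDiffOn ℝ 4 u Ω → IsC2UpToBoundary Ω u →
        (∀ x ∈ Ω, |u x| ≤ K₀ ∧ ‖gradient u x‖ ≤ K₁) →
        Admissible p Ω u →
        (∀ x ∈ Ω, curvatureOperator p u x = f (x, u x, upwardNormal u x)) →
        ∀ x ∈ Ω, ‖hess u x‖ ≤ C * (1 + boundarySupHess Ω u)) ∧
    -- right-hand side `f(x, u)`, for every `p` with `1 ≤ p ≤ n`
    (∀ K₀ K₁ m L : ℝ, 0 < m → ∃ C : ℝ, 0 < C ∧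
      ∀ (Ω : Set (Space n)) (f : Space n × ℝ → ℝ) (u : Space n → ℝ),
        IsOpen Ω → IsConnected Ω → Bornology.IsBounded Ω →
        ContDiffOn ℝ ∞ f (Ω ×ˢ Set.univ) →
        (∀ x ∈ Ω, ∀ z : ℝ, |z| ≤ K₀ →
          m ≤ f (x, z) ∧ ∀ k ≤ 2, ‖iteratedFDeriv ℝ k f (x, z)‖ ≤ L) →
        ContDiffOn ℝ 4 u Ω → IsC2UpToBoundary Ω u →
        (∀ x ∈ Ω, |u x| ≤ K₀ ∧ ‖gradient u x‖ ≤ K₁) →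
        Admissible p Ω u →
        (∀ x ∈ Ω, curvatureOperator p u x = f (x, u x)) →
        ∀ x ∈ Ω, ‖hess u x‖ ≤ C * (1 + boundarySupHess Ω u)) := by
  have hn : 0 < n := hp.trans hpn
  refine ⟨fun hn2 K₀ K₁ m L R hm => ?_, fun K₀ K₁ m L hm => ?_⟩
  · obtain ⟨B, hB, K, hK, hint⟩ := exists_interior_bound hp hpn hn2 K₁ L R hm
    have hα := minTilt_pos K₁
    -- The weight `(1 / w - a) exp (-B |x - z|² / 2)` with `a` half the lower bound of `1 / w`
    -- and `z` any point of `Ω`.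
    refine ⟨n * (1 + K₁ ^ 2) ^ 2 * ((K + 1) / ((minTilt K₁ - minTilt K₁ / 2) *
      Real.exp (-(B * (R ^ 2 / 2))))), ?_, ?_⟩
    · have : 0 < minTilt K₁ - minTilt K₁ / 2 := by linarith
      positivity
    intro Ω f u hΩ hconn hb hdiam hf hfb hu hu2 hu1 hadm heq x hx
    obtain ⟨z, hz⟩ := hconn.nonempty
    have hdist : ∀ x ∈ Ω, ‖x - z‖ ≤ R := fun x hx => by
      rw [← dist_eq_norm]
      exact (Metric.dist_le_diam_of_mem hb hx hz).trans hdiam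
    have hpos : ∀ x ∈ Ω, ∀ s ∈ pSums p (principalCurvatures u x), 0 < s := fun x hx =>
      forall_pos_of_prod_pos (hadm x hx) (by
        have := (hfb x hx (u x) (hu1 x hx).1 _ (norm_upwardNormal u x)).1
        rw [← heq x hx] at this
        exact hm.trans_le this)
    refine norm_hess_le_of_interior_bound hp hpn hΩ hb hu hu2 (fun x hx => (hu1 x hx).2)
      (z := z) (by positivity) (by linarith) hB (fun x hx => ?_) hK hpos
      (fun x₀ hx₀ Λ hmax => ?_) hx
    · have := hdist x hx
      gcongr
    · have hfx := hfb x₀ hx₀ (u x₀) (hu1 x₀ hx₀).1 _ (norm_upwardNormal u x₀)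
      exact hint Ω f u x₀ z Λ hΩ hx₀ (hdist x₀ hx₀) hf hfx.1 hfx.2 hu (hu1 x₀ hx₀).2 hpos heq hmax
  · obtain ⟨K, hK, hint⟩ := exists_interior_bound_of_const hp hpn K₁ L hm
    have hα := minTilt_pos K₁
    -- The weight `1 / w` suffices.
    refine ⟨n * (1 + K₁ ^ 2) ^ 2 * ((K + 1) / ((minTilt K₁ - 0) * Real.exp (-0))), ?_, ?_⟩
    · rw [sub_zero]
      positivity
    intro Ω f u hΩ hconn hb hf hfb hu hu2 hu1 hadm heq x hx
    have hpos : ∀ x ∈ Ω, ∀ s ∈ pSums p (principalCurvatures u x), 0 < s := fun x hx =>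
      forall_pos_of_prod_pos (hadm x hx) (by
        have := (hfb x hx (u x) (hu1 x hx).1).1
        rw [← heq x hx] at this
        exact hm.trans_le this)
    refine norm_hess_le_of_interior_bound hp hpn hΩ hb hu hu2 (fun x hx => (hu1 x hx).2)
      (B := 0) (z := 0) le_rfl hα le_rfl (fun x hx => (zero_mul _).le) hK hpos
      (fun x₀ hx₀ Λ hmax => ?_) hx
    have hfx := hfb x₀ hx₀ (u x₀) (hu1 x₀ hx₀).1
    exact hint Ω f u x₀ Λ hΩ hx₀ hf hfx.1 hfx.2 hu (hu1 x₀ hx₀).2 hpos heq hmax
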